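/- Conventions: manifolds, metrics and maps are $C^\infty$; manifolds are Hausdorff, second countable and without boundary. For a map $f:(M,g)\to(N,h)$ of Riemannian manifolds, $\tau(f)=\mathrm{trace}_g\nabla df$ is the tension field and $\tau_2(f)=-\Delta^f\tau(f)-\mathrm{trace}_g R^N(df,\tau(f))df$ the bitension field, where $\Delta^f=-\mathrm{trace}_g\nabla^2$ on sections of $f^{-1}TN$ and $R^N(X,Y)=\nabla_X\nabla_Y-\nabla_Y\nabla_X-\nabla_{[X,Y]}$; $f$ is proper-biharmonic if $\tau_2(f)=0$ identically and $\tau(f)$ is not identically zero. A contact metric structure on $N^{2n+1}$ is $(\varphi,\xi,\eta,g)$ with $\varphi$ a $(1,1)$-tensor field, $\xi$ a vector field, $\eta$ a $1$-form and $g$ a Riemannian metric such that $\varphi^2=-I+\eta\otimes\xi$, $\eta(\xi)=1$, $g(\varphi X,\varphi Y)=g(X,Y)-\eta(X)\eta(Y)$ and $g(X,\varphi Y)=d\eta(X,Y)$, where $d\eta(X,Y)=\frac12\big(X\eta(Y)-Y\eta(X)-\eta([X,Y])\big)$. It is Sasakian if $N_\varphi+2d\eta\otimes\xi=0$, where $N_\varphi(X,Y)=[\varphi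 X,\varphi Y]-\varphi[\varphi X,Y]-\varphi[X,\varphi Y]+\varphi^2[X,Y]$. A Sasakian space form $N^{2n+1}(c)$ is a Sasakian manifold such that, for every unit vector $X\perp\xi$, the sectional curvature of the plane spanned by $X$ and $\varphi X$ equals $c$. A Legendre curve is a curve $\gamma$ with $\eta(\gamma')=0$; it is taken parametrized by arc length, and it is called proper-biharmonic if it is so as a map from its interval of definition, with the metric $ds^2$, to $N$. Let $\phi_t$ denote the (possibly only local) flow of $\xi$. **Theorem.** Let $N^{2n+1}(c)$ be a Sasakian space form, let $M^2$ be a connected surface and $f:M\to N$ an immersion, with the induced metric on $M$, whose image is invariant under the flow of $\xi$ (that is, $\phi_t(q)\in f(M)$ for all $q\in f(M)$ and all $t$ for which $\phi_t(q)$ is defined). Then $f$ is proper-biharmonic if and only if every point of $M$ has a neighbourhood with smooth coordinates $(t,s)\in(-\varepsilon,\varepsilon)\times(a,b)$ in which $f$ is given by $$x(t,s)=\phi_t(\gamma(s)),$$ where $\gamma:(a,b)\to N$ is a proper-biharmonic Legendre curve parametrized by arc length. -/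

import Mathlib

open Set Bundle Manifold
open scoped ContDiff

noncomputable section

/-! ### Riemannian geometry of smooth maps -/

section Riemannian

variable {E : Type*} [NormedAddCommGroup E] [NormedSpace ℝ E]
  {H : Type*} [TopologicalSpace H] {I : ModelWithCorners ℝ E H}
  {N : Type*} [TopologicalSpace N] [ChartedSpace H N] [IsManifold I ∞ N]
  {E' : Type*} [NormedAddCommGroup E'] [NormedSpace ℝ E']
  {H' : Type*} [TopologicalSpace H'] {J : ModelWithCorners ℝ E' H'}
  {M : Type*} [TopologicalSpace M] [ChartedSpace H' M] [IsManifold J ∞ M]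

/-- Smooth Riemannian metrics on the manifold `N`. -/
abbrev SmoothMetric (I : ModelWithCorners ℝ E H) (N : Type*) [TopologicalSpace N]
    [ChartedSpace H N] [IsManifold I ∞ N] :=
  ContMDiffRiemannianMetric I ∞ E (fun x : N ↦ TangentSpace I x)

/-- The components, in the preferred chart at `x`, of a tangent vector at `q`
(for `q` in the domain of that chart). -/
def toChart (I : ModelWithCorners ℝ E H) [IsManifold I ∞ N] (x q : N) :
    TangentSpace I q →L[ℝ] E :=
  (trivializationAt E (fun y : N ↦ TangentSpace I y) x).continuousLinearMapAt ℝ q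

/-- The tangent vector at `q` with given components in the preferred chart at `x`
(for `q` in the domain of that chart). -/
def ofChart (I : ModelWithCorners ℝ E H) [IsManifold I ∞ N] (x q : N) :
    E →L[ℝ] TangentSpace I q :=
  (trivializationAt E (fun y : N ↦ TangentSpace I y) x).symmL ℝ q

/-- The metric at `q` as a bilinear form on the components in the preferred chart at `x`: in
classical notation, the matrix `g_{ij}(q)`. -/
def metricInChart (h : SmoothMetric I N) (x q : N) : E →L[ℝ] E →L[ℝ] ℝ :=
  (ContinuousLinearMap.precomp ℝ (ofChart I x q)).comp ((h.inner q).comp (ofChart I x q))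

/-- The Christoffel symbols of the Levi-Civita connection in the preferred chart at `x`, at the
point `x`: `Γ(u, v)` is the vector with
`g(Γ(u, v), w) = (1/2) (∂_u g(v, w) + ∂_v g(u, w) - ∂_w g(u, v))` for all `w`. -/
def christoffel (h : SmoothMetric I N) (x : N) (u v : TangentSpace I x) : TangentSpace I x :=
  let D : E →L[ℝ] E →L[ℝ] E →L[ℝ] ℝ := (mvfderiv I (metricInChart h x) x).comp (ofChart I x x)
  let c : TangentSpace I x →L[ℝ] E := toChart I x x
  let K : E →L[ℝ] ℝ :=
    (1 / 2 : ℝ) • (D (c u) (c v) + D (c v) (c u) - (D.flip (c u)).flip (c v))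
  (h.inner x).inverse (K.comp c)

/-- The Levi-Civita covariant derivative `∇_v X` at `x` of a vector field `X`, `v ∈ T_x N`. -/
def leviCivita (h : SmoothMetric I N) (X : Π q : N, TangentSpace I q) (x : N)
    (v : TangentSpace I x) : TangentSpace I x :=
  ofChart I x x (mvfderiv I (fun q ↦ toChart I x q (X q)) x v) + christoffel h x v (X x)

/-- The covariant derivative `∇^f_v V` at `p` of a section `V` of `f⁻¹TN`, `v ∈ T_p M`, for the
pull-back by `f` of the Levi-Civita connection of `N`: in coordinates,
`∂_v V^a + Γ^a_{bc}(f) (∂_v f^b) V^c`. -/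
def covAlong (J : ModelWithCorners ℝ E' H') (h : SmoothMetric I N) (f : M → N)
    (V : Π q : M, TangentSpace I (f q)) (p : M) (v : TangentSpace J p) : TangentSpace I (f p) :=
  ofChart I (f p) (f p) (mvfderiv J (fun q ↦ toChart I (f p) (f q) (V q)) p v) +
    christoffel h (f p) (mfderiv J I f p v) (V p)

/-- The curvature `R(u, v)w` at `x`, with
`R(X, Y)Z = ∇_X ∇_Y Z - ∇_Y ∇_X Z - ∇_{[X, Y]} Z`, computed on local extensions of `u, v, w`. -/
def riemannCurvature (h : SmoothMetric I N) (x : N) (u v w : TangentSpace I x) :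
    TangentSpace I x :=
  let X : Π q : N, TangentSpace I q := FiberBundle.extend E u
  let Y : Π q : N, TangentSpace I q := FiberBundle.extend E v
  let Z : Π q : N, TangentSpace I q := FiberBundle.extend E w
  leviCivita h (fun q ↦ leviCivita h Z q (Y q)) x u
    - leviCivita h (fun q ↦ leviCivita h Z q (X q)) x v
    - leviCivita h Z x (VectorField.mlieBracket I X Y x)

/-- The trace `∑ g^{ij} B(b_i, b_j)` of a bilinear map on `T_p M` with respect to the metric `g`,
where `b` is a basis of `T_p M` and `(g^{ij})` the inverse of its Gram matrix. -/
def metricTrace [FiniteDimensional ℝ E'] (g : SmoothMetric J M) (p : M)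
    {W : Type*} [AddCommGroup W] [Module ℝ W]
    (B : TangentSpace J p → TangentSpace J p → W) : W :=
  let b : Module.Basis (Fin (Module.finrank ℝ E')) ℝ (TangentSpace J p) := Module.finBasis ℝ E'
  let G : Matrix (Fin (Module.finrank ℝ E')) (Fin (Module.finrank ℝ E')) ℝ :=
    Matrix.of fun i j ↦ g.inner p (b i) (b j)
  ∑ i, ∑ j, (G⁻¹ i j) • B (b i) (b j)

/-- The second fundamental form of `f`,
`(∇df)(u, v) = ∇^f_u (df V) - df(∇_u V)`, for a local extension `V` of `v`. -/
def secondFundamentalForm (g : SmoothMetric J M) (h : SmoothMetric I N) (f : M → N) (p : M)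
    (u v : TangentSpace J p) : TangentSpace I (f p) :=
  let V : Π q : M, TangentSpace J q := FiberBundle.extend E' v
  covAlong J h f (fun q ↦ mfderiv J I f q (V q)) p u - mfderiv J I f p (leviCivita g V p u)

/-- The second covariant derivative of a section `S` of `f⁻¹TN`,
`∇²_{u,v} S = ∇^f_u ∇^f_V S - ∇^f_{∇_u V} S`, for a local extension `V` of `v`. -/
def secondCovAlong (g : SmoothMetric J M) (h : SmoothMetric I N) (f : M → N)
    (S : Π q : M, TangentSpace I (f q)) (p : M) (u v : TangentSpace J p) :
    TangentSpace I (f p) :=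
  let V : Π q : M, TangentSpace J q := FiberBundle.extend E' v
  covAlong J h f (fun q ↦ covAlong J h f S q (V q)) p u - covAlong J h f S p (leviCivita g V p u)

variable [FiniteDimensional ℝ E']

/-- The tension field `τ(f) = trace ∇df`. -/
def tensionField (g : SmoothMetric J M) (h : SmoothMetric I N) (f : M → N) (p : M) :
    TangentSpace I (f p) :=
  metricTrace g p (secondFundamentalForm g h f p)

/-- The (geometers') Laplacian `Δ^f S = - trace ∇² S` on sections of `f⁻¹TN`. -/
def laplacianAlong (g : SmoothMetric J M) (h : SmoothMetric I N) (f : M → N)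
    (S : Π q : M, TangentSpace I (f q)) (p : M) : TangentSpace I (f p) :=
  - metricTrace g p (secondCovAlong g h f S p)

/-- The bitension field `τ₂(f) = - Δ^f τ(f) - trace R(df, τ(f)) df`. -/
def bitensionField (g : SmoothMetric J M) (h : SmoothMetric I N) (f : M → N) (p : M) :
    TangentSpace I (f p) :=
  - laplacianAlong g h f (tensionField g h f) p
    - metricTrace g p (fun u v ↦
        riemannCurvature h (f p) (mfderiv J I f p u) (tensionField g h f p) (mfderiv J I f p v))

/-- On the open set `U`, the map `f` is smooth, biharmonic (`τ₂(f) = 0`) and not harmonic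
(`τ(f)` does not vanish identically). -/
def IsProperBiharmonicOn (g : SmoothMetric J M) (h : SmoothMetric I N) (f : M → N) (U : Set M) :
    Prop :=
  ContMDiffOn J I ∞ f U ∧ (∀ p ∈ U, bitensionField g h f p = 0) ∧
    ¬ ∀ p ∈ U, tensionField g h f p = 0

/-- `f : (M, g) → (N, h)` is an isometric immersion: it is smooth and `f^* h = g`. -/
def IsIsometricImmersion (g : SmoothMetric J M) (h : SmoothMetric I N) (f : M → N) : Prop :=
  ContMDiff J I ∞ f ∧ ∀ (p : M) (u v : TangentSpace J p),
    h.inner (f p) (mfderiv J I f p u) (mfderiv J I f p v) = g.inner p u v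

end Riemannian

/-- The standard metric `ds²` of the real line. -/
def lineMetric : SmoothMetric 𝓘(ℝ, ℝ) ℝ where
  inner := (riemannianMetricVectorSpace ℝ).inner
  symm := (riemannianMetricVectorSpace ℝ).symm
  pos := (riemannianMetricVectorSpace ℝ).pos
  isVonNBounded := (riemannianMetricVectorSpace ℝ).isVonNBounded
  contMDiff := (riemannianMetricVectorSpace ℝ).contMDiff.of_le le_top

/-! ### Flows -/

section Flow

variable {E : Type*} [NormedAddCommGroup E] [NormedSpace ℝ E]
  {H : Type*} [TopologicalSpace H] {I : ModelWithCorners ℝ E H}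
  {N : Type*} [TopologicalSpace N] [ChartedSpace H N]

/-- `q = φ_t(p)`, where `φ` is the (possibly only local) flow of the vector field `ξ`: the integral
curve of `ξ` starting at `p` is defined up to time `t`, and is then at `q`. -/
def IsFlowImage (ξ : Π x : N, TangentSpace I x) (t : ℝ) (p q : N) : Prop :=
  ∃ (a b : ℝ) (σ : ℝ → N), 0 ∈ Ioo a b ∧ t ∈ Ioo a b ∧
    IsMIntegralCurveOn σ ξ (Ioo a b) ∧ σ 0 = p ∧ σ t = q

/-- `A` is invariant under the flow of `ξ`: `φ_t(p) ∈ A` for all `p ∈ A` and all `t` for which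
`φ_t(p)` is defined. -/
def IsFlowInvariant (ξ : Π x : N, TangentSpace I x) (A : Set N) : Prop :=
  ∀ (t : ℝ) (p q : N), IsFlowImage ξ t p q → p ∈ A → q ∈ A

end Flow

/-! ### Sasakian manifolds -/

section Sasakian

variable {E : Type*} [NormedAddCommGroup E] [NormedSpace ℝ E]
  {H : Type*} [TopologicalSpace H] {I : ModelWithCorners ℝ E H}
  {N : Type*} [TopologicalSpace N] [ChartedSpace H N]

/-- The exterior derivative of a 1-form, on vector fields, with the normalisation usual in contact
metric geometry: `dη(X, Y) = (1/2) (X(η(Y)) - Y(η(X)) - η([X, Y]))`. -/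
def dOneForm (η : Π x : N, TangentSpace I x →L[ℝ] ℝ) (X Y : Π x : N, TangentSpace I x) (x : N) :
    ℝ :=
  (1 / 2) * (mvfderiv I (fun q ↦ η q (Y q)) x (X x) - mvfderiv I (fun q ↦ η q (X q)) x (Y x)
    - η x (VectorField.mlieBracket I X Y x))

/-- The Nijenhuis tensor field of `φ`, on vector fields. -/
def nijenhuis (φ : Π x : N, TangentSpace I x →L[ℝ] TangentSpace I x)
    (X Y : Π x : N, TangentSpace I x) (x : N) : TangentSpace I x :=
  VectorField.mlieBracket I (fun q ↦ φ q (X q)) (fun q ↦ φ q (Y q)) x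
    - φ x (VectorField.mlieBracket I (fun q ↦ φ q (X q)) Y x)
    - φ x (VectorField.mlieBracket I X (fun q ↦ φ q (Y q)) x)
    + φ x (φ x (VectorField.mlieBracket I X Y x))

variable [IsManifold I ∞ N]

variable (I N) in
/-- A contact metric structure `(φ, ξ, η, g)`. -/
structure ContactMetricStructure where
  /-- the tensor field of type (1,1) -/
  φ : Π x : N, TangentSpace I x →L[ℝ] TangentSpace I x
  /-- the characteristic vector field -/
  ξ : Π x : N, TangentSpace I x
  /-- the contact form -/
  η : Π x : N, TangentSpace I x →L[ℝ] ℝ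
  /-- the metric -/
  g : SmoothMetric I N
  contMDiff_φ : ContMDiff I (I.prod 𝓘(ℝ, E →L[ℝ] E)) ∞
    (fun x ↦ TotalSpace.mk' (E →L[ℝ] E) (E := fun x : N ↦ TangentSpace I x →L[ℝ] TangentSpace I x)
      x (φ x))
  contMDiff_ξ : ContMDiff I (I.prod 𝓘(ℝ, E)) ∞
    (fun x ↦ TotalSpace.mk' E (E := fun x : N ↦ TangentSpace I x) x (ξ x))
  contMDiff_η : ContMDiff I (I.prod 𝓘(ℝ, E →L[ℝ] ℝ)) ∞
    (fun x ↦ TotalSpace.mk' (E →L[ℝ] ℝ) (E := fun x : N ↦ TangentSpace I x →L[ℝ] ℝ) x (η x))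
  φ_sq : ∀ (x : N) (u : TangentSpace I x), φ x (φ x u) = - u + η x u • ξ x
  η_ξ : ∀ x : N, η x (ξ x) = 1
  g_φ_φ : ∀ (x : N) (u v : TangentSpace I x),
    g.inner x (φ x u) (φ x v) = g.inner x u v - η x u * η x v
  /-- `g(X, φY) = dη(X, Y)` -/
  g_φ : ∀ (X Y : Π x : N, TangentSpace I x) (x : N),
    ContMDiffAt I (I.prod 𝓘(ℝ, E)) ∞
      (fun x ↦ TotalSpace.mk' E (E := fun x : N ↦ TangentSpace I x) x (X x)) x →
    ContMDiffAt I (I.prod 𝓘(ℝ, E)) ∞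
      (fun x ↦ TotalSpace.mk' E (E := fun x : N ↦ TangentSpace I x) x (Y x)) x →
    g.inner x (X x) (φ x (Y x)) = dOneForm η X Y x

namespace ContactMetricStructure

/-- The structure is Sasakian, i.e. normal: `N_φ + 2 dη ⊗ ξ = 0`. -/
def IsSasakian (S : ContactMetricStructure I N) : Prop :=
  ∀ (X Y : Π x : N, TangentSpace I x) (x : N),
    ContMDiffAt I (I.prod 𝓘(ℝ, E)) ∞
      (fun x ↦ TotalSpace.mk' E (E := fun x : N ↦ TangentSpace I x) x (X x)) x →
    ContMDiffAt I (I.prod 𝓘(ℝ, E)) ∞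
      (fun x ↦ TotalSpace.mk' E (E := fun x : N ↦ TangentSpace I x) x (Y x)) x →
    nijenhuis S.φ X Y x + (2 * dOneForm S.η X Y x) • S.ξ x = 0

/-- Sasakian space form `N(c)`: Sasakian, and every `φ`-sectional curvature, i.e. the sectional
curvature `g(R(u, φu)φu, u)` of the plane spanned by the orthonormal vectors `u`, `φu` with `u`
a unit vector orthogonal to `ξ`, equals `c`. -/
def IsSasakianSpaceForm (S : ContactMetricStructure I N) (c : ℝ) : Prop :=
  S.IsSasakian ∧ ∀ (x : N) (u : TangentSpace I x),
    S.g.inner x u u = 1 → S.g.inner x u (S.ξ x) = 0 →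
    S.g.inner x (riemannCurvature S.g x u (S.φ x u) (S.φ x u)) u = c

/-- `γ` is, on the open interval `(a, b)`, a Legendre curve parametrized by arc length: smooth,
`η(γ') = 0` and `|γ'| = 1`. -/
def IsLegendreCurve (S : ContactMetricStructure I N) (γ : ℝ → N) (a b : ℝ) : Prop :=
  ContMDiffOn 𝓘(ℝ, ℝ) I ∞ γ (Ioo a b) ∧ ∀ s ∈ Ioo a b,
    S.η (γ s) (mfderiv 𝓘(ℝ, ℝ) I γ s (1 : ℝ)) = 0 ∧
    S.g.inner (γ s) (mfderiv 𝓘(ℝ, ℝ) I γ s (1 : ℝ)) (mfderiv 𝓘(ℝ, ℝ) I γ s (1 : ℝ)) = 1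

/-- Around every point, `f : M → N` has the form `x(t, s) = φ_t(γ(s))`, in smooth local coordinates
`(t, s) ∈ (-ε, ε) × (a, b)` on `M`, where `φ_t` is the flow of `ξ` and `γ : (a, b) → N` is a
proper-biharmonic Legendre curve parametrized by arc length. -/
def IsLocallyFlowOfProperBiharmonicLegendre (S : ContactMetricStructure I N)
    {E' : Type*} [NormedAddCommGroup E'] [NormedSpace ℝ E']
    {H' : Type*} [TopologicalSpace H'] (J : ModelWithCorners ℝ E' H')
    {M : Type*} [TopologicalSpace M] [ChartedSpace H' M] (f : M → N) : Prop :=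
  ∀ p : M, ∃ (ε a b : ℝ) (γ : ℝ → N) (ψ : OpenPartialHomeomorph (ℝ × ℝ) M),
    S.IsLegendreCurve γ a b ∧
    IsProperBiharmonicOn lineMetric S.g γ (Ioo a b) ∧
    ψ.source = Ioo (-ε) ε ×ˢ Ioo a b ∧ p ∈ ψ.target ∧
    ContMDiffOn 𝓘(ℝ, ℝ × ℝ) J ∞ ψ ψ.source ∧ ContMDiffOn J 𝓘(ℝ, ℝ × ℝ) ∞ ψ.symm ψ.target ∧
    ∀ t ∈ Ioo (-ε) ε, ∀ s ∈ Ioo a b, IsFlowImage S.ξ t (γ s) (f (ψ (t, s)))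

end ContactMetricStructure

end Sasakian

end

/-! The characteristic field `ξ` of a Sasakian manifold is a unit Killing field
(`IsSasakianOn.killing`). Its orbits are therefore geodesics, and its flow preserves the Levi-Civita
connection and the curvature (`IsMetricOn.isAffineGeodesicField`,
`IsAffineGeodesicField.lie_curvC`).

Coordinates. A surface with flow-invariant image is tangent to `ξ`; otherwise the flow would sweep
the image out into a set of Hausdorff dimension three (`mem_range_mfderiv_of_isFlowInvariant`). Let
`w` be the field on the surface that is mapped to `ξ`, and `θ` its dual form. Then `θ` is the
pull-back of `η`, and since `dη(ξ, ·) = 0`, it is closed, the surface having dimension two. Write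
the induced metric as `θ² + κ²`; as `w` is Killing, `κ` is closed too. So `θ = dt`, `κ = ds`, the
surface is flat, and `f(t, s) = φ_t(γ(s))` with `γ = f(0, ·)`, a unit-speed Legendre curve because
`∂_t`, `∂_s` are orthonormal (`exists_isFlowParam`). Conversely, flowing out a Legendre curve gives
such flat coordinates, because the flow is isometric (`isFlowParam_of_isFlowImage`).

Reduction to curves. In these coordinates `τ(f) = ∇_t ∂_t + ∇_s ∂_s = ∇_s ∂_s` is the tension field
`τ` of the curve `f(t, ·)`. It is carried along by the flow, hence is a Jacobi field along the
orbits: `∇_t ∇_t τ = R(∂_t, τ)∂_t`. These two terms cancel in `τ₂(f)`, and what remains, `∇_s ∇_s τ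
- R(∂_s, τ)∂_s`, is the bitension field of the curve (`bitensC_eq`, `bitensC_snd`). Both fields are
invariant under the flow, so their vanishing does not depend on `t`.

Non-harmonicity. One non-harmonic curve makes `f` non-harmonic. For the other direction every local
curve has to be non-harmonic. Now `τ₂ = 0` is a linear second-order equation for `τ` in the variable
`s`; if `τ` vanishes on an open set it vanishes on the whole coordinate rectangle, hence, by
connectedness, on the surface.

The covariant derivatives are defined through the preferred chart at each point. They are first
rewritten in one fixed chart, in terms of Christoffel symbols, and the traces are evaluated in flat
coordinates (`tensC`, `bitensC`). The inner product of these coordinates is a separate bilinear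
form, since the norm of `ℝ × ℝ` is the supremum norm. -/

noncomputable section

set_option maxSynthPendingDepth 3
set_option linter.unusedSectionVars false

/-! ### Calculus of a symmetric connection on an open set of a vector space -/

section ChartCalculus

open Filter Topology

variable {E : Type*} [NormedAddCommGroup E] [NormedSpace ℝ E]
  {X : Type*} [NormedAddCommGroup X] [NormedSpace ℝ X]
  {F : Type*} [NormedAddCommGroup F] [NormedSpace ℝ F]
  {G : Type*} [NormedAddCommGroup G] [NormedSpace ℝ G]
  {K : Type*} [NormedAddCommGroup K] [NormedSpace ℝ K]

lemma ContDiffAt.differentiableAt_infty {f : X → E} {x : X} (h : ContDiffAt ℝ ∞ f x) :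
    DifferentiableAt ℝ f x := h.differentiableAt (by simp)

lemma ContDiffAt.fderiv_infty {f : X → E} {x : X} (h : ContDiffAt ℝ ∞ f x) :
    ContDiffAt ℝ ∞ (fderiv ℝ f) x := h.fderiv_right (by simp)

lemma ContDiffAt.fderiv_apply_comm {f : X → E} {x : X} (h : ContDiffAt ℝ ∞ f x) (u v : X) :
    fderiv ℝ (fderiv ℝ f) x u v = fderiv ℝ (fderiv ℝ f) x v u :=
  (h.isSymmSndFDerivAt (by simpa using ENat.LEInfty.out)).eq u v

lemma fderiv_clm_apply₁ {L : X → E →L[ℝ] F} {a : X → E} {q : X}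
    (hL : DifferentiableAt ℝ L q) (ha : DifferentiableAt ℝ a q) (v : X) :
    fderiv ℝ (fun p ↦ L p (a p)) q v = fderiv ℝ L q v (a q) + L q (fderiv ℝ a q v) := by
  rw [fderiv_clm_apply hL ha]
  simp [add_comm]

lemma fderiv_clm_apply₂ {L : X → E →L[ℝ] F →L[ℝ] G} {a : X → E} {b : X → F} {q : X}
    (hL : DifferentiableAt ℝ L q) (ha : DifferentiableAt ℝ a q) (hb : DifferentiableAt ℝ b q)
    (v : X) :
    fderiv ℝ (fun p ↦ L p (a p) (b p)) q v =
      fderiv ℝ L q v (a q) (b q) + L q (fderiv ℝ a q v) (b q) + L q (a q) (fderiv ℝ b q v) := by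
  rw [fderiv_clm_apply₁ (hL.clm_apply ha) hb, fderiv_clm_apply₁ hL ha]
  simp

lemma fderiv_clm_apply₃ {L : X → E →L[ℝ] F →L[ℝ] G →L[ℝ] K} {a : X → E} {b : X → F} {c : X → G}
    {q : X} (hL : DifferentiableAt ℝ L q) (ha : DifferentiableAt ℝ a q)
    (hb : DifferentiableAt ℝ b q) (hc : DifferentiableAt ℝ c q) (v : X) :
    fderiv ℝ (fun p ↦ L p (a p) (b p) (c p)) q v =
      fderiv ℝ L q v (a q) (b q) (c q) + L q (fderiv ℝ a q v) (b q) (c q)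
        + L q (a q) (fderiv ℝ b q v) (c q) + L q (a q) (b q) (fderiv ℝ c q v) := by
  rw [fderiv_clm_apply₁ ((hL.clm_apply ha).clm_apply hb) hc, fderiv_clm_apply₂ hL ha hb]
  simp

lemma fderiv_comp_apply' {L : E → F} {y : X → E} {q : X}
    (hL : DifferentiableAt ℝ L (y q)) (hy : DifferentiableAt ℝ y q) (v : X) :
    fderiv ℝ (fun p ↦ L (y p)) q v = fderiv ℝ L (y q) (fderiv ℝ y q v) := by
  have := fderiv_comp q hL hy
  rw [show (fun p ↦ L (y p)) = L ∘ y from rfl, this]; rfl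

/-- The covariant derivative of the section `V` along the map `y`, for the connection with
Christoffel symbols `Γ`. -/
def covC (Γ : E → E →L[ℝ] E →L[ℝ] E) (y V : X → E) (q v : X) : E :=
  fderiv ℝ V q v + Γ (y q) (fderiv ℝ y q v) (V q)

/-- The curvature of the connection with Christoffel symbols `Γ`. -/
def curvC (Γ : E → E →L[ℝ] E →L[ℝ] E) (z u v w : E) : E :=
  fderiv ℝ Γ z u v w - fderiv ℝ Γ z v u w + Γ z u (Γ z v w) - Γ z v (Γ z u w)

lemma covC_congr {Γ : E → E →L[ℝ] E →L[ℝ] E} {y y' V V' : X → E} {q : X} (hy : y =ᶠ[𝓝 q] y')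
    (hV : V =ᶠ[𝓝 q] V') (v : X) : covC Γ y V q v = covC Γ y' V' q v := by
  simp only [covC, hy.fderiv_eq, hV.fderiv_eq, hy.eq_of_nhds, hV.eq_of_nhds]

lemma ContDiffAt.clm_apply₂ {L : X → E →L[ℝ] F →L[ℝ] G} {a : X → E} {b : X → F} {q : X}
    (hL : ContDiffAt ℝ ∞ L q) (ha : ContDiffAt ℝ ∞ a q) (hb : ContDiffAt ℝ ∞ b q) :
    ContDiffAt ℝ ∞ (fun p ↦ L p (a p) (b p)) q := (hL.clm_apply ha).clm_apply hb

lemma ContDiffAt.clm_apply₃ {L : X → E →L[ℝ] F →L[ℝ] G →L[ℝ] K} {a : X → E} {b : X → F}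
    {c : X → G} {q : X} (hL : ContDiffAt ℝ ∞ L q) (ha : ContDiffAt ℝ ∞ a q)
    (hb : ContDiffAt ℝ ∞ b q) (hc : ContDiffAt ℝ ∞ c q) :
    ContDiffAt ℝ ∞ (fun p ↦ L p (a p) (b p) (c p)) q := (hL.clm_apply₂ ha hb).clm_apply hc

lemma ContDiffAt.covC {Γ : E → E →L[ℝ] E →L[ℝ] E} {y V : X → E} {q : X} {a : X → X}
    (hΓ : ContDiffAt ℝ ∞ Γ (y q)) (hy : ContDiffAt ℝ ∞ y q) (hV : ContDiffAt ℝ ∞ V q)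
    (ha : ContDiffAt ℝ ∞ a q) :
    ContDiffAt ℝ ∞ (fun p ↦ covC Γ y V p (a p)) q := by
  unfold _root_.covC
  have h1 : ContDiffAt ℝ ∞ (fun p ↦ Γ (y p)) q := hΓ.comp q hy
  exact (hV.fderiv_infty.clm_apply ha).add
    ((h1.clm_apply (hy.fderiv_infty.clm_apply ha)).clm_apply hV)

lemma ContDiffAt.curvC {Γ : E → E →L[ℝ] E →L[ℝ] E} {y a b c : X → E} {q : X}
    (hΓ : ContDiffAt ℝ ∞ Γ (y q)) (hy : ContDiffAt ℝ ∞ y q) (ha : ContDiffAt ℝ ∞ a q)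
    (hb : ContDiffAt ℝ ∞ b q) (hc : ContDiffAt ℝ ∞ c q) :
    ContDiffAt ℝ ∞ (fun p ↦ curvC Γ (y p) (a p) (b p) (c p)) q := by
  unfold _root_.curvC
  have h1 : ContDiffAt ℝ ∞ (fun p ↦ Γ (y p)) q := hΓ.comp q hy
  have h2 : ContDiffAt ℝ ∞ (fun p ↦ fderiv ℝ Γ (y p)) q := hΓ.fderiv_infty.comp q hy
  exact (((h2.clm_apply₃ ha hb hc).sub (h2.clm_apply₃ hb ha hc)).add
    (h1.clm_apply₂ ha (h1.clm_apply₂ hb hc))).sub (h1.clm_apply₂ hb (h1.clm_apply₂ ha hc))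

/-- `ξ` is an affine vector field of the symmetric connection `Γ` on `Ω`, with geodesic integral
curves. -/
structure IsAffineGeodesicField (Γ : E → E →L[ℝ] E →L[ℝ] E) (ξ : E → E) (Ω : Set E) : Prop where
  isOpen : IsOpen Ω
  contDiffOn_Γ : ContDiffOn ℝ ∞ Γ Ω
  contDiffOn_ξ : ContDiffOn ℝ ∞ ξ Ω
  symm : ∀ z ∈ Ω, ∀ u v, Γ z u v = Γ z v u
  -- The Lie derivative of the connection along `ξ` is zero.
  affine : ∀ z ∈ Ω, ∀ u v, fderiv ℝ (fderiv ℝ ξ) z u v + fderiv ℝ Γ z (ξ z) u v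
    - fderiv ℝ ξ z (Γ z u v) + Γ z (fderiv ℝ ξ z u) v + Γ z u (fderiv ℝ ξ z v) = 0
  geodesic : ∀ z ∈ Ω, fderiv ℝ ξ z (ξ z) + Γ z (ξ z) (ξ z) = 0

namespace IsAffineGeodesicField

variable {Γ : E → E →L[ℝ] E →L[ℝ] E} {ξ : E → E} {Ω : Set E}

lemma contDiffAt_Γ (h : IsAffineGeodesicField Γ ξ Ω) {z : E} (hz : z ∈ Ω) : ContDiffAt ℝ ∞ Γ z :=
  h.contDiffOn_Γ.contDiffAt (h.isOpen.mem_nhds hz)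

lemma contDiffAt_ξ (h : IsAffineGeodesicField Γ ξ Ω) {z : E} (hz : z ∈ Ω) : ContDiffAt ℝ ∞ ξ z :=
  h.contDiffOn_ξ.contDiffAt (h.isOpen.mem_nhds hz)

lemma fderiv_symm (h : IsAffineGeodesicField Γ ξ Ω) {z : E} (hz : z ∈ Ω) (w u v : E) :
    fderiv ℝ Γ z w u v = fderiv ℝ Γ z w v u := by
  have hΓ := (h.contDiffAt_Γ hz).differentiableAt_infty
  have e1 : fderiv ℝ (fun p ↦ Γ p u v) z w = fderiv ℝ (fun p ↦ Γ p v u) z w := by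
    congr 1
    refine Filter.EventuallyEq.fderiv_eq ?_
    filter_upwards [h.isOpen.mem_nhds hz] with p hp using h.symm p hp u v
  rw [fderiv_clm_apply₂ hΓ (by fun_prop) (by fun_prop),
    fderiv_clm_apply₂ hΓ (by fun_prop) (by fun_prop)] at e1
  simpa using e1

lemma fderiv_geodesic (h : IsAffineGeodesicField Γ ξ Ω) {z : E} (hz : z ∈ Ω) (v : E) :
    fderiv ℝ (fderiv ℝ ξ) z v (ξ z) + fderiv ℝ ξ z (fderiv ℝ ξ z v)
      + (fderiv ℝ Γ z v (ξ z) (ξ z) + Γ z (fderiv ℝ ξ z v) (ξ z) + Γ z (ξ z) (fderiv ℝ ξ z v))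
      = 0 := by
  have hΓ := (h.contDiffAt_Γ hz).differentiableAt_infty
  have hξ := (h.contDiffAt_ξ hz).differentiableAt_infty
  have hξ' := (h.contDiffAt_ξ hz).fderiv_infty.differentiableAt_infty
  have e1 : fderiv ℝ (fun p ↦ fderiv ℝ ξ p (ξ p) + Γ p (ξ p) (ξ p)) z v = 0 := by
    have : (fun p ↦ fderiv ℝ ξ p (ξ p) + Γ p (ξ p) (ξ p)) =ᶠ[𝓝 z] fun _ ↦ 0 := by
      filter_upwards [h.isOpen.mem_nhds hz] with p hp using h.geodesic p hp
    rw [this.fderiv_eq]; simp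
  rw [fderiv_fun_add (hξ'.clm_apply hξ) ((hΓ.clm_apply hξ).clm_apply hξ),
    _root_.add_apply, fderiv_clm_apply₁ hξ' hξ, fderiv_clm_apply₂ hΓ hξ hξ] at e1
  exact e1

/-- The curvature contains one derivative of `Γ`, so its invariance needs the affine equation
differentiated once. -/
lemma fderiv_affine (h : IsAffineGeodesicField Γ ξ Ω) {z : E} (hz : z ∈ Ω) (w u v : E) :
    fderiv ℝ (fderiv ℝ (fderiv ℝ ξ)) z w u v
      + (fderiv ℝ (fderiv ℝ Γ) z w (ξ z) u v + fderiv ℝ Γ z (fderiv ℝ ξ z w) u v)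
      - (fderiv ℝ (fderiv ℝ ξ) z w (Γ z u v) + fderiv ℝ ξ z (fderiv ℝ Γ z w u v))
      + (fderiv ℝ Γ z w (fderiv ℝ ξ z u) v + Γ z (fderiv ℝ (fderiv ℝ ξ) z w u) v)
      + (fderiv ℝ Γ z w u (fderiv ℝ ξ z v) + Γ z u (fderiv ℝ (fderiv ℝ ξ) z w v)) = 0 := by
  have hΓ := (h.contDiffAt_Γ hz).differentiableAt_infty
  have hΓ' := (h.contDiffAt_Γ hz).fderiv_infty.differentiableAt_infty
  have hξ := (h.contDiffAt_ξ hz).differentiableAt_infty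
  have hξ' := (h.contDiffAt_ξ hz).fderiv_infty.differentiableAt_infty
  have hξ'' := (h.contDiffAt_ξ hz).fderiv_infty.fderiv_infty.differentiableAt_infty
  have cu : DifferentiableAt ℝ (fun _ : E ↦ u) z := differentiableAt_const u
  have cv : DifferentiableAt ℝ (fun _ : E ↦ v) z := differentiableAt_const v
  have e1 : fderiv ℝ (fun p ↦ fderiv ℝ (fderiv ℝ ξ) p u v + fderiv ℝ Γ p (ξ p) u v
    - fderiv ℝ ξ p (Γ p u v) + Γ p (fderiv ℝ ξ p u) v + Γ p u (fderiv ℝ ξ p v)) z w = 0 := by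
    have : (fun p ↦ fderiv ℝ (fderiv ℝ ξ) p u v + fderiv ℝ Γ p (ξ p) u v
      - fderiv ℝ ξ p (Γ p u v) + Γ p (fderiv ℝ ξ p u) v + Γ p u (fderiv ℝ ξ p v))
        =ᶠ[𝓝 z] fun _ ↦ 0 := by
      filter_upwards [h.isOpen.mem_nhds hz] with p hp using h.affine p hp u v
    rw [this.fderiv_eq]; simp
  have d1 := (hξ''.clm_apply cu).clm_apply cv
  have d2 := ((hΓ'.clm_apply hξ).clm_apply cu).clm_apply cv
  have d3 := hξ'.clm_apply ((hΓ.clm_apply cu).clm_apply cv)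
  have d4 := (hΓ.clm_apply (hξ'.clm_apply cu)).clm_apply cv
  have d5 := (hΓ.clm_apply cu).clm_apply (hξ'.clm_apply cv)
  rw [fderiv_fun_add (((d1.fun_add d2).fun_sub d3).fun_add d4) d5,
    fderiv_fun_add ((d1.fun_add d2).fun_sub d3) d4, fderiv_fun_sub (d1.fun_add d2) d3, fderiv_fun_add d1 d2] at e1
  simp only [_root_.add_apply, _root_.sub_apply] at e1
  rw [fderiv_clm_apply₂ hξ'' cu cv, fderiv_clm_apply₃ hΓ' hξ cu cv,
    fderiv_clm_apply₁ hξ' ((hΓ.clm_apply cu).clm_apply cv), fderiv_clm_apply₂ hΓ cu cv,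
    fderiv_clm_apply₂ hΓ (hξ'.clm_apply cu) cv, fderiv_clm_apply₂ hΓ cu (hξ'.clm_apply cv),
    fderiv_clm_apply₁ hξ' cu, fderiv_clm_apply₁ hξ' cv] at e1
  simpa using e1

/-- An affine field preserves the curvature. -/
lemma lie_curvC (h : IsAffineGeodesicField Γ ξ Ω) {z : E} (hz : z ∈ Ω) (u v w : E) :
    fderiv ℝ (fderiv ℝ Γ) z (ξ z) u v w - fderiv ℝ (fderiv ℝ Γ) z (ξ z) v u w
      + (fderiv ℝ Γ z (ξ z) u (Γ z v w) + Γ z u (fderiv ℝ Γ z (ξ z) v w))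
      - (fderiv ℝ Γ z (ξ z) v (Γ z u w) + Γ z v (fderiv ℝ Γ z (ξ z) u w))
      + curvC Γ z (fderiv ℝ ξ z u) v w + curvC Γ z u (fderiv ℝ ξ z v) w
      + curvC Γ z u v (fderiv ℝ ξ z w) = fderiv ℝ ξ z (curvC Γ z u v w) := by
  have a1 := h.fderiv_affine hz u v w
  have a2 := h.fderiv_affine hz v u w
  have b1 := congrArg (fun x ↦ Γ z u x) (h.affine z hz v w)
  have b2 := congrArg (fun x ↦ Γ z v x) (h.affine z hz u w)
  have c1 := h.affine z hz u (Γ z v w)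
  have c2 := h.affine z hz v (Γ z u w)
  have s1 := (h.contDiffAt_ξ hz).fderiv_apply_comm u v
  have s2 : fderiv ℝ (fderiv ℝ (fderiv ℝ ξ)) z u v w = fderiv ℝ (fderiv ℝ (fderiv ℝ ξ)) z v u w :=
    by rw [(h.contDiffAt_ξ hz).fderiv_infty.fderiv_apply_comm u v]
  have t1 : fderiv ℝ (fderiv ℝ Γ) z (ξ z) u v w = fderiv ℝ (fderiv ℝ Γ) z u (ξ z) v w := by
    rw [(h.contDiffAt_Γ hz).fderiv_apply_comm]
  have t2 : fderiv ℝ (fderiv ℝ Γ) z (ξ z) v u w = fderiv ℝ (fderiv ℝ Γ) z v (ξ z) u w := by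
    rw [(h.contDiffAt_Γ hz).fderiv_apply_comm]
  rw [t1, t2]
  rw [s1] at a1
  rw [s2] at a1
  simp only [map_add, map_sub, map_zero] at b1 b2
  simp only [curvC, map_add, map_sub]
  linear_combination (norm := module) a1 - a2 + b1 - b2 + c1 - c2

end IsAffineGeodesicField

end ChartCalculus

/-! ### Invariant sections along a surface swept out by the flow. -/

section FlowSurface

open Filter Topology

variable {E : Type*} [NormedAddCommGroup E] [NormedSpace ℝ E]
  {Γ : E → E →L[ℝ] E →L[ℝ] E} {ξ : E → E} {Ω : Set E} {y : ℝ × ℝ → E} {Q : Set (ℝ × ℝ)}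

/-- `y` is smooth on the open set `Q`, with values in `Ω` and `∂y/∂t = ξ ∘ y`. -/
structure IsFlowSurface (ξ : E → E) (Ω : Set E) (y : ℝ × ℝ → E) (Q : Set (ℝ × ℝ)) : Prop where
  isOpen : IsOpen Q
  contDiffOn : ContDiffOn ℝ ∞ y Q
  mapsTo : MapsTo y Q Ω
  fderiv_fst : ∀ q ∈ Q, fderiv ℝ y q (1, 0) = ξ (y q)

/-- The section `V` along `y` is smooth and invariant under the (linearised) flow of `ξ`. -/
structure IsInvariantAlong (ξ : E → E) (y : ℝ × ℝ → E) (Q : Set (ℝ × ℝ)) (V : ℝ × ℝ → E) :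
    Prop where
  contDiffOn : ContDiffOn ℝ ∞ V Q
  fderiv_fst : ∀ q ∈ Q, fderiv ℝ V q (1, 0) = fderiv ℝ ξ (y q) (V q)

lemma IsFlowSurface.contDiffAt (hy : IsFlowSurface ξ Ω y Q) {q : ℝ × ℝ} (hq : q ∈ Q) :
    ContDiffAt ℝ ∞ y q := hy.contDiffOn.contDiffAt (hy.isOpen.mem_nhds hq)

lemma IsInvariantAlong.contDiffAt {V : ℝ × ℝ → E} (hV : IsInvariantAlong ξ y Q V)
    (hQ : IsOpen Q) {q : ℝ × ℝ} (hq : q ∈ Q) :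
    ContDiffAt ℝ ∞ V q := hV.contDiffOn.contDiffAt (hQ.mem_nhds hq)

lemma IsInvariantAlong.sub {V W : ℝ × ℝ → E} (hQ : IsOpen Q) (hV : IsInvariantAlong ξ y Q V)
    (hW : IsInvariantAlong ξ y Q W) : IsInvariantAlong ξ y Q (fun q ↦ V q - W q) where
  contDiffOn := hV.contDiffOn.sub hW.contDiffOn
  fderiv_fst q hq := by
    rw [fderiv_fun_sub (hV.contDiffAt hQ hq).differentiableAt_infty
      (hW.contDiffAt hQ hq).differentiableAt_infty]
    simp [hV.fderiv_fst q hq, hW.fderiv_fst q hq]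

namespace IsAffineGeodesicField

variable (h : IsAffineGeodesicField Γ ξ Ω) (hy : IsFlowSurface ξ Ω y Q)
include h hy

lemma fderiv_fderiv_flow {q : ℝ × ℝ} (hq : q ∈ Q) (v : ℝ × ℝ) :
    fderiv ℝ (fderiv ℝ y) q v (1, 0) = fderiv ℝ ξ (y q) (fderiv ℝ y q v) := by
  have e : (fun p ↦ fderiv ℝ y p (1, 0)) =ᶠ[𝓝 q] fun p ↦ ξ (y p) := by
    filter_upwards [hy.isOpen.mem_nhds hq] with p hp using hy.fderiv_fst p hp
  have e1 := congrArg (fun L : ℝ × ℝ →L[ℝ] E ↦ L v) e.fderiv_eq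
  rw [fderiv_clm_apply₁ (hy.contDiffAt hq).fderiv_infty.differentiableAt_infty (by fun_prop),
    fderiv_comp_apply' (h.contDiffAt_ξ (hy.mapsTo hq)).differentiableAt_infty
      (hy.contDiffAt hq).differentiableAt_infty] at e1
  simpa using e1

lemma invariant_fderiv_snd : IsInvariantAlong ξ y Q (fun q ↦ fderiv ℝ y q (0, 1)) where
  contDiffOn q hq := ((hy.contDiffAt hq).fderiv_infty.clm_apply contDiffAt_const).contDiffWithinAt
  fderiv_fst q hq := by
    rw [fderiv_clm_apply₁ (hy.contDiffAt hq).fderiv_infty.differentiableAt_infty (by fun_prop),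
      (hy.contDiffAt hq).fderiv_apply_comm, h.fderiv_fderiv_flow hy hq]
    simp

/-- The flow preserves the connection, so it commutes with covariant differentiation in the
transversal direction: what separates the two sides of the computation is exactly the affine
equation. -/
lemma invariant_covC {V : ℝ × ℝ → E} (hV : IsInvariantAlong ξ y Q V) :
    IsInvariantAlong ξ y Q (fun q ↦ covC Γ y V q (0, 1)) where
  contDiffOn q hq := (ContDiffAt.covC (h.contDiffAt_Γ (hy.mapsTo hq)) (hy.contDiffAt hq)
    (hV.contDiffAt hy.isOpen hq) contDiffAt_const).contDiffWithinAt
  fderiv_fst q hq := by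
    have cV := hV.contDiffAt hy.isOpen hq
    have dΓ : DifferentiableAt ℝ (fun p ↦ Γ (y p)) q :=
      (h.contDiffAt_Γ (hy.mapsTo hq)).differentiableAt_infty.comp q
        (hy.contDiffAt hq).differentiableAt_infty
    have dy := (hy.contDiffAt hq).fderiv_infty.differentiableAt_infty
    have dV := cV.fderiv_infty.differentiableAt_infty
    have c1 : DifferentiableAt ℝ (fun _ : ℝ × ℝ ↦ ((0, 1) : ℝ × ℝ)) q := differentiableAt_const _
    have e : fderiv ℝ (fderiv ℝ V) q (0, 1) (1, 0) =
        fderiv ℝ (fderiv ℝ ξ) (y q) (fderiv ℝ y q (0, 1)) (V q)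
          + fderiv ℝ ξ (y q) (fderiv ℝ V q (0, 1)) := by
      have e : (fun p ↦ fderiv ℝ V p (1, 0)) =ᶠ[𝓝 q] fun p ↦ fderiv ℝ ξ (y p) (V p) := by
        filter_upwards [hy.isOpen.mem_nhds hq] with p hp using hV.fderiv_fst p hp
      have dξ := (h.contDiffAt_ξ (hy.mapsTo hq)).fderiv_infty.differentiableAt_infty
      have dξc : DifferentiableAt ℝ (fun p ↦ fderiv ℝ ξ (y p)) q :=
        dξ.comp q (hy.contDiffAt hq).differentiableAt_infty
      have e1 := congrArg (fun L : ℝ × ℝ →L[ℝ] E ↦ L (0, 1)) e.fderiv_eq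
      rw [fderiv_clm_apply₁ dV (by fun_prop),
        fderiv_clm_apply₁ dξc cV.differentiableAt_infty, fderiv_comp_apply' dξ
          (hy.contDiffAt hq).differentiableAt_infty] at e1
      simpa using e1
    have z := h.affine (y q) (hy.mapsTo hq) (fderiv ℝ y q (0, 1)) (V q)
    unfold covC
    rw [fderiv_fun_add (dV.clm_apply c1) ((dΓ.clm_apply (dy.clm_apply c1)).clm_apply
        cV.differentiableAt_infty), _root_.add_apply, fderiv_clm_apply₁ dV c1,
      fderiv_clm_apply₂ dΓ (dy.clm_apply c1) cV.differentiableAt_infty,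
      fderiv_comp_apply' (h.contDiffAt_Γ (hy.mapsTo hq)).differentiableAt_infty
        (hy.contDiffAt hq).differentiableAt_infty, fderiv_clm_apply₁ dy c1,
      cV.fderiv_apply_comm, e, (hy.contDiffAt hq).fderiv_apply_comm,
      h.fderiv_fderiv_flow hy hq, hy.fderiv_fst q hq, hV.fderiv_fst q hq]
    simp only [fderiv_fun_const, Pi.zero_apply, _root_.zero_apply, map_zero, map_add, add_zero]
    linear_combination (norm := module) z

lemma invariant_curvC {a b c : ℝ × ℝ → E} (ha : IsInvariantAlong ξ y Q a)
    (hb : IsInvariantAlong ξ y Q b) (hc : IsInvariantAlong ξ y Q c) :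
    IsInvariantAlong ξ y Q (fun q ↦ curvC Γ (y q) (a q) (b q) (c q)) where
  contDiffOn q hq := (ContDiffAt.curvC (h.contDiffAt_Γ (hy.mapsTo hq)) (hy.contDiffAt hq)
    (ha.contDiffAt hy.isOpen hq) (hb.contDiffAt hy.isOpen hq)
    (hc.contDiffAt hy.isOpen hq)).contDiffWithinAt
  fderiv_fst q hq := by
    have hyd := (hy.contDiffAt hq).differentiableAt_infty
    have cΓ := h.contDiffAt_Γ (hy.mapsTo hq)
    have dΓ : DifferentiableAt ℝ (fun p ↦ Γ (y p)) q := cΓ.differentiableAt_infty.comp q hyd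
    have dΓ' : DifferentiableAt ℝ (fun p ↦ fderiv ℝ Γ (y p)) q :=
      cΓ.fderiv_infty.differentiableAt_infty.comp q hyd
    have da := (ha.contDiffAt hy.isOpen hq).differentiableAt_infty
    have db := (hb.contDiffAt hy.isOpen hq).differentiableAt_infty
    have dc := (hc.contDiffAt hy.isOpen hq).differentiableAt_infty
    have t1 := ((dΓ'.clm_apply da).clm_apply db).clm_apply dc
    have t2 := ((dΓ'.clm_apply db).clm_apply da).clm_apply dc
    have t3 := (dΓ.clm_apply da).clm_apply ((dΓ.clm_apply db).clm_apply dc)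
    have t4 := (dΓ.clm_apply db).clm_apply ((dΓ.clm_apply da).clm_apply dc)
    have z := h.lie_curvC (hy.mapsTo hq) (a q) (b q) (c q)
    simp only [curvC] at z ⊢
    rw [fderiv_fun_sub ((t1.fun_sub t2).fun_add t3) t4, fderiv_fun_add (t1.fun_sub t2) t3,
      fderiv_fun_sub t1 t2]
    simp only [_root_.add_apply, _root_.sub_apply]
    rw [fderiv_clm_apply₃ dΓ' da db dc, fderiv_clm_apply₃ dΓ' db da dc,
      fderiv_clm_apply₂ dΓ da ((dΓ.clm_apply db).clm_apply dc),
      fderiv_clm_apply₂ dΓ db ((dΓ.clm_apply da).clm_apply dc),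
      fderiv_clm_apply₂ dΓ db dc, fderiv_clm_apply₂ dΓ da dc,
      fderiv_comp_apply' cΓ.differentiableAt_infty hyd,
      fderiv_comp_apply' cΓ.fderiv_infty.differentiableAt_infty hyd,
      hy.fderiv_fst q hq, ha.fderiv_fst q hq, hb.fderiv_fst q hq, hc.fderiv_fst q hq]
    simp only [map_add, map_sub] at z ⊢
    linear_combination (norm := module) z

/-- An invariant section is a Jacobi field along the integral curves of `ξ`. -/
lemma covC_covC_fst {V : ℝ × ℝ → E} (hV : IsInvariantAlong ξ y Q V) {q : ℝ × ℝ} (hq : q ∈ Q) :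
    covC Γ y (fun p ↦ covC Γ y V p (1, 0)) q (1, 0) =
      curvC Γ (y q) (fderiv ℝ y q (1, 0)) (V q) (fderiv ℝ y q (1, 0)) := by
  have hyd := (hy.contDiffAt hq).differentiableAt_infty
  have cΓ := h.contDiffAt_Γ (hy.mapsTo hq)
  have cξ := h.contDiffAt_ξ (hy.mapsTo hq)
  have dV := (hV.contDiffAt hy.isOpen hq).differentiableAt_infty
  have dΓ : DifferentiableAt ℝ (fun p ↦ Γ (y p)) q := cΓ.differentiableAt_infty.comp q hyd
  have dξ : DifferentiableAt ℝ (fun p ↦ ξ (y p)) q := cξ.differentiableAt_infty.comp q hyd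
  have dξ' : DifferentiableAt ℝ (fun p ↦ fderiv ℝ ξ (y p)) q :=
    cξ.fderiv_infty.differentiableAt_infty.comp q hyd
  -- By invariance, `∇_t V = ∇_V ξ`. The Jacobi equation is then the identity `∇_ξ ξ = 0`
  -- differentiated in the direction `V`.
  have e : (fun p ↦ covC Γ y V p (1, 0)) =ᶠ[𝓝 q]
      fun p ↦ fderiv ℝ ξ (y p) (V p) + Γ (y p) (ξ (y p)) (V p) := by
    filter_upwards [hy.isOpen.mem_nhds hq] with p hp
    rw [covC, hV.fderiv_fst p hp, hy.fderiv_fst p hp]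
  rw [covC_congr (EventuallyEq.refl _ _) e, covC, fderiv_fun_add (dξ'.clm_apply dV)
    ((dΓ.clm_apply dξ).clm_apply dV), _root_.add_apply, fderiv_clm_apply₁ dξ' dV,
    fderiv_clm_apply₂ dΓ dξ dV, fderiv_comp_apply' cΓ.differentiableAt_infty hyd,
    fderiv_comp_apply' cξ.differentiableAt_infty hyd,
    fderiv_comp_apply' cξ.fderiv_infty.differentiableAt_infty hyd,
    hy.fderiv_fst q hq, hV.fderiv_fst q hq]
  have g1 := h.geodesic (y q) (hy.mapsTo hq)
  have g1' := congrArg (fun x ↦ Γ (y q) x (V q)) g1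
  have g2 := h.fderiv_geodesic (hy.mapsTo hq) (V q)
  have s1 := h.symm (y q) (hy.mapsTo hq) (ξ (y q))
  simp only [curvC, map_add, map_zero, _root_.add_apply, _root_.zero_apply] at g1' ⊢
  rw [cξ.fderiv_apply_comm] at g2
  rw [s1 (fderiv ℝ ξ (y q) (V q))] at g2 ⊢
  rw [s1 (V q), h.fderiv_symm (hy.mapsTo hq) (ξ (y q)) (ξ (y q)) (V q),
    h.symm _ (hy.mapsTo hq) (V q) (Γ (y q) (ξ (y q)) (ξ (y q)))]
  linear_combination (norm := module) g2 + g1'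

lemma covC_fst_fst {q : ℝ × ℝ} (hq : q ∈ Q) :
    covC Γ y (fun p ↦ fderiv ℝ y p (1, 0)) q (1, 0) = 0 := by
  rw [covC, fderiv_clm_apply₁ (hy.contDiffAt hq).fderiv_infty.differentiableAt_infty (by fun_prop),
    h.fderiv_fderiv_flow hy hq, hy.fderiv_fst q hq]
  simpa using h.geodesic (y q) (hy.mapsTo hq)

end IsAffineGeodesicField

end FlowSurface

/-! ### Christoffel symbols of a metric on an open set; unit Killing fields. -/

section MetricCalculus

open Filter Topology

variable {E : Type*} [NormedAddCommGroup E] [NormedSpace ℝ E]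
  {X : Type*} [NormedAddCommGroup X] [NormedSpace ℝ X]

/-- The Christoffel symbols of the first kind of `g`, as a function of the derivative of `g`. -/
def koszulC (D : E →L[ℝ] E →L[ℝ] E →L[ℝ] ℝ) : E →L[ℝ] E →L[ℝ] E →L[ℝ] ℝ :=
  (1 / 2 : ℝ) • (D + D.flip - ((ContinuousLinearMap.flipₗᵢ ℝ E E ℝ).toContinuousLinearEquiv :
    (E →L[ℝ] E →L[ℝ] ℝ) →L[ℝ] (E →L[ℝ] E →L[ℝ] ℝ)).comp D.flip)

lemma koszulC_apply (D : E →L[ℝ] E →L[ℝ] E →L[ℝ] ℝ) (u v w : E) :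
    koszulC D u v w = 1 / 2 * (D u v w + D v u w - D w u v) := by
  simp [koszulC]

/-- The Christoffel symbols of the metric `g` on a vector space. -/
def chrC (g : E → E →L[ℝ] E →L[ℝ] ℝ) (z : E) : E →L[ℝ] E →L[ℝ] E :=
  (ContinuousLinearMap.compL ℝ E (E →L[ℝ] ℝ) E (g z).inverse).comp (koszulC (fderiv ℝ g z))

/-- `g` is a smooth Riemannian metric on the open set `Ω`. -/
structure IsMetricOn (g : E → E →L[ℝ] E →L[ℝ] ℝ) (Ω : Set E) : Prop where
  isOpen : IsOpen Ω
  contDiffOn : ContDiffOn ℝ ∞ g Ω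
  symm : ∀ z ∈ Ω, ∀ u v, g z u v = g z v u
  pos : ∀ z ∈ Ω, ∀ u, u ≠ 0 → 0 < g z u u

lemma isInvertible_of_pos [FiniteDimensional ℝ E] {B : E →L[ℝ] E →L[ℝ] ℝ}
    (hB : ∀ u, u ≠ 0 → 0 < B u u) : B.IsInvertible := by
  have hinj : Function.Injective B.toLinearMap := by
    rw [← LinearMap.ker_eq_bot, LinearMap.ker_eq_bot']
    intro u hu
    by_contra h
    have h1 := hB u h
    have h2 : B u = 0 := hu
    simp [h2] at h1
  have hfin : Module.finrank ℝ E = Module.finrank ℝ (E →L[ℝ] ℝ) := by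
    rw [← LinearEquiv.finrank_eq (LinearMap.toContinuousLinearMap (𝕜 := ℝ) (E := E) (F' := ℝ))]
    exact (Subspace.dual_finrank_eq).symm
  exact ⟨(LinearEquiv.ofInjectiveOfFinrankEq B.toLinearMap hinj hfin).toContinuousLinearEquiv,
    by ext; rfl⟩

namespace IsMetricOn

variable {g : E → E →L[ℝ] E →L[ℝ] ℝ} {Ω : Set E}

lemma contDiffAt (h : IsMetricOn g Ω) {z : E} (hz : z ∈ Ω) : ContDiffAt ℝ ∞ g z :=
  h.contDiffOn.contDiffAt (h.isOpen.mem_nhds hz)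

lemma nondegenerate (h : IsMetricOn g Ω) {z : E} (hz : z ∈ Ω) {a b : E}
    (hab : ∀ w, g z a w = g z b w) : a = b := by
  by_contra hne
  have h1 := h.pos z hz (a - b) (sub_ne_zero.2 hne)
  have h2 := hab (a - b)
  simp only [map_sub, _root_.sub_apply] at h1 h2
  linarith

lemma fderiv_symm (h : IsMetricOn g Ω) {z : E} (hz : z ∈ Ω) (w u v : E) :
    fderiv ℝ g z w u v = fderiv ℝ g z w v u := by
  have hg := (h.contDiffAt hz).differentiableAt_infty
  have e1 : fderiv ℝ (fun p ↦ g p u v) z w = fderiv ℝ (fun p ↦ g p v u) z w := by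
    congr 1
    refine Filter.EventuallyEq.fderiv_eq ?_
    filter_upwards [h.isOpen.mem_nhds hz] with p hp using h.symm p hp u v
  rw [fderiv_clm_apply₂ hg (by fun_prop) (by fun_prop),
    fderiv_clm_apply₂ hg (by fun_prop) (by fun_prop)] at e1
  simpa using e1

variable [FiniteDimensional ℝ E]

lemma isInvertible (h : IsMetricOn g Ω) {z : E} (hz : z ∈ Ω) : (g z).IsInvertible :=
  isInvertible_of_pos (h.pos z hz)

lemma chrC_spec (h : IsMetricOn g Ω) {z : E} (hz : z ∈ Ω) (u v w : E) :
    g z (chrC g z u v) w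
      = 1 / 2 * (fderiv ℝ g z u v w + fderiv ℝ g z v u w - fderiv ℝ g z w u v) := by
  rw [← koszulC_apply]
  have : g z ((g z).inverse (koszulC (fderiv ℝ g z) u v)) = koszulC (fderiv ℝ g z) u v :=
    (h.isInvertible hz).self_apply_inverse _
  exact congrArg (fun L : E →L[ℝ] ℝ ↦ L w) this

lemma chrC_symm (h : IsMetricOn g Ω) {z : E} (hz : z ∈ Ω) (u v : E) :
    chrC g z u v = chrC g z v u := by
  refine h.nondegenerate hz fun w ↦ ?_
  rw [h.chrC_spec hz, h.chrC_spec hz, h.fderiv_symm hz w u v]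
  ring

lemma chrC_compat (h : IsMetricOn g Ω) {z : E} (hz : z ∈ Ω) (w u v : E) :
    fderiv ℝ g z w u v = g z (chrC g z w u) v + g z u (chrC g z w v) := by
  rw [h.symm z hz u, h.chrC_spec hz, h.chrC_spec hz, h.fderiv_symm hz u w v,
    h.fderiv_symm hz v w u, h.fderiv_symm hz w v u]
  ring

lemma contDiffOn_inverse (h : IsMetricOn g Ω) :
    ContDiffOn ℝ ∞ (fun z ↦ (g z).inverse) Ω := fun z hz ↦
  (((h.isInvertible hz).contDiffAt_map_inverse (n := ∞)).comp z
    (h.contDiffAt hz)).contDiffWithinAt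

lemma contDiffOn_chrC (h : IsMetricOn g Ω) : ContDiffOn ℝ ∞ (chrC g) Ω := by
  have hi := h.contDiffOn_inverse
  have hd : ContDiffOn ℝ ∞ (fderiv ℝ g) Ω := fun z hz ↦
    (h.contDiffAt hz).fderiv_infty.contDiffWithinAt
  have hk : ContDiffOn ℝ ∞ (fun z ↦ koszulC (fderiv ℝ g z)) Ω := by
    rw [contDiffOn_clm_apply]; intro u
    rw [contDiffOn_clm_apply]; intro v
    rw [contDiffOn_clm_apply]; intro w
    simp only [koszulC_apply]
    have hd' : ∀ a b c : E, ContDiffOn ℝ ∞ (fun z ↦ fderiv ℝ g z a b c) Ω := fun a b c ↦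
      ((hd.clm_apply contDiffOn_const).clm_apply contDiffOn_const).clm_apply contDiffOn_const
    exact contDiffOn_const.mul (((hd' u v w).add (hd' v u w)).sub (hd' w u v))
  rw [contDiffOn_clm_apply]; intro u
  rw [contDiffOn_clm_apply]; intro v
  exact hi.clm_apply ((hk.clm_apply contDiffOn_const).clm_apply contDiffOn_const)

/-- The transformation law of the Christoffel symbols under an isometry. -/
lemma chrC_transform [FiniteDimensional ℝ X] {g' : X → X →L[ℝ] X →L[ℝ] ℝ} {Ω' : Set X}
    (h : IsMetricOn g Ω) (h' : IsMetricOn g' Ω') {c : X → E} {z : X} (hz : z ∈ Ω')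
    (hcz : c z ∈ Ω) (hc : ContDiffAt ℝ ∞ c z)
    (hiso : ∀ᶠ p in 𝓝 z, ∀ u v, g' p u v = g (c p) (fderiv ℝ c p u) (fderiv ℝ c p v))
    (hsurj : Function.Surjective (fderiv ℝ c z)) (u v : X) :
    fderiv ℝ c z (chrC g' z u v) =
      fderiv ℝ (fderiv ℝ c) z u v + chrC g (c z) (fderiv ℝ c z u) (fderiv ℝ c z v) := by
  have dg := (h.contDiffAt hcz).differentiableAt_infty
  have dc := hc.differentiableAt_infty
  have dc' := hc.fderiv_infty.differentiableAt_infty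
  -- With `H = c'' + Γ(c', c')`, this is `∂_a g'(b, d) = g(H(a, b), c'd) + g(c'b, H(a, d))`. Since
  -- `H` is symmetric, the alternating sum of the Koszul formula leaves `g(H(u, v), c'w)` alone.
  have key : ∀ a b d : X, fderiv ℝ g' z a b d =
      g (c z) (fderiv ℝ (fderiv ℝ c) z a b + chrC g (c z) (fderiv ℝ c z a) (fderiv ℝ c z b))
        (fderiv ℝ c z d)
      + g (c z) (fderiv ℝ c z b)
        (fderiv ℝ (fderiv ℝ c) z a d + chrC g (c z) (fderiv ℝ c z a) (fderiv ℝ c z d)) := by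
    intro a b d
    have dgc : DifferentiableAt ℝ (fun p ↦ g (c p)) z := dg.comp z dc
    have e : fderiv ℝ (fun p ↦ g' p b d) z a
        = fderiv ℝ (fun p ↦ g (c p) (fderiv ℝ c p b) (fderiv ℝ c p d)) z a := by
      congr 1
      refine Filter.EventuallyEq.fderiv_eq ?_
      filter_upwards [hiso] with p hp using hp b d
    rw [fderiv_clm_apply₂ (h'.contDiffAt hz).differentiableAt_infty (by fun_prop) (by fun_prop),
      fderiv_clm_apply₂ dgc (dc'.clm_apply (by fun_prop)) (dc'.clm_apply (by fun_prop)),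
      fderiv_clm_apply₁ dc' (by fun_prop), fderiv_clm_apply₁ dc' (by fun_prop),
      fderiv_comp_apply' dg dc, h.chrC_compat hcz] at e
    simp only [fderiv_fun_const, Pi.zero_apply, _root_.zero_apply, map_zero, add_zero] at e
    rw [e]
    simp only [map_add, _root_.add_apply]
    ring
  refine h.nondegenerate hcz fun w' ↦ ?_
  obtain ⟨w, rfl⟩ := hsurj w'
  rw [← hiso.self_of_nhds, h'.chrC_spec hz, key, key, key, hc.fderiv_apply_comm v u,
    hc.fderiv_apply_comm w u, hc.fderiv_apply_comm w v, h.chrC_symm hcz (fderiv ℝ c z v),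
    h.chrC_symm hcz (fderiv ℝ c z w), h.chrC_symm hcz (fderiv ℝ c z w),
    h.symm _ hcz (fderiv ℝ c z v), h.symm _ hcz (fderiv ℝ c z u)]
  simp only [map_add, _root_.add_apply]
  ring

/-- A unit Killing field is affine for the Levi-Civita connection and its integral curves are
geodesics. -/
lemma isAffineGeodesicField (h : IsMetricOn g Ω) {ξ : E → E} (hξ : ContDiffOn ℝ ∞ ξ Ω)
    (hK : ∀ z ∈ Ω, ∀ u v,
      fderiv ℝ g z (ξ z) u v + g z (fderiv ℝ ξ z u) v + g z u (fderiv ℝ ξ z v) = 0)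
    (h1 : ∀ z ∈ Ω, g z (ξ z) (ξ z) = 1) : IsAffineGeodesicField (chrC g) ξ Ω where
  isOpen := h.isOpen
  contDiffOn_Γ := h.contDiffOn_chrC
  contDiffOn_ξ := hξ
  symm z hz := h.chrC_symm hz
  geodesic z hz := by
    have dg := (h.contDiffAt hz).differentiableAt_infty
    have cξ : ContDiffAt ℝ ∞ ξ z := hξ.contDiffAt (h.isOpen.mem_nhds hz)
    refine h.nondegenerate hz fun w ↦ ?_
    -- Unit length gives `g(∇_w ξ, ξ) = 0`, and the Killing equation turns this into `g(∇_ξ ξ, w) =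
    -- 0`.
    have e : fderiv ℝ (fun p ↦ g p (ξ p) (ξ p)) z w = 0 := by
      have : (fun p ↦ g p (ξ p) (ξ p)) =ᶠ[𝓝 z] fun _ ↦ 1 := by
        filter_upwards [h.isOpen.mem_nhds hz] with p hp using h1 p hp
      rw [this.fderiv_eq]; simp
    rw [fderiv_clm_apply₂ dg cξ.differentiableAt_infty cξ.differentiableAt_infty,
      h.symm z hz (ξ z)] at e
    have k := hK z hz (ξ z) w
    rw [h.symm z hz (ξ z)] at k
    simp only [map_add, _root_.add_apply, map_zero, _root_.zero_apply]
    rw [h.chrC_spec hz]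
    linarith
  affine z hz u v := by
    have dg := (h.contDiffAt hz).differentiableAt_infty
    have dg' := (h.contDiffAt hz).fderiv_infty.differentiableAt_infty
    have cξ : ContDiffAt ℝ ∞ ξ z := hξ.contDiffAt (h.isOpen.mem_nhds hz)
    have dξ := cξ.differentiableAt_infty
    have dξ' := cξ.fderiv_infty.differentiableAt_infty
    have dΓ : DifferentiableAt ℝ (chrC g) z :=
      (h.contDiffOn_chrC.contDiffAt (h.isOpen.mem_nhds hz)).differentiableAt_infty
    have cst : ∀ a : E, DifferentiableAt ℝ (fun _ : E ↦ a) z := fun a ↦ differentiableAt_const a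
    have dK : ∀ a b w, fderiv ℝ (fderiv ℝ g) z (ξ z) w a b + fderiv ℝ g z (fderiv ℝ ξ z w) a b
        + (fderiv ℝ g z w (fderiv ℝ ξ z a) b + g z (fderiv ℝ (fderiv ℝ ξ) z w a) b)
        + (fderiv ℝ g z w a (fderiv ℝ ξ z b) + g z a (fderiv ℝ (fderiv ℝ ξ) z w b)) = 0 := by
      intro a b w
      have e : fderiv ℝ (fun p ↦ fderiv ℝ g p (ξ p) a b + g p (fderiv ℝ ξ p a) b
          + g p a (fderiv ℝ ξ p b)) z w = 0 := by
        have : (fun p ↦ fderiv ℝ g p (ξ p) a b + g p (fderiv ℝ ξ p a) b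
          + g p a (fderiv ℝ ξ p b)) =ᶠ[𝓝 z] fun _ ↦ 0 := by
          filter_upwards [h.isOpen.mem_nhds hz] with p hp using hK p hp a b
        rw [this.fderiv_eq]; simp
      have t1 := ((dg'.clm_apply dξ).clm_apply (cst a)).clm_apply (cst b)
      have t2 := (dg.clm_apply (dξ'.clm_apply (cst a))).clm_apply (cst b)
      have t3 := (dg.clm_apply (cst a)).clm_apply (dξ'.clm_apply (cst b))
      rw [fderiv_fun_add (t1.fun_add t2) t3, fderiv_fun_add t1 t2, _root_.add_apply,
        _root_.add_apply, fderiv_clm_apply₃ dg' dξ (cst a) (cst b),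
        fderiv_clm_apply₂ dg (dξ'.clm_apply (cst a)) (cst b),
        fderiv_clm_apply₂ dg (cst a) (dξ'.clm_apply (cst b)), fderiv_clm_apply₁ dξ' (cst a),
        fderiv_clm_apply₁ dξ' (cst b), (h.contDiffAt hz).fderiv_apply_comm] at e
      simpa using e
    refine h.nondegenerate hz fun w ↦ ?_
    -- The Koszul formula is differentiated along `ξ`. The second derivatives of the metric are then
    -- eliminated by `dK`, the derivative of the Killing equation, used for the three cyclic choices
    -- of directions.
    have dS : fderiv ℝ g z (ξ z) (chrC g z u v) w + g z (fderiv ℝ (chrC g) z (ξ z) u v) w =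
        1 / 2 * (fderiv ℝ (fderiv ℝ g) z (ξ z) u v w + fderiv ℝ (fderiv ℝ g) z (ξ z) v u w
          - fderiv ℝ (fderiv ℝ g) z (ξ z) w u v) := by
      have e : fderiv ℝ (fun p ↦ g p (chrC g p u v) w) z (ξ z) =
          fderiv ℝ (fun p ↦ 1 / 2 * (fderiv ℝ g p u v w + fderiv ℝ g p v u w
            - fderiv ℝ g p w u v)) z (ξ z) := by
        congr 1
        refine Filter.EventuallyEq.fderiv_eq ?_
        filter_upwards [h.isOpen.mem_nhds hz] with p hp using h.chrC_spec hp u v w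
      have t : ∀ a b d : E, DifferentiableAt ℝ (fun p ↦ fderiv ℝ g p a b d) z := fun a b d ↦
        ((dg'.clm_apply (cst a)).clm_apply (cst b)).clm_apply (cst d)
      have t' : ∀ a b d x : E, fderiv ℝ (fun p ↦ fderiv ℝ g p a b d) z x
          = fderiv ℝ (fderiv ℝ g) z x a b d := fun a b d x ↦ by
        rw [fderiv_clm_apply₃ dg' (cst a) (cst b) (cst d)]; simp
      rw [fderiv_clm_apply₂ dg ((dΓ.clm_apply (cst u)).clm_apply (cst v)) (cst w),
        fderiv_clm_apply₂ dΓ (cst u) (cst v),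
        fderiv_const_mul (((t u v w).fun_add (t v u w)).fun_sub (t w u v)),
        fderiv_fun_sub ((t u v w).fun_add (t v u w)) (t w u v),
        fderiv_fun_add (t u v w) (t v u w)] at e
      simp only [_root_.smul_apply, _root_.sub_apply, _root_.add_apply, t'] at e
      simpa using e
    have k1 := dK v w u
    have k2 := dK u w v
    have k3 := dK u v w
    have k4 := hK z hz (chrC g z u v) w
    have c1 := h.chrC_spec hz (fderiv ℝ ξ z u) v w
    have c2 := h.chrC_spec hz u (fderiv ℝ ξ z v) w
    have c3 := h.chrC_spec hz u v (fderiv ℝ ξ z w)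
    have s1 := h.fderiv_symm hz w (fderiv ℝ ξ z u) v
    have s4 := h.symm z hz (fderiv ℝ (fderiv ℝ ξ) z u w) v
    have s5 := h.symm z hz (fderiv ℝ (fderiv ℝ ξ) z v w) u
    rw [cξ.fderiv_apply_comm v u] at k2
    rw [cξ.fderiv_apply_comm w u, cξ.fderiv_apply_comm w v] at k3
    simp only [map_add, map_sub, _root_.add_apply, _root_.sub_apply, map_zero, _root_.zero_apply]
    linarith

end IsMetricOn

end MetricCalculus

/-! ### Representatives of maps and sections in fixed charts. -/

section ChartReps

open Filter Topology

variable {E : Type*} [NormedAddCommGroup E] [NormedSpace ℝ E]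
  {N : Type*} [TopologicalSpace N] [ChartedSpace E N] [IsManifold 𝓘(ℝ, E) ∞ N]
  {E' : Type*} [NormedAddCommGroup E'] [NormedSpace ℝ E']
  {M : Type*} [TopologicalSpace M] [ChartedSpace E' M] [IsManifold 𝓘(ℝ, E') ∞ M]
  {F : Type*} [NormedAddCommGroup F] [NormedSpace ℝ F]

variable (E E') in
/-- The local representative of `f` in the preferred charts at `p` and `x`. -/
def repMap (p : M) (x : N) (f : M → N) : E' → E :=
  fun z ↦ extChartAt 𝓘(ℝ, E) x (f ((extChartAt 𝓘(ℝ, E') p).symm z))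

variable (E E') in
/-- The local representative, in the preferred charts at `p` and `x`, of a section along `f`. -/
def repSec (p : M) (x : N) (f : M → N) (V : Π q : M, TangentSpace 𝓘(ℝ, E) (f q)) : E' → E :=
  fun z ↦ toChart 𝓘(ℝ, E) x (f ((extChartAt 𝓘(ℝ, E') p).symm z))
    (V ((extChartAt 𝓘(ℝ, E') p).symm z))

/-- The metric in the preferred chart at `x`, as a function on the model space. -/
def metricRep (h : SmoothMetric 𝓘(ℝ, E) N) (x : N) : E → E →L[ℝ] E →L[ℝ] ℝ :=
  fun z ↦ metricInChart h x ((extChartAt 𝓘(ℝ, E) x).symm z)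

lemma toChart_ofChart {x q : N} (hq : q ∈ (chartAt E x).source) (u : E) :
    toChart 𝓘(ℝ, E) x q (ofChart 𝓘(ℝ, E) x q u) = u :=
  (trivializationAt E (fun y : N ↦ TangentSpace 𝓘(ℝ, E) y) x).continuousLinearMapAt_symmL (R := ℝ)
    (b := q) hq u

lemma ofChart_toChart {x q : N} (hq : q ∈ (chartAt E x).source) (u : TangentSpace 𝓘(ℝ, E) q) :
    ofChart 𝓘(ℝ, E) x q (toChart 𝓘(ℝ, E) x q u) = u :=
  (trivializationAt E (fun y : N ↦ TangentSpace 𝓘(ℝ, E) y) x).symmL_continuousLinearMapAt (R := ℝ)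
    (b := q) hq u

lemma toChart_injective {x q : N} (hq : q ∈ (chartAt E x).source) :
    Function.Injective (toChart 𝓘(ℝ, E) x q) :=
  Function.LeftInverse.injective (ofChart_toChart hq)

lemma toChart_eq_mvfderiv {x q : N} (hq : q ∈ (chartAt E x).source) :
    toChart 𝓘(ℝ, E) x q = mvfderiv 𝓘(ℝ, E) (extChartAt 𝓘(ℝ, E) x) q :=
  TangentBundle.continuousLinearMapAt_trivializationAt hq

lemma extChartAt_mem_target {x q : N} (hq : q ∈ (chartAt E x).source) :
    extChartAt 𝓘(ℝ, E) x q ∈ (extChartAt 𝓘(ℝ, E) x).target :=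
  (extChartAt 𝓘(ℝ, E) x).map_source (by rwa [extChartAt_source])

lemma extChartAt_symm_apply {x q : N} (hq : q ∈ (chartAt E x).source) :
    (extChartAt 𝓘(ℝ, E) x).symm (extChartAt 𝓘(ℝ, E) x q) = q :=
  (extChartAt 𝓘(ℝ, E) x).left_inv (by rwa [extChartAt_source])

lemma extChartAt_symm_mem {x : N} {z : E} (hz : z ∈ (extChartAt 𝓘(ℝ, E) x).target) :
    (extChartAt 𝓘(ℝ, E) x).symm z ∈ (chartAt E x).source := by
  rw [← extChartAt_source 𝓘(ℝ, E)]
  exact (extChartAt 𝓘(ℝ, E) x).map_target hz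

lemma contMDiffAt_extChartAt_of_mem {x q : N} (hq : q ∈ (chartAt E x).source) :
    ContMDiffAt 𝓘(ℝ, E) 𝓘(ℝ, E) ∞ (extChartAt 𝓘(ℝ, E) x) q :=
  contMDiffAt_extChartAt' hq

lemma contMDiffAt_extChartAt_symm_of_mem {x : N} {z : E}
    (hz : z ∈ (extChartAt 𝓘(ℝ, E) x).target) :
    ContMDiffAt 𝓘(ℝ, E) 𝓘(ℝ, E) ∞ (extChartAt 𝓘(ℝ, E) x).symm z :=
  (contMDiffOn_extChartAt_symm x).contMDiffAt ((isOpen_extChartAt_target x).mem_nhds hz)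

lemma eventually_extChartAt_symm_mem {x : N} {z : E} (hz : z ∈ (extChartAt 𝓘(ℝ, E) x).target)
    {s : Set N} (hs : s ∈ 𝓝 ((extChartAt 𝓘(ℝ, E) x).symm z)) :
    ∀ᶠ z' in 𝓝 z, (extChartAt 𝓘(ℝ, E) x).symm z' ∈ s :=
  (contMDiffAt_extChartAt_symm_of_mem hz).continuousAt.eventually hs

lemma contMDiffAt_iff_repMap {f : M → N} {p q : M} {x : N} (hq : q ∈ (chartAt E' p).source)
    (hx : f q ∈ (chartAt E x).source) :
    ContMDiffAt 𝓘(ℝ, E') 𝓘(ℝ, E) ∞ f q ↔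
      ContinuousAt f q ∧ ContDiffAt ℝ ∞ (repMap E E' p x f) (extChartAt 𝓘(ℝ, E') p q) := by
  rw [contMDiffAt_iff_of_mem_source hq hx]
  simp only [modelWithCornersSelf_coe, range_id, contDiffWithinAt_univ]
  rfl

lemma ContMDiffAt.repMap {f : M → N} {p q : M} {x : N} (hf : ContMDiffAt 𝓘(ℝ, E') 𝓘(ℝ, E) ∞ f q)
    (hq : q ∈ (chartAt E' p).source) (hx : f q ∈ (chartAt E x).source) :
    ContDiffAt ℝ ∞ (repMap E E' p x f) (extChartAt 𝓘(ℝ, E') p q) :=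
  ((contMDiffAt_iff_repMap hq hx).1 hf).2

/-- The chart is centred at an arbitrary `p` and not at `q`: iterated derivatives near a point need
a single chart for all nearby `q`. -/
lemma mvfderiv_eq_fderiv {φ : M → F} {p q : M} (hq : q ∈ (chartAt E' p).source)
    (hφ : DifferentiableAt ℝ (φ ∘ (extChartAt 𝓘(ℝ, E') p).symm) (extChartAt 𝓘(ℝ, E') p q))
    (v : TangentSpace 𝓘(ℝ, E') q) :
    mvfderiv 𝓘(ℝ, E') φ q v = fderiv ℝ (φ ∘ (extChartAt 𝓘(ℝ, E') p).symm)
      (extChartAt 𝓘(ℝ, E') p q) (toChart 𝓘(ℝ, E') p q v) := by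
  have e : φ =ᶠ[𝓝 q] (φ ∘ (extChartAt 𝓘(ℝ, E') p).symm) ∘ extChartAt 𝓘(ℝ, E') p := by
    filter_upwards [(chartAt E' p).open_source.mem_nhds hq] with q' hq'
    simp only [Function.comp_apply, extChartAt_symm_apply hq']
  have h1 : mvfderiv 𝓘(ℝ, E') φ q v = mvfderiv 𝓘(ℝ, E')
      ((φ ∘ (extChartAt 𝓘(ℝ, E') p).symm) ∘ extChartAt 𝓘(ℝ, E') p) q v := by
    unfold mvfderiv
    rw [e.mfderiv_eq, e.eq_of_nhds]
  rw [h1, toChart_eq_mvfderiv hq]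
  have h2 := mfderiv_comp_apply q (hφ.mdifferentiableAt)
    ((contMDiffAt_extChartAt_of_mem hq).mdifferentiableAt (by simp)) v
  rw [mfderiv_eq_fderiv] at h2
  exact h2

lemma toChart_mfderiv {f : M → N} {p q : M} {x : N} (hf : ContMDiffAt 𝓘(ℝ, E') 𝓘(ℝ, E) ∞ f q)
    (hq : q ∈ (chartAt E' p).source) (hx : f q ∈ (chartAt E x).source)
    (v : TangentSpace 𝓘(ℝ, E') q) :
    toChart 𝓘(ℝ, E) x (f q) (mfderiv 𝓘(ℝ, E') 𝓘(ℝ, E) f q v) =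
      fderiv ℝ (repMap E E' p x f) (extChartAt 𝓘(ℝ, E') p q) (toChart 𝓘(ℝ, E') p q v) := by
  have h1 := mvfderiv_eq_fderiv (φ := extChartAt 𝓘(ℝ, E) x ∘ f) hq
    (hf.repMap hq hx).differentiableAt_infty v
  rw [toChart_eq_mvfderiv hx]
  refine Eq.trans ?_ h1
  exact (mfderiv_comp_apply q ((contMDiffAt_extChartAt_of_mem hx).mdifferentiableAt (by simp))
    (hf.mdifferentiableAt (by simp)) v).symm

end ChartReps

/-! ### Vector fields, Lie brackets and the metric in a chart. -/

section ChartFields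

open Filter Topology

variable {E : Type*} [NormedAddCommGroup E] [NormedSpace ℝ E]
  {N : Type*} [TopologicalSpace N] [ChartedSpace E N] [IsManifold 𝓘(ℝ, E) ∞ N]
  {E' : Type*} [NormedAddCommGroup E'] [NormedSpace ℝ E']
  {M : Type*} [TopologicalSpace M] [ChartedSpace E' M] [IsManifold 𝓘(ℝ, E') ∞ M]

lemma toChart_modelSpace (x q : E) (v : TangentSpace 𝓘(ℝ, E) q) :
    toChart 𝓘(ℝ, E) x q v = v := by
  unfold toChart
  rw [TangentBundle.continuousLinearMapAt_model_space]
  rfl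

/-- The representative, in the preferred chart at `x`, of a vector field. -/
def fieldRep (x : N) (X : Π q : N, TangentSpace 𝓘(ℝ, E) q) : E → E :=
  fun z ↦ toChart 𝓘(ℝ, E) x ((extChartAt 𝓘(ℝ, E) x).symm z) (X ((extChartAt 𝓘(ℝ, E) x).symm z))

lemma contMDiffAt_iff_contDiffAt_comp_symm {F : Type*} [NormedAddCommGroup F] [NormedSpace ℝ F]
    {φ : N → F} {x q : N} (hq : q ∈ (chartAt E x).source) :
    ContMDiffAt 𝓘(ℝ, E) 𝓘(ℝ, F) ∞ φ q ↔
      ContDiffAt ℝ ∞ (φ ∘ (extChartAt 𝓘(ℝ, E) x).symm) (extChartAt 𝓘(ℝ, E) x q) := by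
  constructor
  · intro h
    rw [← contMDiffAt_iff_contDiffAt]
    rw [← extChartAt_symm_apply hq] at h
    exact h.comp _ (contMDiffAt_extChartAt_symm_of_mem (extChartAt_mem_target hq))
  · intro h
    have e : φ =ᶠ[𝓝 q] (φ ∘ (extChartAt 𝓘(ℝ, E) x).symm) ∘ extChartAt 𝓘(ℝ, E) x := by
      filter_upwards [(chartAt E x).open_source.mem_nhds hq] with q' hq'
      simp only [Function.comp_apply, extChartAt_symm_apply hq']
    exact (h.contMDiffAt.comp q (contMDiffAt_extChartAt_of_mem hq)).congr_of_eventuallyEq e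

lemma contMDiffAt_section_iff_toChart {X : Π q : N, TangentSpace 𝓘(ℝ, E) q} {x q : N}
    (hq : q ∈ (chartAt E x).source) :
    ContMDiffAt 𝓘(ℝ, E) (𝓘(ℝ, E).prod 𝓘(ℝ, E)) ∞
      (fun x ↦ TotalSpace.mk' E (E := fun x : N ↦ TangentSpace 𝓘(ℝ, E) x) x (X x)) q ↔
    ContMDiffAt 𝓘(ℝ, E) 𝓘(ℝ, E) ∞ (fun q' ↦ toChart 𝓘(ℝ, E) x q' (X q')) q := by
  rw [(trivializationAt E (fun y : N ↦ TangentSpace 𝓘(ℝ, E) y) x).contMDiffAt_section_iff hq]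
  refine Filter.EventuallyEq.contMDiffAt_iff ?_
  filter_upwards [(chartAt E x).open_source.mem_nhds hq] with q' hq'
  exact (Trivialization.continuousLinearMapAt_apply_of_mem ℝ _ hq' _).symm

lemma contMDiffAt_section_iff_fieldRep {X : Π q : N, TangentSpace 𝓘(ℝ, E) q} {x q : N}
    (hq : q ∈ (chartAt E x).source) :
    ContMDiffAt 𝓘(ℝ, E) (𝓘(ℝ, E).prod 𝓘(ℝ, E)) ∞
      (fun x ↦ TotalSpace.mk' E (E := fun x : N ↦ TangentSpace 𝓘(ℝ, E) x) x (X x)) q ↔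
    ContDiffAt ℝ ∞ (fieldRep x X) (extChartAt 𝓘(ℝ, E) x q) := by
  rw [contMDiffAt_section_iff_toChart hq, contMDiffAt_iff_contDiffAt_comp_symm hq]
  rfl

lemma fieldRep_apply {x q : N} (hq : q ∈ (chartAt E x).source)
    (X : Π q : N, TangentSpace 𝓘(ℝ, E) q) :
    fieldRep x X (extChartAt 𝓘(ℝ, E) x q) = toChart 𝓘(ℝ, E) x q (X q) := by
  simp only [fieldRep]
  rw [extChartAt_symm_apply hq]

lemma fieldRep_ofChart {x : N} {z : E} (hz : z ∈ (extChartAt 𝓘(ℝ, E) x).target) (u : E) :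
    fieldRep x (fun q ↦ ofChart 𝓘(ℝ, E) x q u) z = u :=
  toChart_ofChart (extChartAt_symm_mem hz) u

lemma eventually_fieldRep_ofChart {x : N} {z : E} (hz : z ∈ (extChartAt 𝓘(ℝ, E) x).target)
    (u : E) : fieldRep x (fun q ↦ ofChart 𝓘(ℝ, E) x q u) =ᶠ[𝓝 z] fun _ ↦ u := by
  filter_upwards [(isOpen_extChartAt_target x).mem_nhds hz] with z' hz' using fieldRep_ofChart hz' u

/-- These are the coordinate fields of the chart at `x`, the test fields in conditions that quantify
over vector fields. -/
lemma contMDiffAt_ofChart {x q : N} (hq : q ∈ (chartAt E x).source) (u : E) :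
    ContMDiffAt 𝓘(ℝ, E) (𝓘(ℝ, E).prod 𝓘(ℝ, E)) ∞
      (fun y ↦ TotalSpace.mk' E (E := fun x : N ↦ TangentSpace 𝓘(ℝ, E) x) y
        (ofChart 𝓘(ℝ, E) x y u)) q := by
  rw [contMDiffAt_section_iff_fieldRep hq]
  exact contDiffAt_const.congr_of_eventuallyEq
    (eventually_fieldRep_ofChart (extChartAt_mem_target hq) u)

lemma toChart_mfderiv_symm {x : N} {z : E} (hz : z ∈ (extChartAt 𝓘(ℝ, E) x).target) (u : E) :
    toChart 𝓘(ℝ, E) x ((extChartAt 𝓘(ℝ, E) x).symm z)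
      (mfderiv 𝓘(ℝ, E) 𝓘(ℝ, E) (extChartAt 𝓘(ℝ, E) x).symm z u) = u := by
  refine (toChart_mfderiv (p := z) (contMDiffAt_extChartAt_symm_of_mem hz) (mem_chart_source _ _)
    (extChartAt_symm_mem hz) u).trans ?_
  have e1 : toChart 𝓘(ℝ, E) z z u = u := toChart_modelSpace z z u
  have e : repMap E E z x (extChartAt 𝓘(ℝ, E) x).symm =ᶠ[𝓝 z] id := by
    filter_upwards [(isOpen_extChartAt_target x).mem_nhds hz] with z' hz'
    simp only [repMap, extChartAt_model_space_eq_id, PartialEquiv.refl_symm,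
      PartialEquiv.refl_coe, id]
    exact (extChartAt 𝓘(ℝ, E) x).right_inv hz'
  have e2 : extChartAt 𝓘(ℝ, E) z z = z := rfl
  rw [e1, e2, e.fderiv_eq, fderiv_id]
  rfl

lemma mfderiv_symm_inverse {x : N} {z : E} (hz : z ∈ (extChartAt 𝓘(ℝ, E) x).target) :
    (mfderiv 𝓘(ℝ, E) 𝓘(ℝ, E) (extChartAt 𝓘(ℝ, E) x).symm z).inverse =
      toChart 𝓘(ℝ, E) x ((extChartAt 𝓘(ℝ, E) x).symm z) := by
  refine ContinuousLinearMap.inverse_eq ?_ ?_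
  · ext v
    apply toChart_injective (extChartAt_symm_mem hz)
    exact toChart_mfderiv_symm hz _
  · ext v
    exact toChart_mfderiv_symm hz v

/-- The Lie bracket in the preferred chart at `x`. -/
lemma toChart_mlieBracket [CompleteSpace E] {x q : N} (hq : q ∈ (chartAt E x).source)
    {X Y : Π q : N, TangentSpace 𝓘(ℝ, E) q}
    (hX : ContDiffAt ℝ ∞ (fieldRep x X) (extChartAt 𝓘(ℝ, E) x q))
    (hY : ContDiffAt ℝ ∞ (fieldRep x Y) (extChartAt 𝓘(ℝ, E) x q)) :
    toChart 𝓘(ℝ, E) x q (VectorField.mlieBracket 𝓘(ℝ, E) X Y q) =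
      fderiv ℝ (fieldRep x Y) (extChartAt 𝓘(ℝ, E) x q) (fieldRep x X (extChartAt 𝓘(ℝ, E) x q))
      - fderiv ℝ (fieldRep x X) (extChartAt 𝓘(ℝ, E) x q)
        (fieldRep x Y (extChartAt 𝓘(ℝ, E) x q)) := by
  have hz := extChartAt_mem_target hq
  have hX' := (contMDiffAt_section_iff_fieldRep hq).2 hX
  have hY' := (contMDiffAt_section_iff_fieldRep hq).2 hY
  rw [← extChartAt_symm_apply hq] at hX' hY'
  have : IsManifold 𝓘(ℝ, E) (minSmoothness ℝ 3) N := by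
    rw [minSmoothness_of_isRCLikeNormedField]
    exact IsManifold.of_le (n := ∞) ENat.LEInfty.out
  have : IsManifold 𝓘(ℝ, E) (minSmoothness ℝ 3) E := by
    rw [minSmoothness_of_isRCLikeNormedField]
    exact IsManifold.of_le (n := ∞) ENat.LEInfty.out
  -- The bracket is natural under pull-back by the inverse chart, and the pull-back of a field is
  -- its representative.
  have key := VectorField.mpullback_mlieBracket (n := ∞) (I := 𝓘(ℝ, E)) (I' := 𝓘(ℝ, E))
    (f := (extChartAt 𝓘(ℝ, E) x).symm) (x₀ := extChartAt 𝓘(ℝ, E) x q)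
    (hX'.mdifferentiableAt (by simp)) (hY'.mdifferentiableAt (by simp))
    (contMDiffAt_extChartAt_symm_of_mem hz) (by simpa using ENat.LEInfty.out)
  have eqv : ∀ Z : Π q : N, TangentSpace 𝓘(ℝ, E) q,
      (VectorField.mpullback 𝓘(ℝ, E) 𝓘(ℝ, E) (extChartAt 𝓘(ℝ, E) x).symm Z)
        =ᶠ[𝓝 (extChartAt 𝓘(ℝ, E) x q)] fieldRep x Z := by
    intro Z
    filter_upwards [(isOpen_extChartAt_target x).mem_nhds hz] with z' hz'
    rw [VectorField.mpullback_apply, mfderiv_symm_inverse hz']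
    rfl
  rw [VectorField.mpullback_apply, mfderiv_symm_inverse hz,
    (eqv X).mlieBracket_vectorField_eq (eqv Y), extChartAt_symm_apply hq] at key
  refine key.trans (congrFun (VectorField.mlieBracketWithin_eq_lieBracketWithin
    (V := fieldRep x X) (W := fieldRep x Y) (s := univ)) _) |>.trans ?_
  rw [VectorField.lieBracketWithin_univ]
  rfl

variable [FiniteDimensional ℝ E]

/-- The inner product in the preferred chart at `x`. -/
lemma metricRep_apply (h : SmoothMetric 𝓘(ℝ, E) N) {x q : N} (hq : q ∈ (chartAt E x).source)
    (u v : TangentSpace 𝓘(ℝ, E) q) :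
    metricRep h x (extChartAt 𝓘(ℝ, E) x q) (toChart 𝓘(ℝ, E) x q u) (toChart 𝓘(ℝ, E) x q v) =
      h.inner q u v := by
  simp only [metricRep]
  rw [extChartAt_symm_apply hq]
  simp [metricInChart, ofChart_toChart hq]

lemma isMetricOn_metricRep (h : SmoothMetric 𝓘(ℝ, E) N) (x : N) :
    IsMetricOn (metricRep h x) (extChartAt 𝓘(ℝ, E) x).target where
  isOpen := isOpen_extChartAt_target x
  contDiffOn := by
    rw [contDiffOn_clm_apply]; intro u
    rw [contDiffOn_clm_apply]; intro v z hz
    apply ContDiffAt.contDiffWithinAt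
    have hq := extChartAt_symm_mem hz
    have h1 : ContMDiffAt 𝓘(ℝ, E) 𝓘(ℝ, ℝ) ∞ (fun q : N ↦
        h.inner q (ofChart 𝓘(ℝ, E) x q u) (ofChart 𝓘(ℝ, E) x q v))
        ((extChartAt 𝓘(ℝ, E) x).symm z) := by
      have := ContMDiffAt.clm_bundle_apply₂ (F₁ := E) (F₂ := E) (F₃ := ℝ)
        (E₃ := Bundle.Trivial N ℝ) (b := fun q : N ↦ q)
        (h.contMDiff ((extChartAt 𝓘(ℝ, E) x).symm z)) (contMDiffAt_ofChart hq u)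
        (contMDiffAt_ofChart hq v)
      rw [Bundle.contMDiffAt_totalSpace] at this
      exact this.2
    rw [contMDiffAt_iff_contDiffAt_comp_symm hq, (extChartAt 𝓘(ℝ, E) x).right_inv hz] at h1
    exact h1
  symm z hz u v := h.symm _ _ _
  pos z hz u hu := by
    refine h.pos _ _ fun h0 ↦ hu ?_
    have := toChart_ofChart (extChartAt_symm_mem hz) u
    rw [← this]
    exact (congrArg _ h0).trans (map_zero _)

end ChartFields

/-! ### The covariant derivative along a map, in arbitrary charts. -/

section CovariantDerivative

open Filter Topology

variable {E : Type*} [NormedAddCommGroup E] [NormedSpace ℝ E] [FiniteDimensional ℝ E]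
  {N : Type*} [TopologicalSpace N] [ChartedSpace E N] [IsManifold 𝓘(ℝ, E) ∞ N]
  {E' : Type*} [NormedAddCommGroup E'] [NormedSpace ℝ E']
  {M : Type*} [TopologicalSpace M] [ChartedSpace E' M] [IsManifold 𝓘(ℝ, E') ∞ M]

/-- Both vectors satisfy the same Koszul identity, and the metric is nondegenerate. -/
lemma toChart_christoffel (h : SmoothMetric 𝓘(ℝ, E) N) (x : N) (u v : TangentSpace 𝓘(ℝ, E) x) :
    toChart 𝓘(ℝ, E) x x (christoffel h x u v) = chrC (metricRep h x) (extChartAt 𝓘(ℝ, E) x x)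
      (toChart 𝓘(ℝ, E) x x u) (toChart 𝓘(ℝ, E) x x v) := by
  have hx := mem_chart_source E x
  have hz := extChartAt_mem_target hx
  have hm := isMetricOn_metricRep h x
  refine hm.nondegenerate hz fun w' ↦ ?_
  obtain ⟨w, rfl⟩ : ∃ w, w' = toChart 𝓘(ℝ, E) x x w := ⟨_, (toChart_ofChart hx w').symm⟩
  rw [metricRep_apply h hx, hm.chrC_spec hz]
  have hinv : (h.inner x).IsInvertible :=
    isInvertible_of_pos (E := E) (B := h.inner x) (h.pos x)
  have hD : ∀ a b d : E, (mvfderiv 𝓘(ℝ, E) (metricInChart h x) x).comp (ofChart 𝓘(ℝ, E) x x) a b d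
      = fderiv ℝ (metricRep h x) (extChartAt 𝓘(ℝ, E) x x) a b d := by
    intro a b d
    have := mvfderiv_eq_fderiv (φ := metricInChart h x) hx (hm.contDiffAt hz).differentiableAt_infty
      (ofChart 𝓘(ℝ, E) x x a)
    rw [toChart_ofChart hx] at this
    exact congrArg (fun L : E →L[ℝ] E →L[ℝ] ℝ ↦ L b d) this
  unfold christoffel
  simp only
  rw [hinv.self_apply_inverse]
  simp only [ContinuousLinearMap.comp_apply, _root_.smul_apply, _root_.sub_apply, _root_.add_apply,
    ContinuousLinearMap.flip_apply, smul_eq_mul]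
  simp only [ContinuousLinearMap.comp_apply] at hD
  rw [hD, hD, hD]

lemma toChart_change {x x' q : N} (hq : q ∈ (chartAt E x).source) (hq' : q ∈ (chartAt E x').source)
    (w : TangentSpace 𝓘(ℝ, E) q) :
    toChart 𝓘(ℝ, E) x' q w =
      fderiv ℝ (repMap E E x x' (id : N → N)) (extChartAt 𝓘(ℝ, E) x q)
        (toChart 𝓘(ℝ, E) x q w) := by
  have := toChart_mfderiv (f := (id : N → N)) (p := x) (x := x') contMDiffAt_id hq hq' w
  rw [mfderiv_id] at this
  exact this

lemma contDiffAt_repMap_id {x x' q : N} (hq : q ∈ (chartAt E x).source)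
    (hq' : q ∈ (chartAt E x').source) :
    ContDiffAt ℝ ∞ (repMap E E x x' (id : N → N)) (extChartAt 𝓘(ℝ, E) x q) :=
  ContMDiffAt.repMap (f := (id : N → N)) contMDiffAt_id hq hq'

lemma fderiv_repMap_id_surjective {x x' q : N} (hq : q ∈ (chartAt E x).source)
    (hq' : q ∈ (chartAt E x').source) :
    Function.Surjective (fderiv ℝ (repMap E E x x' (id : N → N)) (extChartAt 𝓘(ℝ, E) x q)) := by
  intro u
  refine ⟨toChart 𝓘(ℝ, E) x q (ofChart 𝓘(ℝ, E) x' q u), ?_⟩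
  rw [← toChart_change hq hq', toChart_ofChart hq']

lemma eventually_mem_chart_source {x x' q : N} (hq : q ∈ (chartAt E x).source)
    (hq' : q ∈ (chartAt E x').source) :
    ∀ᶠ z in 𝓝 (extChartAt 𝓘(ℝ, E) x q), z ∈ (extChartAt 𝓘(ℝ, E) x).target ∧
      (extChartAt 𝓘(ℝ, E) x).symm z ∈ (chartAt E x').source := by
  have hz := extChartAt_mem_target hq
  refine Filter.Eventually.and ((isOpen_extChartAt_target x).mem_nhds hz) ?_
  refine eventually_extChartAt_symm_mem hz ?_
  rw [extChartAt_symm_apply hq]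
  exact (chartAt E x').open_source.mem_nhds hq'

/-- Change of charts for the Christoffel symbols. -/
lemma chrC_metricRep_change (h : SmoothMetric 𝓘(ℝ, E) N) {x x' q : N}
    (hq : q ∈ (chartAt E x).source) (hq' : q ∈ (chartAt E x').source) (u v : E) :
    fderiv ℝ (repMap E E x x' (id : N → N)) (extChartAt 𝓘(ℝ, E) x q)
        (chrC (metricRep h x) (extChartAt 𝓘(ℝ, E) x q) u v) =
      fderiv ℝ (fderiv ℝ (repMap E E x x' (id : N → N))) (extChartAt 𝓘(ℝ, E) x q) u v
      + chrC (metricRep h x') (extChartAt 𝓘(ℝ, E) x' q)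
        (fderiv ℝ (repMap E E x x' (id : N → N)) (extChartAt 𝓘(ℝ, E) x q) u)
        (fderiv ℝ (repMap E E x x' (id : N → N)) (extChartAt 𝓘(ℝ, E) x q) v) := by
  have e : repMap E E x x' (id : N → N) (extChartAt 𝓘(ℝ, E) x q) = extChartAt 𝓘(ℝ, E) x' q := by
    simp only [repMap, id]
    rw [extChartAt_symm_apply hq]
  rw [← e]
  refine (isMetricOn_metricRep h x').chrC_transform (isMetricOn_metricRep h x)
    (extChartAt_mem_target hq) (e ▸ extChartAt_mem_target hq') (contDiffAt_repMap_id hq hq') ?_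
    (fderiv_repMap_id_surjective hq hq') u v
  -- The transition map is an isometry between the two coordinate expressions of the metric.
  filter_upwards [eventually_mem_chart_source hq hq'] with z hz u v
  obtain ⟨y, hy, rfl⟩ : ∃ y ∈ (chartAt E x).source, z = extChartAt 𝓘(ℝ, E) x y :=
    ⟨_, extChartAt_symm_mem hz.1, ((extChartAt 𝓘(ℝ, E) x).right_inv hz.1).symm⟩
  have hy' := hz.2
  rw [extChartAt_symm_apply hy] at hy'
  have e : repMap E E x x' (id : N → N) (extChartAt 𝓘(ℝ, E) x y) = extChartAt 𝓘(ℝ, E) x' y := by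
    simp only [repMap, id]
    rw [extChartAt_symm_apply hy]
  have hu := toChart_ofChart hy u
  have hv := toChart_ofChart hy v
  rw [e, ← hu, ← hv, ← toChart_change hy hy', ← toChart_change hy hy', metricRep_apply h hy,
    metricRep_apply h hy']

lemma eventually_mem_of_contMDiffAt {f : M → N} {p q : M} {x : N}
    (hf : ContMDiffAt 𝓘(ℝ, E') 𝓘(ℝ, E) ∞ f q) (hq : q ∈ (chartAt E' p).source)
    (hx : f q ∈ (chartAt E x).source) :
    ∀ᶠ z in 𝓝 (extChartAt 𝓘(ℝ, E') p q), z ∈ (extChartAt 𝓘(ℝ, E') p).target ∧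
      f ((extChartAt 𝓘(ℝ, E') p).symm z) ∈ (chartAt E x).source := by
  have hz := extChartAt_mem_target hq
  refine Filter.Eventually.and ((isOpen_extChartAt_target p).mem_nhds hz) ?_
  refine eventually_extChartAt_symm_mem (s := f ⁻¹' (chartAt E x).source) hz ?_
  rw [extChartAt_symm_apply hq]
  exact hf.continuousAt ((chartAt E x).open_source.mem_nhds hx)

lemma repMap_apply {f : M → N} {p q : M} {x : N} (hq : q ∈ (chartAt E' p).source) :
    repMap E E' p x f (extChartAt 𝓘(ℝ, E') p q) = extChartAt 𝓘(ℝ, E) x (f q) := by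
  simp only [repMap]
  rw [extChartAt_symm_apply hq]

lemma repSec_apply {f : M → N} {V : Π q : M, TangentSpace 𝓘(ℝ, E) (f q)} {p q : M} {x : N}
    (hq : q ∈ (chartAt E' p).source) :
    repSec E E' p x f V (extChartAt 𝓘(ℝ, E') p q) = toChart 𝓘(ℝ, E) x (f q) (V q) := by
  simp only [repSec]
  rw [extChartAt_symm_apply hq]

/-- The covariant derivative along `f` in arbitrary charts. -/
lemma toChart_covAlong (h : SmoothMetric 𝓘(ℝ, E) N) {f : M → N} {p q : M} {x : N}
    {V : Π q : M, TangentSpace 𝓘(ℝ, E) (f q)}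
    (hf : ContMDiffAt 𝓘(ℝ, E') 𝓘(ℝ, E) ∞ f q) (hq : q ∈ (chartAt E' p).source)
    (hx : f q ∈ (chartAt E x).source)
    (hV : DifferentiableAt ℝ (repSec E E' p x f V) (extChartAt 𝓘(ℝ, E') p q))
    (v : TangentSpace 𝓘(ℝ, E') q) :
    toChart 𝓘(ℝ, E) x (f q) (covAlong 𝓘(ℝ, E') h f V q v) =
      covC (chrC (metricRep h x)) (repMap E E' p x f) (repSec E E' p x f V)
        (extChartAt 𝓘(ℝ, E') p q) (toChart 𝓘(ℝ, E') p q v) := by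
  have hx' := mem_chart_source E (f q)
  have dy := (hf.repMap hq hx).differentiableAt_infty
  have hy : repMap E E' p x f (extChartAt 𝓘(ℝ, E') p q) = extChartAt 𝓘(ℝ, E) x (f q) :=
    repMap_apply hq
  have cb := contDiffAt_repMap_id hx hx'
  have db : DifferentiableAt ℝ (fderiv ℝ (repMap E E x (f q) (id : N → N)))
      (repMap E E' p x f (extChartAt 𝓘(ℝ, E') p q)) := by
    rw [hy]; exact cb.fderiv_infty.differentiableAt_infty
  have dbc : DifferentiableAt ℝ (fun z ↦ fderiv ℝ (repMap E E x (f q) (id : N → N))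
      (repMap E E' p x f z)) (extChartAt 𝓘(ℝ, E') p q) := db.comp _ dy
  -- `covAlong` at `q` is defined in the chart centred at `f q`. Passing to the chart at `x`
  -- multiplies the section by the derivative of the transition map, and the second derivative that
  -- appears is absorbed by the transformation law of the Christoffel symbols.
  have e1 : repSec E E' p (f q) f V =ᶠ[𝓝 (extChartAt 𝓘(ℝ, E') p q)]
      fun z ↦ fderiv ℝ (repMap E E x (f q) (id : N → N)) (repMap E E' p x f z)
        (repSec E E' p x f V z) := by
    filter_upwards [eventually_mem_of_contMDiffAt hf hq hx,
      eventually_mem_of_contMDiffAt hf hq hx'] with z hz hz'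
    exact toChart_change hz.2 hz'.2 _
  have dV' : DifferentiableAt ℝ (repSec E E' p (f q) f V) (extChartAt 𝓘(ℝ, E') p q) :=
    (dbc.clm_apply hV).congr_of_eventuallyEq e1
  have k1 : mvfderiv 𝓘(ℝ, E') (fun q' ↦ toChart 𝓘(ℝ, E) (f q) (f q') (V q')) q v =
      fderiv ℝ (repSec E E' p (f q) f V) (extChartAt 𝓘(ℝ, E') p q) (toChart 𝓘(ℝ, E') p q v) :=
    mvfderiv_eq_fderiv (φ := fun q' ↦ toChart 𝓘(ℝ, E) (f q) (f q') (V q')) hq dV' v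
  have k2 : toChart 𝓘(ℝ, E) (f q) (f q) (covAlong 𝓘(ℝ, E') h f V q v) =
      fderiv ℝ (repSec E E' p (f q) f V) (extChartAt 𝓘(ℝ, E') p q) (toChart 𝓘(ℝ, E') p q v)
      + chrC (metricRep h (f q)) (extChartAt 𝓘(ℝ, E) (f q) (f q))
        (toChart 𝓘(ℝ, E) (f q) (f q) (mfderiv 𝓘(ℝ, E') 𝓘(ℝ, E) f q v))
        (toChart 𝓘(ℝ, E) (f q) (f q) (V q)) := by
    unfold covAlong
    rw [map_add, toChart_christoffel, k1, toChart_ofChart hx']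
  rw [toChart_change hx hx', e1.fderiv_eq, fderiv_clm_apply₁ dbc hV,
    fderiv_comp_apply' db dy, hy, toChart_change hx hx', toChart_change hx hx',
    toChart_mfderiv hf hq hx] at k2
  apply (toChart_injective (x := f q) hx').comp (g := toChart 𝓘(ℝ, E) (f q) (f q))
    (f := ofChart 𝓘(ℝ, E) x (f q)) ?_ |>.eq_iff.1
  · simp only [Function.comp_apply]
    rw [ofChart_toChart hx, toChart_change hx hx', k2, toChart_change hx hx', toChart_ofChart hx]
    rw [covC, map_add, hy, chrC_metricRep_change h hx hx', repSec_apply hq]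
    abel
  · exact Function.LeftInverse.injective (toChart_ofChart hx)

end CovariantDerivative

/-! ### The Levi-Civita connection and the curvature in a chart. -/

section LeviCivita

open Filter Topology

variable {E : Type*} [NormedAddCommGroup E] [NormedSpace ℝ E] [FiniteDimensional ℝ E]
  {N : Type*} [TopologicalSpace N] [ChartedSpace E N] [IsManifold 𝓘(ℝ, E) ∞ N]

lemma fderiv_fieldExpr {Γ : E → E →L[ℝ] E →L[ℝ] E} {Y Z : E → E} {z : E}
    (hΓ : ContDiffAt ℝ ∞ Γ z) (hY : ContDiffAt ℝ ∞ Y z) (hZ : ContDiffAt ℝ ∞ Z z) (v : E) :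
    covC Γ id (fun p ↦ covC Γ id Z p (Y p)) z v =
      fderiv ℝ (fderiv ℝ Z) z v (Y z) + fderiv ℝ Z z (fderiv ℝ Y z v)
      + (fderiv ℝ Γ z v (Y z) (Z z) + Γ z (fderiv ℝ Y z v) (Z z) + Γ z (Y z) (fderiv ℝ Z z v))
      + (Γ z v (fderiv ℝ Z z (Y z)) + Γ z v (Γ z (Y z) (Z z))) := by
  have dΓ := hΓ.differentiableAt_infty
  have dY := hY.differentiableAt_infty
  have dZ := hZ.differentiableAt_infty
  have dZ' := hZ.fderiv_infty.differentiableAt_infty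
  simp only [covC, fderiv_id, ContinuousLinearMap.id_apply, id]
  rw [fderiv_fun_add (dZ'.clm_apply dY) ((dΓ.clm_apply dY).clm_apply dZ), _root_.add_apply,
    fderiv_clm_apply₁ dZ' dY, fderiv_clm_apply₂ dΓ dY dZ, map_add]

/-- Tensoriality of the curvature: the second derivatives of `Z` cancel by symmetry, and the
derivatives of `X` and `Y` are matched by the bracket term. -/
lemma curvature_fields {Γ : E → E →L[ℝ] E →L[ℝ] E} {X Y Z : E → E} {z : E}
    (hΓ : ContDiffAt ℝ ∞ Γ z) (hX : ContDiffAt ℝ ∞ X z) (hY : ContDiffAt ℝ ∞ Y z)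
    (hZ : ContDiffAt ℝ ∞ Z z) :
    covC Γ id (fun p ↦ covC Γ id Z p (Y p)) z (X z) - covC Γ id (fun p ↦ covC Γ id Z p (X p)) z (Y z)
      - covC Γ id Z z (fderiv ℝ Y z (X z) - fderiv ℝ X z (Y z)) = curvC Γ z (X z) (Y z) (Z z) := by
  rw [fderiv_fieldExpr hΓ hY hZ, fderiv_fieldExpr hΓ hX hZ,
    hZ.fderiv_apply_comm (Y z)]
  simp only [covC, curvC, fderiv_id, ContinuousLinearMap.id_apply, id, map_sub, _root_.sub_apply]
  abel

lemma leviCivita_eq_covAlong (h : SmoothMetric 𝓘(ℝ, E) N) (X : Π q : N, TangentSpace 𝓘(ℝ, E) q)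
    (q : N) (v : TangentSpace 𝓘(ℝ, E) q) :
    leviCivita h X q v = covAlong (M := N) (f := id) 𝓘(ℝ, E) h X q v := by
  unfold leviCivita covAlong
  rw [mfderiv_id]
  rfl

lemma eventually_repMap_id (x : N) {z : E} (hz : z ∈ (extChartAt 𝓘(ℝ, E) x).target) :
    repMap E E x x (id : N → N) =ᶠ[𝓝 z] id := by
  filter_upwards [(isOpen_extChartAt_target x).mem_nhds hz] with z' hz'
  exact (extChartAt 𝓘(ℝ, E) x).right_inv hz'

/-- The Levi-Civita connection in the preferred chart at `x`. -/
lemma toChart_leviCivita (h : SmoothMetric 𝓘(ℝ, E) N) {X : Π q : N, TangentSpace 𝓘(ℝ, E) q}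
    {x q : N} (hq : q ∈ (chartAt E x).source)
    (hX : DifferentiableAt ℝ (fieldRep x X) (extChartAt 𝓘(ℝ, E) x q))
    (v : TangentSpace 𝓘(ℝ, E) q) :
    toChart 𝓘(ℝ, E) x q (leviCivita h X q v) =
      covC (chrC (metricRep h x)) id (fieldRep x X) (extChartAt 𝓘(ℝ, E) x q)
        (toChart 𝓘(ℝ, E) x q v) := by
  rw [leviCivita_eq_covAlong]
  refine (toChart_covAlong (f := (id : N → N)) h contMDiffAt_id hq hq hX v).trans ?_
  exact covC_congr (eventually_repMap_id x (extChartAt_mem_target hq)) (EventuallyEq.refl _ _) _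

lemma contDiffAt_fieldRep_extend {x q : N} (hq : q ∈ (chartAt E x).source)
    (u : TangentSpace 𝓘(ℝ, E) q) :
    ContDiffAt ℝ ∞ (fieldRep x (FiberBundle.extend E u)) (extChartAt 𝓘(ℝ, E) x q) :=
  (contMDiffAt_section_iff_fieldRep hq).1
    (FiberBundle.contMDiffAt_extend (I := 𝓘(ℝ, E)) (F := E) (k := ∞) (V := TangentSpace 𝓘(ℝ, E)) u)

lemma eventually_eq_extChartAt {x q : N} (hq : q ∈ (chartAt E x).source) :
    ∀ᶠ z in 𝓝 (extChartAt 𝓘(ℝ, E) x q), ∃ y ∈ (chartAt E x).source, z = extChartAt 𝓘(ℝ, E) x y := by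
  filter_upwards [(isOpen_extChartAt_target x).mem_nhds (extChartAt_mem_target hq)] with z hz
  exact ⟨_, extChartAt_symm_mem hz, ((extChartAt 𝓘(ℝ, E) x).right_inv hz).symm⟩

lemma ContDiffAt.eventually_differentiableAt {X F : Type*} [NormedAddCommGroup X]
    [NormedSpace ℝ X] [NormedAddCommGroup F] [NormedSpace ℝ F] {φ : X → F} {z : X}
    (hφ : ContDiffAt ℝ ∞ φ z) : ∀ᶠ z' in 𝓝 z, DifferentiableAt ℝ φ z' := by
  filter_upwards [(hφ.of_le (m := 1) (by simp)).eventually (by simp)] with z' hz'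
  exact hz'.differentiableAt (by simp)

lemma fieldRep_leviCivita (h : SmoothMetric 𝓘(ℝ, E) N) {Z Y : Π q : N, TangentSpace 𝓘(ℝ, E) q}
    {x q : N} (hq : q ∈ (chartAt E x).source)
    (hZ : ContDiffAt ℝ ∞ (fieldRep x Z) (extChartAt 𝓘(ℝ, E) x q)) :
    fieldRep x (fun y ↦ leviCivita h Z y (Y y)) =ᶠ[𝓝 (extChartAt 𝓘(ℝ, E) x q)]
      fun z ↦ covC (chrC (metricRep h x)) id (fieldRep x Z) z (fieldRep x Y z) := by
  filter_upwards [eventually_eq_extChartAt hq, hZ.eventually_differentiableAt] with z hz hdz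
  obtain ⟨y, hy, rfl⟩ := hz
  rw [fieldRep_apply hy, toChart_leviCivita h hy hdz, fieldRep_apply hy]

/-- The curvature in the preferred chart at `x`. -/
lemma toChart_riemannCurvature (h : SmoothMetric 𝓘(ℝ, E) N) {x q : N}
    (hq : q ∈ (chartAt E x).source) (u v w : TangentSpace 𝓘(ℝ, E) q) :
    toChart 𝓘(ℝ, E) x q (riemannCurvature h q u v w) =
      curvC (chrC (metricRep h x)) (extChartAt 𝓘(ℝ, E) x q) (toChart 𝓘(ℝ, E) x q u)
        (toChart 𝓘(ℝ, E) x q v) (toChart 𝓘(ℝ, E) x q w) := by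
  have hz := extChartAt_mem_target hq
  have hΓ : ContDiffAt ℝ ∞ (chrC (metricRep h x)) (extChartAt 𝓘(ℝ, E) x q) :=
    (isMetricOn_metricRep h x).contDiffOn_chrC.contDiffAt
      ((isOpen_extChartAt_target x).mem_nhds hz)
  have cX := contDiffAt_fieldRep_extend hq u
  have cY := contDiffAt_fieldRep_extend hq v
  have cZ := contDiffAt_fieldRep_extend hq w
  have eX : fieldRep x (FiberBundle.extend E u) (extChartAt 𝓘(ℝ, E) x q)
    = toChart 𝓘(ℝ, E) x q u := by rw [fieldRep_apply hq, FiberBundle.extend_apply_self]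
  have eY : fieldRep x (FiberBundle.extend E v) (extChartAt 𝓘(ℝ, E) x q)
    = toChart 𝓘(ℝ, E) x q v := by rw [fieldRep_apply hq, FiberBundle.extend_apply_self]
  have eZ : fieldRep x (FiberBundle.extend E w) (extChartAt 𝓘(ℝ, E) x q)
    = toChart 𝓘(ℝ, E) x q w := by rw [fieldRep_apply hq, FiberBundle.extend_apply_self]
  have f1 := fieldRep_leviCivita h (Y := FiberBundle.extend E v) hq cZ
  have f2 := fieldRep_leviCivita h (Y := FiberBundle.extend E u) hq cZ
  have key := curvature_fields hΓ cX cY cZ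
  rw [eX, eY, eZ] at key
  rw [← key]
  unfold riemannCurvature
  simp only [map_sub]
  rw [toChart_leviCivita h hq, toChart_leviCivita h hq, toChart_leviCivita h hq
    cZ.differentiableAt_infty, toChart_mlieBracket hq cX cY, eX, eY,
    covC_congr (EventuallyEq.refl _ _) f1, covC_congr (EventuallyEq.refl _ _) f2]
  · exact (ContDiffAt.covC (y := id) hΓ contDiffAt_id cZ cX).differentiableAt_infty.congr_of_eventuallyEq
      f2
  · exact (ContDiffAt.covC (y := id) hΓ contDiffAt_id cZ cY).differentiableAt_infty.congr_of_eventuallyEq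
      f1

end LeviCivita

/-! ### The trace with respect to a metric, in an orthonormal basis. -/

section MetricTrace

open Filter Topology Matrix

variable {E' : Type*} [NormedAddCommGroup E'] [NormedSpace ℝ E'] [FiniteDimensional ℝ E']
  {M : Type*} [TopologicalSpace M] [ChartedSpace E' M] [IsManifold 𝓘(ℝ, E') ∞ M]

/-- If `Q` is the matrix of `b` in the orthonormal basis `e` and `R` its inverse, the Gram matrix of
`b` is `Qᵀ Q`, with inverse `R Rᵀ`. Expanding `B` in the basis `e` then produces the coefficients `Q
(R Rᵀ) Qᵀ = 1`. -/
lemma sum_inv_gram_smul {V W : Type*} [AddCommGroup V] [Module ℝ V] [AddCommGroup W] [Module ℝ W]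
    {n ι : Type*} [Fintype n] [DecidableEq n] [Fintype ι] [DecidableEq ι]
    (b : Module.Basis n ℝ V) (e : Module.Basis ι ℝ V) (g : V →ₗ[ℝ] V →ₗ[ℝ] ℝ)
    (he : ∀ i j, g (e i) (e j) = if i = j then 1 else 0) (B : V →ₗ[ℝ] V →ₗ[ℝ] W) :
    ∑ i, ∑ j, ((Matrix.of fun i j ↦ g (b i) (b j) : Matrix n n ℝ)⁻¹ i j) • B (b i) (b j)
      = ∑ k, B (e k) (e k) := by
  set Q : Matrix ι n ℝ := e.toMatrix b with hQ
  set R : Matrix n ι ℝ := b.toMatrix e with hR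
  have hQR : Q * R = 1 := e.toMatrix_mul_toMatrix_flip b
  have hRQ : R * Q = 1 := b.toMatrix_mul_toMatrix_flip e
  have hb : ∀ i, b i = ∑ k, Q k i • e k := fun i ↦ (e.sum_toMatrix_smul_self b i).symm
  have hG : (Matrix.of fun i j ↦ g (b i) (b j) : Matrix n n ℝ) = Qᵀ * Q := by
    ext i j
    simp only [Matrix.of_apply, Matrix.mul_apply, Matrix.transpose_apply]
    rw [hb i, hb j]
    simp [he, mul_comm]
  have hinv : (Matrix.of fun i j ↦ g (b i) (b j) : Matrix n n ℝ)⁻¹ = R * Rᵀ := by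
    rw [hG]
    apply Matrix.inv_eq_right_inv
    rw [Matrix.mul_assoc, ← Matrix.mul_assoc Q, hQR, Matrix.one_mul, ← Matrix.transpose_mul, hRQ,
      Matrix.transpose_one]
  rw [hinv]
  have h1 : Q * (R * Rᵀ) * Qᵀ = 1 := by
    rw [← Matrix.mul_assoc, hQR, Matrix.one_mul, ← Matrix.transpose_mul, hQR, Matrix.transpose_one]
  have hBb : ∀ i j, B (b i) (b j) = ∑ k, ∑ l, (Q k i * Q l j) • B (e k) (e l) := by
    intro i j
    rw [hb i, hb j]
    simp only [map_sum, map_smul, LinearMap.sum_apply, LinearMap.smul_apply, Finset.smul_sum,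
      smul_smul]
    rw [Finset.sum_comm]
    simp only [mul_comm]
  have h2 : ∀ k l, ∑ i, ∑ j, ((R * Rᵀ) i j) * (Q k i * Q l j) = if k = l then 1 else 0 := by
    intro k l
    have := congrFun (congrFun h1 k) l
    rw [Matrix.one_apply] at this
    rw [← this, Matrix.mul_apply, Finset.sum_comm]
    refine Finset.sum_congr rfl fun j _ ↦ ?_
    rw [Matrix.mul_apply, Finset.sum_mul]
    refine Finset.sum_congr rfl fun i _ ↦ ?_
    rw [Matrix.transpose_apply]; ring
  calc ∑ i, ∑ j, ((R * Rᵀ) i j) • B (b i) (b j)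
      = ∑ i, ∑ j, ∑ k, ∑ l, ((R * Rᵀ) i j * (Q k i * Q l j)) • B (e k) (e l) := by
        simp only [hBb, Finset.smul_sum, smul_smul]
    _ = ∑ k, ∑ l, (∑ i, ∑ j, (R * Rᵀ) i j * (Q k i * Q l j)) • B (e k) (e l) := by
        simp only [Finset.sum_smul]
        have s1 : ∀ i, ∑ j, ∑ k, ∑ l, ((R * Rᵀ) i j * (Q k i * Q l j)) • B (e k) (e l)
            = ∑ k, ∑ l, ∑ j, ((R * Rᵀ) i j * (Q k i * Q l j)) • B (e k) (e l) := by
          intro i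
          rw [Finset.sum_comm]
          exact Finset.sum_congr rfl fun k _ ↦ Finset.sum_comm
        rw [Finset.sum_congr rfl fun i _ ↦ s1 i, Finset.sum_comm]
        exact Finset.sum_congr rfl fun k _ ↦ Finset.sum_comm
    _ = ∑ k, B (e k) (e k) := by
        simp [h2, ite_smul]

/-- The trace of a bilinear map with respect to the metric, in an orthonormal basis. -/
lemma metricTrace_eq_sum {W : Type*} [AddCommGroup W] [Module ℝ W] {ι : Type*} [Fintype ι]
    [DecidableEq ι] (g : SmoothMetric 𝓘(ℝ, E') M) (p : M)
    (e : Module.Basis ι ℝ (TangentSpace 𝓘(ℝ, E') p))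
    (he : ∀ i j, g.inner p (e i) (e j) = if i = j then 1 else 0)
    {B : TangentSpace 𝓘(ℝ, E') p → TangentSpace 𝓘(ℝ, E') p → W}
    (h1 : ∀ u u' v, B (u + u') v = B u v + B u' v) (h2 : ∀ (c : ℝ) u v, B (c • u) v = c • B u v)
    (h3 : ∀ u v v', B u (v + v') = B u v + B u v') (h4 : ∀ (c : ℝ) u v, B u (c • v) = c • B u v) :
    metricTrace g p B = ∑ i, B (e i) (e i) := by
  let B' : TangentSpace 𝓘(ℝ, E') p →ₗ[ℝ] TangentSpace 𝓘(ℝ, E') p →ₗ[ℝ] W :=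
    LinearMap.mk₂ ℝ B h1 h2 h3 h4
  let g' : TangentSpace 𝓘(ℝ, E') p →ₗ[ℝ] TangentSpace 𝓘(ℝ, E') p →ₗ[ℝ] ℝ :=
    LinearMap.mk₂ ℝ (fun u v ↦ g.inner p u v) (by simp) (by simp) (by simp) (by simp)
  exact sum_inv_gram_smul (Module.finBasis ℝ E' : Module.Basis _ ℝ (TangentSpace 𝓘(ℝ, E') p)) e g'
    he B'

end MetricTrace

/-! ### Flat coordinates and second covariant derivatives. -/

section FlatCharts

open Filter Topology

variable {E : Type*} [NormedAddCommGroup E] [NormedSpace ℝ E] [FiniteDimensional ℝ E]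
  {E' : Type*} [NormedAddCommGroup E'] [NormedSpace ℝ E'] [FiniteDimensional ℝ E']
  {E₁ : Type*} [NormedAddCommGroup E₁] [NormedSpace ℝ E₁] [FiniteDimensional ℝ E₁]

/-- `y` is, near `q`, a local isometry from `E₁` with the constant metric `B`. -/
structure IsFlatAt (B : E₁ →L[ℝ] E₁ →L[ℝ] ℝ) (g : E' → E' →L[ℝ] E' →L[ℝ] ℝ) (y : E₁ → E') (q : E₁) :
    Prop where
  symm : ∀ u v, B u v = B v u
  pos : ∀ u, u ≠ 0 → 0 < B u u
  finrank_eq : Module.finrank ℝ E₁ = Module.finrank ℝ E'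
  eventually_contDiffAt : ∀ᶠ p in 𝓝 q, ContDiffAt ℝ ∞ y p
  isometry : ∀ᶠ p in 𝓝 q, ∀ u v, B u v = g (y p) (fderiv ℝ y p u) (fderiv ℝ y p v)

namespace IsFlatAt

variable {B : E₁ →L[ℝ] E₁ →L[ℝ] ℝ} {g : E' → E' →L[ℝ] E' →L[ℝ] ℝ} {y : E₁ → E'} {q : E₁}
  {Ω : Set E'}

lemma contDiffAt (h : IsFlatAt B g y q) : ContDiffAt ℝ ∞ y q := h.eventually_contDiffAt.self_of_nhds

lemma injective (h : IsFlatAt B g y q) : Function.Injective (fderiv ℝ y q) := by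
  rw [injective_iff_map_eq_zero]
  intro u hu
  by_contra hne
  have h1 := h.pos u hne
  rw [h.isometry.self_of_nhds, hu] at h1
  simp at h1

lemma surjective (h : IsFlatAt B g y q) : Function.Surjective (fderiv ℝ y q) :=
  (LinearMap.injective_iff_surjective_of_finrank_eq_finrank (f := (fderiv ℝ y q).toLinearMap)
    h.finrank_eq).1 h.injective

/-- A constant metric has zero Christoffel symbols, so the transformation law under the isometry `y`
reduces to this; in particular straight lines go to geodesics. -/
lemma fderiv_fderiv_add_chrC (h : IsFlatAt B g y q) (hg : IsMetricOn g Ω) (hq : y q ∈ Ω)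
    (u v : E₁) :
    fderiv ℝ (fderiv ℝ y) q u v + chrC g (y q) (fderiv ℝ y q u) (fderiv ℝ y q v) = 0 := by
  have hB : IsMetricOn (fun _ : E₁ ↦ B) univ :=
    ⟨isOpen_univ, contDiffOn_const, fun _ _ ↦ h.symm, fun _ _ ↦ h.pos⟩
  have h0 : chrC (fun _ : E₁ ↦ B) q u v = 0 := by
    refine hB.nondegenerate (mem_univ q) fun w ↦ ?_
    rw [hB.chrC_spec (mem_univ q)]
    simp
  rw [← hg.chrC_transform hB (mem_univ q) hq h.contDiffAt h.isometry h.surjective, h0, map_zero]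

/-- The local inverse of a flat chart is smooth, so that smoothness can be tested in the chart. -/
lemma contDiffAt_of_comp {F : Type*} [NormedAddCommGroup F] [NormedSpace ℝ F]
    (h : IsFlatAt B g y q) {S : E' → F} (hS : ContDiffAt ℝ ∞ (fun p ↦ S (y p)) q) :
    ContDiffAt ℝ ∞ S (y q) := by
  let e : E₁ ≃L[ℝ] E' := (LinearEquiv.ofBijective (fderiv ℝ y q).toLinearMap
    ⟨h.injective, h.surjective⟩).toContinuousLinearEquiv
  have he : HasFDerivAt y (e : E₁ →L[ℝ] E') q := by
    have : (e : E₁ →L[ℝ] E') = fderiv ℝ y q := by ext; rfl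
    rw [this]
    exact h.contDiffAt.differentiableAt_infty.hasFDerivAt
  have hs : HasStrictFDerivAt y (e : E₁ →L[ℝ] E') q := h.contDiffAt.hasStrictFDerivAt' he (by simp)
  have h1 := h.contDiffAt.to_localInverse he (by simp)
  have h2 : ContDiffAt ℝ ∞ (fun z ↦ (fun p ↦ S (y p)) (h.contDiffAt.localInverse he (by simp) z))
      (y q) := by
    refine ContDiffAt.comp (g := fun p ↦ S (y p)) (y q) ?_ h1
    rw [h.contDiffAt.localInverse_apply_image he (by simp)]
    exact hS
  refine h2.congr_of_eventuallyEq ?_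
  have h3 := hs.eventually_right_inverse
  filter_upwards [h3] with z hz
  congr 1
  exact hz.symm

end IsFlatAt

/-- The second covariant derivative `∇_u (𝒢 V) - 𝒢 (∇_u V)` in coordinates. -/
def hessC (Γ : E → E →L[ℝ] E →L[ℝ] E) (Γ' : E' → E' →L[ℝ] E' →L[ℝ] E') (f : E' → E)
    (G : E' → E' →L[ℝ] E) (z : E') : E' →ₗ[ℝ] E' →ₗ[ℝ] E :=
  LinearMap.mk₂ ℝ (fun u v ↦ fderiv ℝ G z u v + Γ (f z) (fderiv ℝ f z u) (G z v) - G z (Γ' z u v))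
    (by intros; simp; abel) (by intros; simp [smul_sub, smul_add]) (by intros; simp; abel)
    (by intros; simp [smul_sub, smul_add])

lemma hessC_apply (Γ : E → E →L[ℝ] E →L[ℝ] E) (Γ' : E' → E' →L[ℝ] E' →L[ℝ] E') (f : E' → E)
    (G : E' → E' →L[ℝ] E) (z u v : E') : hessC Γ Γ' f G z u v =
      fderiv ℝ G z u v + Γ (f z) (fderiv ℝ f z u) (G z v) - G z (Γ' z u v) := rfl

/-- The derivative of `W` cancels, so a second covariant derivative computed with an extension `W`
of a vector depends only on the value of `W` at the point. -/
lemma covC_sub_eq_hessC {Γ : E → E →L[ℝ] E →L[ℝ] E} {Γ' : E' → E' →L[ℝ] E' →L[ℝ] E'} {f : E' → E}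
    {G : E' → E' →L[ℝ] E} {W : E' → E'} {z : E'} (hG : DifferentiableAt ℝ G z)
    (hW : DifferentiableAt ℝ W z) (u : E') :
    covC Γ f (fun p ↦ G p (W p)) z u - G z (covC Γ' id W z u) = hessC Γ Γ' f G z u (W z) := by
  rw [hessC_apply, covC, covC, fderiv_clm_apply₁ hG hW]
  simp only [fderiv_id, ContinuousLinearMap.id_apply, id, map_add]
  abel

/-- The lines in direction `b` are geodesics, so the correction term `G (∇_b b)` disappears and the
Hessian is a derivative iterated along the line. -/
lemma IsFlatAt.hessC_apply_apply {B : E₁ →L[ℝ] E₁ →L[ℝ] ℝ} {g : E' → E' →L[ℝ] E' →L[ℝ] ℝ}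
    {y : E₁ → E'} {q : E₁} {Ω : Set E'} (h : IsFlatAt B g y q) (hg : IsMetricOn g Ω)
    (hq : y q ∈ Ω) {Γ : E → E →L[ℝ] E →L[ℝ] E} {f : E' → E} {G : E' → E' →L[ℝ] E}
    (hf : DifferentiableAt ℝ f (y q)) (hG : DifferentiableAt ℝ G (y q)) (b : E₁) :
    hessC Γ (chrC g) f G (y q) (fderiv ℝ y q b) (fderiv ℝ y q b) =
      covC Γ (fun p ↦ f (y p)) (fun p ↦ G (y p) (fderiv ℝ y p b)) q b := by
  have dy := h.contDiffAt.differentiableAt_infty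
  have hc := h.fderiv_fderiv_add_chrC hg hq b b
  have dG : DifferentiableAt ℝ (fun p ↦ G (y p)) q := hG.comp q dy
  have dy' := h.contDiffAt.fderiv_infty.differentiableAt_infty
  rw [hessC_apply, covC, fderiv_clm_apply₁ dG (dy'.clm_apply (differentiableAt_const b)),
    fderiv_comp_apply' hG dy, fderiv_comp_apply' hf dy,
    fderiv_clm_apply₁ dy' (differentiableAt_const b), eq_neg_of_add_eq_zero_left hc]
  simp
  abel

end FlatCharts

/-! ### Second fundamental form and second covariant derivative in charts. -/

section TensionFields

open Filter Topology

variable {E : Type*} [NormedAddCommGroup E] [NormedSpace ℝ E] [FiniteDimensional ℝ E]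
  {N : Type*} [TopologicalSpace N] [ChartedSpace E N] [IsManifold 𝓘(ℝ, E) ∞ N]
  {E' : Type*} [NormedAddCommGroup E'] [NormedSpace ℝ E'] [FiniteDimensional ℝ E']
  {M : Type*} [TopologicalSpace M] [ChartedSpace E' M] [IsManifold 𝓘(ℝ, E') ∞ M]
  {E₁ : Type*} [NormedAddCommGroup E₁] [NormedSpace ℝ E₁] [FiniteDimensional ℝ E₁]

lemma contDiffAt_chrC_metricRep (h : SmoothMetric 𝓘(ℝ, E) N) {x q : N}
    (hq : q ∈ (chartAt E x).source) :
    ContDiffAt ℝ ∞ (chrC (metricRep h x)) (extChartAt 𝓘(ℝ, E) x q) :=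
  (isMetricOn_metricRep h x).contDiffOn_chrC.contDiffAt
    ((isOpen_extChartAt_target x).mem_nhds (extChartAt_mem_target hq))

/-- `∇ S` along `f`, in coordinates, for a symmetric connection. -/
def covCL (Γ : E → E →L[ℝ] E →L[ℝ] E) (f S : E' → E) (z : E') : E' →L[ℝ] E :=
  fderiv ℝ S z + (Γ (f z) (S z)).comp (fderiv ℝ f z)

variable {f : M → N} {p m : M} {x : N}

lemma eventually_of_eventually {P : M → Prop} (hm : m ∈ (chartAt E' p).source)
    (h : ∀ᶠ m' in 𝓝 m, P m') :
    ∀ᶠ z in 𝓝 (extChartAt 𝓘(ℝ, E') p m), P ((extChartAt 𝓘(ℝ, E') p).symm z) := by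
  refine eventually_extChartAt_symm_mem (s := {m' | P m'}) (extChartAt_mem_target hm) ?_
  rw [extChartAt_symm_apply hm]
  exact h

/-- The right-hand side is bilinear in the components, which makes the trace independent of the
basis. -/
lemma toChart_secondFundamentalForm (g : SmoothMetric 𝓘(ℝ, E') M) (h : SmoothMetric 𝓘(ℝ, E) N)
    (hf : ∀ᶠ m' in 𝓝 m, ContMDiffAt 𝓘(ℝ, E') 𝓘(ℝ, E) ∞ f m') (hm : m ∈ (chartAt E' p).source)
    (hx : f m ∈ (chartAt E x).source) (u v : TangentSpace 𝓘(ℝ, E') m) :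
    toChart 𝓘(ℝ, E) x (f m) (secondFundamentalForm g h f m u v) =
      hessC (chrC (metricRep h x)) (chrC (metricRep g p)) (repMap E E' p x f)
        (fderiv ℝ (repMap E E' p x f)) (extChartAt 𝓘(ℝ, E') p m) (toChart 𝓘(ℝ, E') p m u)
        (toChart 𝓘(ℝ, E') p m v) := by
  have hfm := hf.self_of_nhds
  have cf := hfm.repMap hm hx
  have cV := contDiffAt_fieldRep_extend hm v
  have eV : fieldRep p (FiberBundle.extend E' v) (extChartAt 𝓘(ℝ, E') p m)
    = toChart 𝓘(ℝ, E') p m v := by rw [fieldRep_apply hm, FiberBundle.extend_apply_self]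
  have e : repSec E E' p x f (fun q ↦ mfderiv 𝓘(ℝ, E') 𝓘(ℝ, E) f q (FiberBundle.extend E' v q))
      =ᶠ[𝓝 (extChartAt 𝓘(ℝ, E') p m)]
      fun z ↦ fderiv ℝ (repMap E E' p x f) z (fieldRep p (FiberBundle.extend E' v) z) := by
    filter_upwards [eventually_mem_of_contMDiffAt hfm hm hx, eventually_of_eventually hm hf]
      with z hz hfz
    have := toChart_mfderiv hfz (extChartAt_symm_mem hz.1) hz.2
      (FiberBundle.extend E' v ((extChartAt 𝓘(ℝ, E') p).symm z))
    rw [(extChartAt 𝓘(ℝ, E') p).right_inv hz.1] at this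
    exact this
  have d := (cf.fderiv_infty.clm_apply cV).differentiableAt_infty.congr_of_eventuallyEq e
  unfold secondFundamentalForm
  simp only [map_sub]
  rw [toChart_covAlong h hfm hm hx d, toChart_mfderiv hfm hm hx,
    toChart_leviCivita g hm cV.differentiableAt_infty, covC_congr (EventuallyEq.refl _ _) e,
    covC_sub_eq_hessC cf.fderiv_infty.differentiableAt_infty cV.differentiableAt_infty, eV]

lemma repSec_covAlong (h : SmoothMetric 𝓘(ℝ, E) N)
    (hf : ∀ᶠ m' in 𝓝 m, ContMDiffAt 𝓘(ℝ, E') 𝓘(ℝ, E) ∞ f m') (hm : m ∈ (chartAt E' p).source)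
    (hx : f m ∈ (chartAt E x).source) {S : Π q : M, TangentSpace 𝓘(ℝ, E) (f q)}
    (hS : ContDiffAt ℝ ∞ (repSec E E' p x f S) (extChartAt 𝓘(ℝ, E') p m))
    (V : Π q : M, TangentSpace 𝓘(ℝ, E') q) :
    repSec E E' p x f (fun q ↦ covAlong 𝓘(ℝ, E') h f S q (V q))
      =ᶠ[𝓝 (extChartAt 𝓘(ℝ, E') p m)]
      fun z ↦ covCL (chrC (metricRep h x)) (repMap E E' p x f) (repSec E E' p x f S) z
        (fieldRep p V z) := by
  filter_upwards [eventually_mem_of_contMDiffAt hf.self_of_nhds hm hx,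
    eventually_of_eventually hm hf, hS.eventually_differentiableAt] with z hz hfz hSz
  have e := (extChartAt 𝓘(ℝ, E') p).right_inv hz.1
  have := toChart_covAlong h hfz (extChartAt_symm_mem hz.1) hz.2 (by rwa [e])
    (V ((extChartAt 𝓘(ℝ, E') p).symm z))
  rw [e] at this
  refine this.trans ?_
  rw [covC, covCL, _root_.add_apply, ContinuousLinearMap.comp_apply,
    (isMetricOn_metricRep h x).chrC_symm (z := repMap E E' p x f z)]
  · rfl
  · exact extChartAt_mem_target hz.2

lemma contDiffAt_covCL (h : SmoothMetric 𝓘(ℝ, E) N) (hf : ContMDiffAt 𝓘(ℝ, E') 𝓘(ℝ, E) ∞ f m)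
    (hm : m ∈ (chartAt E' p).source) (hx : f m ∈ (chartAt E x).source)
    {S : E' → E} (hS : ContDiffAt ℝ ∞ S (extChartAt 𝓘(ℝ, E') p m)) :
    ContDiffAt ℝ ∞ (covCL (chrC (metricRep h x)) (repMap E E' p x f) S)
      (extChartAt 𝓘(ℝ, E') p m) := by
  have cf := hf.repMap hm hx
  have cΓ : ContDiffAt ℝ ∞ (chrC (metricRep h x))
      (repMap E E' p x f (extChartAt 𝓘(ℝ, E') p m)) := by
    rw [repMap_apply hm]; exact contDiffAt_chrC_metricRep h hx
  have cΓ' : ContDiffAt ℝ ∞ (fun z ↦ chrC (metricRep h x) (repMap E E' p x f z))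
    (extChartAt 𝓘(ℝ, E') p m) := cΓ.comp _ cf
  exact hS.fderiv_infty.add ((cΓ'.clm_apply hS).clm_comp cf.fderiv_infty)

lemma toChart_secondCovAlong (g : SmoothMetric 𝓘(ℝ, E') M) (h : SmoothMetric 𝓘(ℝ, E) N)
    (hf : ∀ᶠ m' in 𝓝 m, ContMDiffAt 𝓘(ℝ, E') 𝓘(ℝ, E) ∞ f m') (hm : m ∈ (chartAt E' p).source)
    (hx : f m ∈ (chartAt E x).source) {S : Π q : M, TangentSpace 𝓘(ℝ, E) (f q)}
    (hS : ContDiffAt ℝ ∞ (repSec E E' p x f S) (extChartAt 𝓘(ℝ, E') p m))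
    (u v : TangentSpace 𝓘(ℝ, E') m) :
    toChart 𝓘(ℝ, E) x (f m) (secondCovAlong g h f S m u v) =
      hessC (chrC (metricRep h x)) (chrC (metricRep g p)) (repMap E E' p x f)
        (covCL (chrC (metricRep h x)) (repMap E E' p x f) (repSec E E' p x f S))
        (extChartAt 𝓘(ℝ, E') p m) (toChart 𝓘(ℝ, E') p m u) (toChart 𝓘(ℝ, E') p m v) := by
  have hfm := hf.self_of_nhds
  have cf := hfm.repMap hm hx
  have cV := contDiffAt_fieldRep_extend hm v
  have eV : fieldRep p (FiberBundle.extend E' v) (extChartAt 𝓘(ℝ, E') p m)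
    = toChart 𝓘(ℝ, E') p m v := by rw [fieldRep_apply hm, FiberBundle.extend_apply_self]
  have e := repSec_covAlong h hf hm hx hS (FiberBundle.extend E' v)
  have cG := contDiffAt_covCL h hfm hm hx hS
  have d := (cG.clm_apply cV).differentiableAt_infty.congr_of_eventuallyEq e
  have e2 : ∀ w : TangentSpace 𝓘(ℝ, E') m,
      toChart 𝓘(ℝ, E) x (f m) (covAlong 𝓘(ℝ, E') h f S m w) =
      covCL (chrC (metricRep h x)) (repMap E E' p x f) (repSec E E' p x f S)
        (extChartAt 𝓘(ℝ, E') p m) (toChart 𝓘(ℝ, E') p m w) := by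
    intro w
    have := (repSec_covAlong h hf hm hx hS (FiberBundle.extend E' w)).self_of_nhds
    beta_reduce at this
    rw [repSec_apply hm, fieldRep_apply hm, FiberBundle.extend_apply_self] at this
    exact this
  unfold secondCovAlong
  simp only [map_sub]
  rw [toChart_covAlong h hfm hm hx d, e2,
    toChart_leviCivita g hm cV.differentiableAt_infty, covC_congr (EventuallyEq.refl _ _) e,
    covC_sub_eq_hessC cG.differentiableAt_infty cV.differentiableAt_infty, eV]

lemma map_metricTrace {W W' : Type*} [AddCommGroup W] [Module ℝ W] [AddCommGroup W'] [Module ℝ W']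
    (g : SmoothMetric 𝓘(ℝ, E') M) (m : M) (L : W →ₗ[ℝ] W')
    (T : TangentSpace 𝓘(ℝ, E') m → TangentSpace 𝓘(ℝ, E') m → W) :
    L (metricTrace g m T) = metricTrace g m (fun u v ↦ L (T u v)) := by
  simp [metricTrace]

/-- `k` is, near `q`, a local isometry from `E₁` with the constant metric `B`; `p` is the centre of
a chart of `M`. -/
structure IsFlatChartAt (B : E₁ →L[ℝ] E₁ →L[ℝ] ℝ) (g : SmoothMetric 𝓘(ℝ, E') M) (p : M)
    (k : E₁ → M) (q : E₁) : Prop where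
  mem_source : k q ∈ (chartAt E' p).source
  continuousAt : ContinuousAt k q
  isFlatAt : IsFlatAt B (metricRep g p) (fun q' ↦ extChartAt 𝓘(ℝ, E') p (k q')) q

namespace IsFlatChartAt

variable {B : E₁ →L[ℝ] E₁ →L[ℝ] ℝ} {g : SmoothMetric 𝓘(ℝ, E') M} {k : E₁ → M} {q : E₁}
  {ι : Type*} [Fintype ι] [DecidableEq ι]

/-- The differential of `k` takes the `B`-orthonormal basis `b` to an orthonormal basis of the
tangent space. Bilinearity is needed only for the composite of `T` with the chart, where it is
inherited from `H`. -/
lemma toChart_metricTrace (hk : IsFlatChartAt B g p k q) (b : Module.Basis ι ℝ E₁)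
    (hb : ∀ i j, B (b i) (b j) = if i = j then 1 else 0)
    (T : TangentSpace 𝓘(ℝ, E') (k q) → TangentSpace 𝓘(ℝ, E') (k q) → TangentSpace 𝓘(ℝ, E) (f (k q)))
    (H : E' →ₗ[ℝ] E' →ₗ[ℝ] E)
    (hT : ∀ u v, toChart 𝓘(ℝ, E) x (f (k q)) (T u v) =
      H (toChart 𝓘(ℝ, E') p (k q) u) (toChart 𝓘(ℝ, E') p (k q) v)) :
    toChart 𝓘(ℝ, E) x (f (k q)) (metricTrace g (k q) T) =
      ∑ i, H (fderiv ℝ (fun q' ↦ extChartAt 𝓘(ℝ, E') p (k q')) q (b i))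
        (fderiv ℝ (fun q' ↦ extChartAt 𝓘(ℝ, E') p (k q')) q (b i)) := by
  have h1 := map_metricTrace g (k q) (toChart 𝓘(ℝ, E) x (f (k q))).toLinearMap T
  let e₀ : E₁ ≃ₗ[ℝ] E' := LinearEquiv.ofBijective
    (fderiv ℝ (fun q' ↦ extChartAt 𝓘(ℝ, E') p (k q')) q).toLinearMap
    ⟨hk.isFlatAt.injective, hk.isFlatAt.surjective⟩
  let e₁ : E' ≃ₗ[ℝ] TangentSpace 𝓘(ℝ, E') (k q) :=
    { (ofChart 𝓘(ℝ, E') p (k q)).toLinearMap with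
      invFun := toChart 𝓘(ℝ, E') p (k q)
      left_inv := toChart_ofChart hk.mem_source
      right_inv := ofChart_toChart hk.mem_source }
  have he : ∀ i, toChart 𝓘(ℝ, E') p (k q) ((b.map (e₀.trans e₁)) i) =
      fderiv ℝ (fun q' ↦ extChartAt 𝓘(ℝ, E') p (k q')) q (b i) := fun i ↦
    toChart_ofChart hk.mem_source _
  refine h1.trans ?_
  refine (metricTrace_eq_sum g (k q) (b.map (e₀.trans e₁)) ?_ ?_ ?_ ?_ ?_).trans ?_
  · intro i j
    rw [← metricRep_apply g hk.mem_source, he, he, ← hb,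
      hk.isFlatAt.isometry.self_of_nhds (b i) (b j)]
  · intro u u' v
    exact (hT _ _).trans (by rw [map_add, map_add, LinearMap.add_apply, ← hT, ← hT]; rfl)
  · intro c u v
    exact (hT _ _).trans (by rw [map_smul, map_smul, LinearMap.smul_apply, ← hT]; rfl)
  · intro u v v'
    exact (hT _ _).trans (by rw [map_add, map_add, ← hT, ← hT]; rfl)
  · intro c u v
    exact (hT _ _).trans (by rw [map_smul, map_smul, ← hT]; rfl)
  · refine Finset.sum_congr rfl fun i _ ↦ ?_
    rw [← he]
    exact hT _ _

end IsFlatChartAt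

end TensionFields

/-! ### Tension and bitension fields in flat coordinates. -/

section TensionFieldsInCoordinates

open Filter Topology

variable {E : Type*} [NormedAddCommGroup E] [NormedSpace ℝ E] [FiniteDimensional ℝ E]
  {N : Type*} [TopologicalSpace N] [ChartedSpace E N] [IsManifold 𝓘(ℝ, E) ∞ N]
  {E' : Type*} [NormedAddCommGroup E'] [NormedSpace ℝ E'] [FiniteDimensional ℝ E']
  {M : Type*} [TopologicalSpace M] [ChartedSpace E' M] [IsManifold 𝓘(ℝ, E') ∞ M]
  {E₁ : Type*} [NormedAddCommGroup E₁] [NormedSpace ℝ E₁] [FiniteDimensional ℝ E₁]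
  {ι : Type*} [Fintype ι]

/-- The tension field, in coordinates, of a map `y` from a flat space with orthonormal basis `b`. -/
def tensC (Γ : E → E →L[ℝ] E →L[ℝ] E) (b : ι → E₁) (y : E₁ → E) (q : E₁) : E :=
  ∑ i, covC Γ y (fun q' ↦ fderiv ℝ y q' (b i)) q (b i)

/-- The bitension field, in coordinates, of a map `y` from a flat space with orthonormal basis
`b`. -/
def bitensC (Γ : E → E →L[ℝ] E →L[ℝ] E) (b : ι → E₁) (y : E₁ → E) (q : E₁) : E :=
  ∑ i, covC Γ y (fun q' ↦ covC Γ y (tensC Γ b y) q' (b i)) q (b i)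
    - ∑ i, curvC Γ (y q) (fderiv ℝ y q (b i)) (tensC Γ b y q) (fderiv ℝ y q (b i))

lemma tensC_congr {Γ : E → E →L[ℝ] E →L[ℝ] E} {b : ι → E₁} {y y' : E₁ → E} {q : E₁}
    (h : y =ᶠ[𝓝 q] y') : tensC Γ b y q = tensC Γ b y' q := by
  refine Finset.sum_congr rfl fun i _ ↦ covC_congr h ?_ _
  filter_upwards [h.eventuallyEq_nhds] with q' hq'
  rw [hq'.fderiv_eq]

lemma bitensC_congr {Γ : E → E →L[ℝ] E →L[ℝ] E} {b : ι → E₁} {y y' : E₁ → E} {q : E₁}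
    (h : y =ᶠ[𝓝 q] y') : bitensC Γ b y q = bitensC Γ b y' q := by
  unfold bitensC
  rw [h.fderiv_eq, tensC_congr h, h.eq_of_nhds]
  congr 1
  refine Finset.sum_congr rfl fun i _ ↦ covC_congr h ?_ _
  filter_upwards [h.eventuallyEq_nhds] with q' hq'
  refine covC_congr hq' ?_ _
  filter_upwards [hq'.eventuallyEq_nhds] with q'' hq''
  exact tensC_congr hq''

lemma contDiffAt_tensC {Γ : E → E →L[ℝ] E →L[ℝ] E} (b : ι → E₁) {y : E₁ → E} {q : E₁}
    (hΓ : ContDiffAt ℝ ∞ Γ (y q)) (hy : ContDiffAt ℝ ∞ y q) :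
    ContDiffAt ℝ ∞ (tensC Γ b y) q :=
  ContDiffAt.sum fun _ _ ↦ ContDiffAt.covC hΓ hy (hy.fderiv_infty.clm_apply contDiffAt_const)
    contDiffAt_const

namespace IsFlatChartAt

variable {f : M → N} {p : M} {x : N} {g : SmoothMetric 𝓘(ℝ, E') M} {h : SmoothMetric 𝓘(ℝ, E) N}
  {B : E₁ →L[ℝ] E₁ →L[ℝ] ℝ} {k : E₁ → M} {q : E₁} [DecidableEq ι]

lemma eventually_eq_comp (hk : ∀ᶠ q' in 𝓝 q, IsFlatChartAt B g p k q') :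
    (fun q' ↦ extChartAt 𝓘(ℝ, E) x (f (k q'))) =ᶠ[𝓝 q]
      fun q' ↦ repMap E E' p x f (extChartAt 𝓘(ℝ, E') p (k q')) := by
  filter_upwards [hk] with q' hq'
  rw [repMap_apply hq'.mem_source]

lemma fderiv_comp_apply (hk : ∀ᶠ q' in 𝓝 q, IsFlatChartAt B g p k q')
    (hf : ContMDiffAt 𝓘(ℝ, E') 𝓘(ℝ, E) ∞ f (k q)) (hx : f (k q) ∈ (chartAt E x).source) (v : E₁) :
    fderiv ℝ (fun q' ↦ extChartAt 𝓘(ℝ, E) x (f (k q'))) q v =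
      fderiv ℝ (repMap E E' p x f) (extChartAt 𝓘(ℝ, E') p (k q))
        (fderiv ℝ (fun q' ↦ extChartAt 𝓘(ℝ, E') p (k q')) q v) := by
  rw [(eventually_eq_comp hk).fderiv_eq]
  exact fderiv_comp_apply' (y := fun q' ↦ extChartAt 𝓘(ℝ, E') p (k q'))
    (hf.repMap hk.self_of_nhds.mem_source hx).differentiableAt_infty
    hk.self_of_nhds.isFlatAt.contDiffAt.differentiableAt_infty v

lemma contDiffAt_comp (hk : ∀ᶠ q' in 𝓝 q, IsFlatChartAt B g p k q')
    (hf : ContMDiffAt 𝓘(ℝ, E') 𝓘(ℝ, E) ∞ f (k q)) (hx : f (k q) ∈ (chartAt E x).source) :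
    ContDiffAt ℝ ∞ (fun q' ↦ extChartAt 𝓘(ℝ, E) x (f (k q'))) q :=
  (ContDiffAt.comp q (hf.repMap hk.self_of_nhds.mem_source hx)
    hk.self_of_nhds.isFlatAt.contDiffAt).congr_of_eventuallyEq (eventually_eq_comp hk)

lemma eventually_contMDiffAt (hk : IsFlatChartAt B g p k q)
    (hf : ∀ᶠ m in 𝓝 (k q), ContMDiffAt 𝓘(ℝ, E') 𝓘(ℝ, E) ∞ f m)
    (hx : f (k q) ∈ (chartAt E x).source) :
    ∀ᶠ q' in 𝓝 q, (∀ᶠ m in 𝓝 (k q'), ContMDiffAt 𝓘(ℝ, E') 𝓘(ℝ, E) ∞ f m) ∧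
      f (k q') ∈ (chartAt E x).source := by
  refine Filter.Eventually.and (hk.continuousAt.eventually hf.eventually_nhds) ?_
  exact (ContinuousAt.comp hf.self_of_nhds.continuousAt hk.continuousAt)
    ((chartAt E x).open_source.mem_nhds hx)

lemma toChart_tensionField (hk : ∀ᶠ q' in 𝓝 q, IsFlatChartAt B g p k q')
    (b : Module.Basis ι ℝ E₁) (hb : ∀ i j, B (b i) (b j) = if i = j then 1 else 0)
    (hf : ∀ᶠ m in 𝓝 (k q), ContMDiffAt 𝓘(ℝ, E') 𝓘(ℝ, E) ∞ f m)
    (hx : f (k q) ∈ (chartAt E x).source) :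
    toChart 𝓘(ℝ, E) x (f (k q)) (tensionField g h f (k q)) =
      tensC (chrC (metricRep h x)) b (fun q' ↦ extChartAt 𝓘(ℝ, E) x (f (k q'))) q := by
  have hkq := hk.self_of_nhds
  have cf := hf.self_of_nhds.repMap hkq.mem_source hx
  refine (hkq.toChart_metricTrace b hb _ _
    (toChart_secondFundamentalForm g h hf hkq.mem_source hx)).trans ?_
  refine Finset.sum_congr rfl fun i _ ↦ ?_
  refine (hkq.isFlatAt.hessC_apply_apply (isMetricOn_metricRep g p)
    (extChartAt_mem_target hkq.mem_source) cf.differentiableAt_infty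
    cf.fderiv_infty.differentiableAt_infty (b i)).trans ?_
  refine covC_congr (eventually_eq_comp hk).symm ?_ _
  filter_upwards [hk.eventually_nhds, eventually_contMDiffAt hkq hf hx] with q' hq' hfq'
  exact (fderiv_comp_apply hq' hfq'.1.self_of_nhds hfq'.2 _).symm

lemma toChart_bitensionField (hk : ∀ᶠ q' in 𝓝 q, IsFlatChartAt B g p k q')
    (b : Module.Basis ι ℝ E₁) (hb : ∀ i j, B (b i) (b j) = if i = j then 1 else 0)
    (hf : ∀ᶠ m in 𝓝 (k q), ContMDiffAt 𝓘(ℝ, E') 𝓘(ℝ, E) ∞ f m)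
    (hx : f (k q) ∈ (chartAt E x).source) :
    toChart 𝓘(ℝ, E) x (f (k q)) (bitensionField g h f (k q)) =
      bitensC (chrC (metricRep h x)) b (fun q' ↦ extChartAt 𝓘(ℝ, E) x (f (k q'))) q := by
  have hkq := hk.self_of_nhds
  have cf := hf.self_of_nhds.repMap hkq.mem_source hx
  have cF := contDiffAt_comp hk hf.self_of_nhds hx
  set S := repSec E E' p x f (tensionField g h f) with hS
  set F : E₁ → E := fun q' ↦ extChartAt 𝓘(ℝ, E) x (f (k q')) with hF
  have eS : (fun q' ↦ S (extChartAt 𝓘(ℝ, E') p (k q'))) =ᶠ[𝓝 q]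
      tensC (chrC (metricRep h x)) b F := by
    filter_upwards [hk.eventually_nhds, eventually_contMDiffAt hkq hf hx] with q' hq' hfq'
    rw [hS, repSec_apply hq'.self_of_nhds.mem_source,
      toChart_tensionField hq' b hb hfq'.1 hfq'.2]
  -- The tension field is defined pointwise, with charts and extensions varying with the point, so
  -- its smoothness has to be proved. In the flat coordinates it is `tensC`, which is smooth, and
  -- the local inverse of the flat chart carries this back.
  have cS : ContDiffAt ℝ ∞ S (extChartAt 𝓘(ℝ, E') p (k q)) := by
    refine hkq.isFlatAt.contDiffAt_of_comp ((contDiffAt_tensC b ?_ cF).congr_of_eventuallyEq eS)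
    exact contDiffAt_chrC_metricRep h hx
  have cG := contDiffAt_covCL h hf.self_of_nhds hkq.mem_source hx cS
  have h1 : toChart 𝓘(ℝ, E) x (f (k q))
      (metricTrace g (k q) (secondCovAlong g h f (tensionField g h f) (k q))) =
      ∑ i, covC (chrC (metricRep h x)) F (fun q' ↦ covC (chrC (metricRep h x)) F
        (tensC (chrC (metricRep h x)) b F) q' (b i)) q (b i) := by
    refine (hkq.toChart_metricTrace b hb _ _
      (toChart_secondCovAlong g h hf hkq.mem_source hx cS)).trans ?_
    refine Finset.sum_congr rfl fun i _ ↦ ?_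
    refine (hkq.isFlatAt.hessC_apply_apply (isMetricOn_metricRep g p)
      (extChartAt_mem_target hkq.mem_source) cf.differentiableAt_infty
      cG.differentiableAt_infty (b i)).trans ?_
    refine covC_congr (eventually_eq_comp hk).symm ?_ _
    have cS' : ∀ᶠ q' in 𝓝 q, DifferentiableAt ℝ S (extChartAt 𝓘(ℝ, E') p (k q')) :=
      hkq.isFlatAt.contDiffAt.continuousAt.eventually cS.eventually_differentiableAt
    filter_upwards [hk.eventually_nhds, eventually_contMDiffAt hkq hf hx, cS',
      eS.eventuallyEq_nhds] with q' hq' hfq' hSq' eSq'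
    have hy := hq'.self_of_nhds.isFlatAt.contDiffAt.differentiableAt_infty
    have e1 := fderiv_comp_apply hq' hfq'.1.self_of_nhds hfq'.2 (b i)
    have e2 := fderiv_comp_apply' (y := fun q' ↦ extChartAt 𝓘(ℝ, E') p (k q')) hSq' hy (b i)
    have e3 : extChartAt 𝓘(ℝ, E) x (f (k q')) =
      repMap E E' p x f (extChartAt 𝓘(ℝ, E') p (k q')) := (eventually_eq_comp hq').eq_of_nhds
    rw [covC, ← eSq'.fderiv_eq, ← eSq'.eq_of_nhds, e2,
      (isMetricOn_metricRep h x).chrC_symm (z := F q') (extChartAt_mem_target hfq'.2), e1, covCL]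
    simp only [hF]
    rw [e3]
    rfl
  have h2 : toChart 𝓘(ℝ, E) x (f (k q)) (metricTrace g (k q) (fun u v ↦
        riemannCurvature h (f (k q)) (mfderiv 𝓘(ℝ, E') 𝓘(ℝ, E) f (k q) u)
          (tensionField g h f (k q)) (mfderiv 𝓘(ℝ, E') 𝓘(ℝ, E) f (k q) v))) =
      ∑ i, curvC (chrC (metricRep h x)) (F q) (fderiv ℝ F q (b i))
        (tensC (chrC (metricRep h x)) b F q) (fderiv ℝ F q (b i)) := by
    refine (hkq.toChart_metricTrace b hb _ (LinearMap.mk₂ ℝ (fun u v ↦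
      curvC (chrC (metricRep h x)) (F q)
        (fderiv ℝ (repMap E E' p x f) (extChartAt 𝓘(ℝ, E') p (k q)) u)
        (tensC (chrC (metricRep h x)) b F q)
        (fderiv ℝ (repMap E E' p x f) (extChartAt 𝓘(ℝ, E') p (k q)) v))
      (by intros; simp [curvC]; abel) (by intros; simp [curvC, smul_sub, smul_add])
      (by intros; simp [curvC]; abel) (by intros; simp [curvC, smul_sub, smul_add])) ?_).trans ?_
    · intro u v
      rw [toChart_riemannCurvature h hx, toChart_mfderiv hf.self_of_nhds hkq.mem_source hx,
        toChart_mfderiv hf.self_of_nhds hkq.mem_source hx, toChart_tensionField hk b hb hf hx]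
      rfl
    · refine Finset.sum_congr rfl fun i _ ↦ ?_
      have : fderiv ℝ F q (b i) = fderiv ℝ (repMap E E' p x f) (extChartAt 𝓘(ℝ, E') p (k q))
          (fderiv ℝ (fun q' ↦ extChartAt 𝓘(ℝ, E') p (k q')) q (b i)) :=
        fderiv_comp_apply hk hf.self_of_nhds hx (b i)
      rw [LinearMap.mk₂_apply, this]
  unfold bitensionField laplacianAlong bitensC
  rw [neg_neg, map_sub, h1, h2]

end IsFlatChartAt

end TensionFieldsInCoordinates

/-! ### Sasakian structures on an open set; the characteristic field is Killing. -/

section SasakianCoordinates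

open Filter Topology

variable {E : Type*} [NormedAddCommGroup E] [NormedSpace ℝ E]

/-- A Sasakian structure on an open set of a vector space; the conditions involving derivatives are
stated for constant vector fields. -/
structure IsSasakianOn (φ : E → E →L[ℝ] E) (ξ : E → E) (η : E → E →L[ℝ] ℝ)
    (g : E → E →L[ℝ] E →L[ℝ] ℝ) (Ω : Set E) : Prop where
  isMetricOn : IsMetricOn g Ω
  contDiffOn_φ : ContDiffOn ℝ ∞ φ Ω
  contDiffOn_ξ : ContDiffOn ℝ ∞ ξ Ω
  contDiffOn_η : ContDiffOn ℝ ∞ η Ω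
  φ_sq : ∀ z ∈ Ω, ∀ u, φ z (φ z u) = - u + η z u • ξ z
  η_ξ : ∀ z ∈ Ω, η z (ξ z) = 1
  g_φ_φ : ∀ z ∈ Ω, ∀ u v, g z (φ z u) (φ z v) = g z u v - η z u * η z v
  g_φ : ∀ z ∈ Ω, ∀ u w, g z u (φ z w) = 1 / 2 * (fderiv ℝ η z u w - fderiv ℝ η z w u)
  normal : ∀ z ∈ Ω, ∀ u w, fderiv ℝ φ z (φ z u) w - fderiv ℝ φ z (φ z w) u
    + φ z (fderiv ℝ φ z w u) - φ z (fderiv ℝ φ z u w)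
    + (fderiv ℝ η z u w - fderiv ℝ η z w u) • ξ z = 0

namespace IsSasakianOn

variable {φ : E → E →L[ℝ] E} {ξ : E → E} {η : E → E →L[ℝ] ℝ} {g : E → E →L[ℝ] E →L[ℝ] ℝ}
  {Ω : Set E} (h : IsSasakianOn φ ξ η g Ω) {z : E} (hz : z ∈ Ω)
include h hz

lemma ξ_ne_zero : ξ z ≠ 0 := fun h0 ↦ by
  have := h.η_ξ z hz
  simp [h0] at this

/-- `φ² ξ = 0`, so `φ²` applied to `φ ξ` shows that `φ ξ` is a multiple `a ξ`; then `φ² ξ = a² ξ`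
forces `a = 0`. -/
lemma φ_ξ : φ z (ξ z) = 0 := by
  have h2 : φ z (φ z (ξ z)) = 0 := by rw [h.φ_sq z hz, h.η_ξ z hz]; simp
  have h3 : φ z (ξ z) = η z (φ z (ξ z)) • ξ z := by
    have := h.φ_sq z hz (φ z (ξ z))
    rw [h2, map_zero] at this
    exact (neg_add_eq_zero.1 this.symm)
  obtain ⟨a, ha⟩ : ∃ a : ℝ, φ z (ξ z) = a • ξ z := ⟨_, h3⟩
  rw [ha, map_smul, ha, smul_smul] at h2
  rw [ha, mul_self_eq_zero.1 ((smul_eq_zero.1 h2).resolve_right (h.ξ_ne_zero hz)), zero_smul]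

lemma η_φ (u : E) : η z (φ z u) = 0 := by
  have h1 := h.φ_sq z hz (φ z u)
  have h2 := congrArg (φ z) (h.φ_sq z hz u)
  rw [map_add, map_neg, map_smul, h.φ_ξ hz, smul_zero, add_zero] at h2
  rw [h2, left_eq_add] at h1
  exact (smul_eq_zero.1 h1).resolve_right (h.ξ_ne_zero hz)

lemma g_ξ (u : E) : g z (ξ z) u = η z u := by
  have := h.g_φ_φ z hz (ξ z) u
  rw [h.φ_ξ hz, h.η_ξ z hz] at this
  simp at this
  linarith

lemma g_ξ_ξ : g z (ξ z) (ξ z) = 1 := by rw [h.g_ξ hz, h.η_ξ z hz]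

lemma differentiableAt_φ : DifferentiableAt ℝ φ z :=
  (h.contDiffOn_φ.contDiffAt (h.isMetricOn.isOpen.mem_nhds hz)).differentiableAt_infty

lemma contDiffAt_ξ : ContDiffAt ℝ ∞ ξ z :=
  h.contDiffOn_ξ.contDiffAt (h.isMetricOn.isOpen.mem_nhds hz)

lemma contDiffAt_η : ContDiffAt ℝ ∞ η z :=
  h.contDiffOn_η.contDiffAt (h.isMetricOn.isOpen.mem_nhds hz)

lemma fderiv_φ_ξ (v : E) : fderiv ℝ φ z v (ξ z) = - φ z (fderiv ℝ ξ z v) := by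
  have e : (fun p ↦ φ p (ξ p)) =ᶠ[𝓝 z] fun _ ↦ 0 := by
    filter_upwards [h.isMetricOn.isOpen.mem_nhds hz] with p hp using h.φ_ξ hp
  have e1 := congrArg (fun L : E →L[ℝ] E ↦ L v) e.fderiv_eq
  rw [fderiv_clm_apply₁ (h.differentiableAt_φ hz) (h.contDiffAt_ξ hz).differentiableAt_infty] at e1
  simp only [fderiv_fun_const, Pi.zero_apply, _root_.zero_apply] at e1
  exact eq_neg_of_add_eq_zero_left e1

lemma fderiv_η_ξ (v : E) : fderiv ℝ η z v (ξ z) = - η z (fderiv ℝ ξ z v) := by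
  have e : (fun p ↦ η p (ξ p)) =ᶠ[𝓝 z] fun _ ↦ 1 := by
    filter_upwards [h.isMetricOn.isOpen.mem_nhds hz] with p hp using h.η_ξ p hp
  have e1 := congrArg (fun L : E →L[ℝ] ℝ ↦ L v) e.fderiv_eq
  rw [fderiv_clm_apply₁ (h.contDiffAt_η hz).differentiableAt_infty
    (h.contDiffAt_ξ hz).differentiableAt_infty] at e1
  simp only [fderiv_fun_const, Pi.zero_apply, _root_.zero_apply] at e1
  exact eq_neg_of_add_eq_zero_left e1

/-- `η` is invariant under the flow of `ξ`: indeed `dη(ξ, u) = g(ξ, φ u) = η(φ u) = 0`, and `η(ξ)`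
is constant. -/
lemma lie_η (u : E) : fderiv ℝ η z (ξ z) u + η z (fderiv ℝ ξ z u) = 0 := by
  have h1 := h.g_φ z hz (ξ z) u
  rw [h.g_ξ hz, h.η_φ hz, h.fderiv_η_ξ hz] at h1
  linarith

/-- `φ` is invariant under the flow of `ξ`. Normality with second argument `ξ` says that `φ` kills
the Lie derivative `L`, invariance of `η` and `η ∘ φ = 0` give `η(L) = 0`, and the formula for `φ²`
yields `L = 0`. -/
lemma fderiv_φ_fderiv (u : E) :
    fderiv ℝ φ z (ξ z) u - fderiv ℝ ξ z (φ z u) + φ z (fderiv ℝ ξ z u) = 0 := by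
  set L := fderiv ℝ φ z (ξ z) u - fderiv ℝ ξ z (φ z u) + φ z (fderiv ℝ ξ z u) with hL
  have h1 := h.normal z hz u (ξ z)
  have h0 : fderiv ℝ η z u (ξ z) - fderiv ℝ η z (ξ z) u = 0 := by
    rw [h.fderiv_η_ξ hz]; linarith [h.lie_η hz u]
  rw [h0, zero_smul, add_zero, h.φ_ξ hz, h.fderiv_φ_ξ hz, h.fderiv_φ_ξ hz, map_neg] at h1
  have h2 : φ z L = 0 := by
    rw [← h1, hL]
    simp only [map_add, map_sub, map_zero, _root_.zero_apply]
    abel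
  have h3 : η z L = 0 := by
    have e : (fun p ↦ η p (φ p u)) =ᶠ[𝓝 z] fun _ ↦ 0 := by
      filter_upwards [h.isMetricOn.isOpen.mem_nhds hz] with p hp using h.η_φ hp u
    have e1 := congrArg (fun L : E →L[ℝ] ℝ ↦ L (ξ z)) e.fderiv_eq
    rw [fderiv_clm_apply₁ (h.contDiffAt_η hz).differentiableAt_infty
      ((h.differentiableAt_φ hz).clm_apply (differentiableAt_const u)),
      fderiv_clm_apply₁ (h.differentiableAt_φ hz) (differentiableAt_const u)] at e1
    simp only [fderiv_fun_const, Pi.zero_apply, _root_.zero_apply, map_zero, add_zero] at e1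
    have := h.lie_η hz (φ z u)
    rw [hL, map_add, map_sub, h.η_φ hz]
    linarith
  have h4 := h.φ_sq z hz L
  rw [h2, h3, map_zero, zero_smul, add_zero] at h4
  exact neg_eq_zero.1 h4.symm

/-- The derivative of `lie_η`; antisymmetrised in `u`, `w` it is the invariance of `dη`. -/
lemma lie_lie_η (u w : E) :
    fderiv ℝ (fderiv ℝ η) z w (ξ z) u + fderiv ℝ η z (fderiv ℝ ξ z w) u
      + (fderiv ℝ η z w (fderiv ℝ ξ z u) + η z (fderiv ℝ (fderiv ℝ ξ) z w u)) = 0 := by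
  have e : (fun p ↦ fderiv ℝ η p (ξ p) u + η p (fderiv ℝ ξ p u)) =ᶠ[𝓝 z] fun _ ↦ 0 := by
    filter_upwards [h.isMetricOn.isOpen.mem_nhds hz] with p hp using h.lie_η hp u
  have e1 := congrArg (fun L : E →L[ℝ] ℝ ↦ L w) e.fderiv_eq
  have d1 := (h.contDiffAt_η hz).fderiv_infty.differentiableAt_infty
  have d2 := (h.contDiffAt_ξ hz).fderiv_infty.differentiableAt_infty
  have d3 := (h.contDiffAt_ξ hz).differentiableAt_infty
  have d4 := (h.contDiffAt_η hz).differentiableAt_infty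
  have cu : DifferentiableAt ℝ (fun _ : E ↦ u) z := differentiableAt_const u
  rw [fderiv_fun_add ((d1.clm_apply d3).clm_apply cu) (d4.clm_apply (d2.clm_apply cu)),
    _root_.add_apply, fderiv_clm_apply₂ d1 d3 cu, fderiv_clm_apply₁ d4 (d2.clm_apply cu),
    fderiv_clm_apply₁ d2 cu] at e1
  simpa using e1

/-- The characteristic field of a Sasakian structure is a Killing field. -/
lemma killing (u v : E) :
    fderiv ℝ g z (ξ z) u v + g z (fderiv ℝ ξ z u) v + g z u (fderiv ℝ ξ z v) = 0 := by
  have dg := (h.isMetricOn.contDiffAt hz).differentiableAt_infty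
  have dη' := (h.contDiffAt_η hz).fderiv_infty.differentiableAt_infty
  have dη := (h.contDiffAt_η hz).differentiableAt_infty
  have dξ := (h.contDiffAt_ξ hz).differentiableAt_infty
  have dφ := h.differentiableAt_φ hz
  have cc : ∀ w : E, DifferentiableAt ℝ (fun _ : E ↦ w) z := fun w ↦ differentiableAt_const w
  -- Take the Lie derivative of `g(u, φ w) = dη(u, w)`: as `φ` and `dη` are invariant, the Lie
  -- derivative of `g` vanishes on pairs `(u, φ w)`.
  have k1 : ∀ w, fderiv ℝ g z (ξ z) u (φ z w) + g z (fderiv ℝ ξ z u) (φ z w)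
      + g z u (fderiv ℝ ξ z (φ z w)) = 0 := by
    intro w
    have e : (fun p ↦ g p u (φ p w)) =ᶠ[𝓝 z]
        fun p ↦ 1 / 2 * (fderiv ℝ η p u w - fderiv ℝ η p w u) := by
      filter_upwards [h.isMetricOn.isOpen.mem_nhds hz] with p hp using h.g_φ p hp u w
    have e1 := congrArg (fun L : E →L[ℝ] ℝ ↦ L (ξ z)) e.fderiv_eq
    have d1 := (dη'.clm_apply (cc u)).clm_apply (cc w)
    have d2 := (dη'.clm_apply (cc w)).clm_apply (cc u)
    rw [fderiv_clm_apply₂ dg (cc u) (dφ.clm_apply (cc w)), fderiv_clm_apply₁ dφ (cc w),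
      fderiv_const_mul (d1.fun_sub d2), _root_.smul_apply, fderiv_fun_sub d1 d2,
      _root_.sub_apply, fderiv_clm_apply₂ dη' (cc u) (cc w),
      fderiv_clm_apply₂ dη' (cc w) (cc u)] at e1
    simp only [fderiv_fun_const, Pi.zero_apply, _root_.zero_apply, map_zero, add_zero,
      smul_eq_mul] at e1
    have e2 := h.g_φ z hz (fderiv ℝ ξ z u) w
    have e3 := h.g_φ z hz u (fderiv ℝ ξ z w)
    have e4 := congrArg (g z u) (h.fderiv_φ_fderiv hz w)
    have e5 := h.lie_lie_η hz u w
    have e6 := h.lie_lie_η hz w u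
    have s1 := (h.contDiffAt_ξ hz).fderiv_apply_comm u w
    have s2 : fderiv ℝ (fderiv ℝ η) z u (ξ z) w = fderiv ℝ (fderiv ℝ η) z (ξ z) u w := by
      rw [(h.contDiffAt_η hz).fderiv_apply_comm]
    have s3 : fderiv ℝ (fderiv ℝ η) z w (ξ z) u = fderiv ℝ (fderiv ℝ η) z (ξ z) w u := by
      rw [(h.contDiffAt_η hz).fderiv_apply_comm]
    rw [s3] at e5
    rw [s2, s1] at e6
    simp only [map_add, map_sub, map_zero] at e4
    linarith
  -- On pairs `(u, ξ)` it vanishes because `g(·, ξ) = η` is invariant. The decomposition `hv` shows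
  -- that these two cases exhaust all vectors.
  have k2 : fderiv ℝ g z (ξ z) u (ξ z) + g z (fderiv ℝ ξ z u) (ξ z)
      + g z u (fderiv ℝ ξ z (ξ z)) = 0 := by
    have e : (fun p ↦ g p u (ξ p)) =ᶠ[𝓝 z] fun p ↦ η p u := by
      filter_upwards [h.isMetricOn.isOpen.mem_nhds hz] with p hp
      rw [h.isMetricOn.symm p hp, h.g_ξ hp]
    have e1 := congrArg (fun L : E →L[ℝ] ℝ ↦ L (ξ z)) e.fderiv_eq
    rw [fderiv_clm_apply₂ dg (cc u) dξ, fderiv_clm_apply₁ dη (cc u)] at e1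
    simp only [fderiv_fun_const, Pi.zero_apply, _root_.zero_apply, map_zero, add_zero] at e1
    have e2 := h.lie_η hz u
    rw [h.isMetricOn.symm z hz _ (ξ z), h.g_ξ hz]
    linarith
  have hv : v = φ z (- φ z v) + η z v • ξ z := by
    rw [map_neg, h.φ_sq z hz]; abel
  have k1' := k1 (- φ z v)
  have k3 := congrArg (fun x ↦ η z v * x) k2
  rw [hv]
  generalize φ z (- φ z v) = a at *
  generalize η z v = c at *
  simp only [map_add, map_smul, smul_eq_mul]
  linarith

end IsSasakianOn

lemma IsSasakianOn.isAffineGeodesicField [FiniteDimensional ℝ E] {φ : E → E →L[ℝ] E} {ξ : E → E}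
    {η : E → E →L[ℝ] ℝ} {g : E → E →L[ℝ] E →L[ℝ] ℝ} {Ω : Set E}
    (h : IsSasakianOn φ ξ η g Ω) : IsAffineGeodesicField (chrC g) ξ Ω :=
  h.isMetricOn.isAffineGeodesicField h.contDiffOn_ξ (fun _ hz ↦ h.killing hz)
    (fun _ hz ↦ h.g_ξ_ξ hz)

end SasakianCoordinates

/-! ### The Sasakian structure of the manifold, read in a chart. -/

section SasakianCharts

variable {E : Type*} [NormedAddCommGroup E] [NormedSpace ℝ E] [FiniteDimensional ℝ E]
  {N : Type*} [TopologicalSpace N] [ChartedSpace E N] [IsManifold 𝓘(ℝ, E) ∞ N]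

namespace ContactMetricStructure

/-- The tensor field `φ` in the preferred chart at `x`. -/
def φRep (S : ContactMetricStructure 𝓘(ℝ, E) N) (x : N) (z : E) : E →L[ℝ] E :=
  (toChart 𝓘(ℝ, E) x ((extChartAt 𝓘(ℝ, E) x).symm z)).comp
    ((S.φ ((extChartAt 𝓘(ℝ, E) x).symm z)).comp
      (ofChart 𝓘(ℝ, E) x ((extChartAt 𝓘(ℝ, E) x).symm z)))

/-- The contact form in the preferred chart at `x`. -/
def ηRep (S : ContactMetricStructure 𝓘(ℝ, E) N) (x : N) (z : E) : E →L[ℝ] ℝ :=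
  (S.η ((extChartAt 𝓘(ℝ, E) x).symm z)).comp
      (ofChart 𝓘(ℝ, E) x ((extChartAt 𝓘(ℝ, E) x).symm z))

variable (S : ContactMetricStructure 𝓘(ℝ, E) N) {x q : N}

lemma φRep_apply (hq : q ∈ (chartAt E x).source)
    (u : TangentSpace 𝓘(ℝ, E) q) :
    S.φRep x (extChartAt 𝓘(ℝ, E) x q) (toChart 𝓘(ℝ, E) x q u) =
      toChart 𝓘(ℝ, E) x q (S.φ q u) := by
  simp only [φRep]
  rw [extChartAt_symm_apply hq]
  simp [ofChart_toChart hq]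

lemma ηRep_apply (hq : q ∈ (chartAt E x).source)
    (u : TangentSpace 𝓘(ℝ, E) q) :
    S.ηRep x (extChartAt 𝓘(ℝ, E) x q) (toChart 𝓘(ℝ, E) x q u) = S.η q u := by
  simp only [ηRep]
  rw [extChartAt_symm_apply hq]
  simp [ofChart_toChart hq]

lemma contMDiffAt_φ_ofChart (hq : q ∈ (chartAt E x).source)
    (u : E) :
    ContMDiffAt 𝓘(ℝ, E) (𝓘(ℝ, E).prod 𝓘(ℝ, E)) ∞
      (fun y ↦ TotalSpace.mk' E (E := fun x : N ↦ TangentSpace 𝓘(ℝ, E) x) y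
        (S.φ y (ofChart 𝓘(ℝ, E) x y u))) q :=
  ContMDiffAt.clm_bundle_apply (F₁ := E) (F₂ := E) (b := fun q : N ↦ q) (S.contMDiff_φ q)
    (contMDiffAt_ofChart hq u)

lemma contMDiffAt_η_ofChart (hq : q ∈ (chartAt E x).source)
    (u : E) :
    ContMDiffAt 𝓘(ℝ, E) 𝓘(ℝ, ℝ) ∞ (fun y ↦ S.η y (ofChart 𝓘(ℝ, E) x y u)) q := by
  have := ContMDiffAt.clm_bundle_apply (F₁ := E) (F₂ := ℝ) (E₂ := Bundle.Trivial N ℝ)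
    (b := fun q : N ↦ q) (S.contMDiff_η q) (contMDiffAt_ofChart hq u)
  rw [Bundle.contMDiffAt_totalSpace] at this
  exact this.2

lemma contDiffOn_φRep (x : N) : ContDiffOn ℝ ∞ (S.φRep x) (extChartAt 𝓘(ℝ, E) x).target := by
  rw [contDiffOn_clm_apply]; intro u z hz
  apply ContDiffAt.contDiffWithinAt
  have h1 := (contMDiffAt_section_iff_fieldRep (extChartAt_symm_mem hz)).1
    (S.contMDiffAt_φ_ofChart (extChartAt_symm_mem hz) u)
  rw [(extChartAt 𝓘(ℝ, E) x).right_inv hz] at h1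
  exact h1

lemma contDiffOn_ηRep (x : N) : ContDiffOn ℝ ∞ (S.ηRep x) (extChartAt 𝓘(ℝ, E) x).target := by
  rw [contDiffOn_clm_apply]; intro u z hz
  apply ContDiffAt.contDiffWithinAt
  have h1 := S.contMDiffAt_η_ofChart (extChartAt_symm_mem hz) u
  rw [contMDiffAt_iff_contDiffAt_comp_symm (extChartAt_symm_mem hz),
    (extChartAt 𝓘(ℝ, E) x).right_inv hz] at h1
  exact h1

lemma contDiffAt_fieldRep_ξ (hq : q ∈ (chartAt E x).source) :
    ContDiffAt ℝ ∞ (fieldRep x S.ξ) (extChartAt 𝓘(ℝ, E) x q) :=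
  (contMDiffAt_section_iff_fieldRep hq).1 (S.contMDiff_ξ q)

lemma toChart_mlieBracket_ofChart (hq : q ∈ (chartAt E x).source)
    (u w : E) :
    toChart 𝓘(ℝ, E) x q (VectorField.mlieBracket 𝓘(ℝ, E) (fun y ↦ ofChart 𝓘(ℝ, E) x y u)
      (fun y ↦ ofChart 𝓘(ℝ, E) x y w) q) = 0 := by
  have hz := extChartAt_mem_target hq
  rw [toChart_mlieBracket hq ((contMDiffAt_section_iff_fieldRep hq).1 (contMDiffAt_ofChart hq u))
    ((contMDiffAt_section_iff_fieldRep hq).1 (contMDiffAt_ofChart hq w)),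
    (eventually_fieldRep_ofChart hz u).fderiv_eq, (eventually_fieldRep_ofChart hz w).fderiv_eq]
  simp

lemma dOneForm_ofChart (hq : q ∈ (chartAt E x).source)
    (u w : E) :
    dOneForm S.η (fun y ↦ ofChart 𝓘(ℝ, E) x y u) (fun y ↦ ofChart 𝓘(ℝ, E) x y w) q =
      1 / 2 * (fderiv ℝ (S.ηRep x) (extChartAt 𝓘(ℝ, E) x q) u w
        - fderiv ℝ (S.ηRep x) (extChartAt 𝓘(ℝ, E) x q) w u) := by
  have hz := extChartAt_mem_target hq
  have cη := (S.contDiffOn_ηRep x).contDiffAt ((isOpen_extChartAt_target x).mem_nhds hz)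
  have h1 : ∀ u w : E, mvfderiv 𝓘(ℝ, E) (fun y ↦ S.η y (ofChart 𝓘(ℝ, E) x y w)) q
      (ofChart 𝓘(ℝ, E) x q u) = fderiv ℝ (S.ηRep x) (extChartAt 𝓘(ℝ, E) x q) u w := by
    intro u w
    have d := cη.differentiableAt_infty.clm_apply (differentiableAt_const w)
    rw [mvfderiv_eq_fderiv (φ := fun y ↦ S.η y (ofChart 𝓘(ℝ, E) x y w)) hq d, toChart_ofChart hq]
    refine (fderiv_clm_apply₁ cη.differentiableAt_infty (differentiableAt_const w) u).trans ?_
    simp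
  have h2 : VectorField.mlieBracket 𝓘(ℝ, E) (fun y ↦ ofChart 𝓘(ℝ, E) x y u)
      (fun y ↦ ofChart 𝓘(ℝ, E) x y w) q = 0 :=
    toChart_injective hq ((toChart_mlieBracket_ofChart hq u w).trans (map_zero _).symm)
  unfold dOneForm
  rw [h1, h1, h2, map_zero, sub_zero]

/-- Coordinate fields commute and have constant components, so only derivatives of `φ` survive in
the brackets. -/
lemma toChart_nijenhuis_ofChart (hq : q ∈ (chartAt E x).source)
    (u w : E) :
    toChart 𝓘(ℝ, E) x q
      (nijenhuis S.φ (fun y ↦ ofChart 𝓘(ℝ, E) x y u) (fun y ↦ ofChart 𝓘(ℝ, E) x y w) q) =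
    fderiv ℝ (S.φRep x) (extChartAt 𝓘(ℝ, E) x q) (S.φRep x (extChartAt 𝓘(ℝ, E) x q) u) w
    - fderiv ℝ (S.φRep x) (extChartAt 𝓘(ℝ, E) x q) (S.φRep x (extChartAt 𝓘(ℝ, E) x q) w) u
    + S.φRep x (extChartAt 𝓘(ℝ, E) x q)
      (fderiv ℝ (S.φRep x) (extChartAt 𝓘(ℝ, E) x q) w u)
    - S.φRep x (extChartAt 𝓘(ℝ, E) x q)
      (fderiv ℝ (S.φRep x) (extChartAt 𝓘(ℝ, E) x q) u w) := by
  have hz := extChartAt_mem_target hq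
  have cφ := (S.contDiffOn_φRep x).contDiffAt ((isOpen_extChartAt_target x).mem_nhds hz)
  have cc : ∀ u : E, ContDiffAt ℝ ∞ (fieldRep x (fun y ↦ ofChart 𝓘(ℝ, E) x y u))
      (extChartAt 𝓘(ℝ, E) x q) := fun u ↦
    (contMDiffAt_section_iff_fieldRep hq).1 (contMDiffAt_ofChart hq u)
  have cφu : ∀ u : E, ContDiffAt ℝ ∞ (fieldRep x (fun y ↦ S.φ y (ofChart 𝓘(ℝ, E) x y u)))
      (extChartAt 𝓘(ℝ, E) x q) := fun u ↦ cφ.clm_apply contDiffAt_const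
  have d0 : ∀ u v : E, fderiv ℝ (fieldRep x (fun y ↦ ofChart 𝓘(ℝ, E) x y u))
      (extChartAt 𝓘(ℝ, E) x q) v = 0 := by
    intro u v
    rw [(eventually_fieldRep_ofChart hz u).fderiv_eq]; simp
  have v0 : ∀ u : E, fieldRep x (fun y ↦ ofChart 𝓘(ℝ, E) x y u) (extChartAt 𝓘(ℝ, E) x q) = u :=
    fun u ↦ fieldRep_ofChart hz u
  have d1 : ∀ u v : E, fderiv ℝ (fieldRep x (fun y ↦ S.φ y (ofChart 𝓘(ℝ, E) x y u)))
      (extChartAt 𝓘(ℝ, E) x q) v = fderiv ℝ (S.φRep x) (extChartAt 𝓘(ℝ, E) x q) v u := by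
    intro u v
    refine (fderiv_clm_apply₁ cφ.differentiableAt_infty (differentiableAt_const u) v).trans ?_
    simp
  have v1 : ∀ u : E, fieldRep x (fun y ↦ S.φ y (ofChart 𝓘(ℝ, E) x y u))
      (extChartAt 𝓘(ℝ, E) x q) = S.φRep x (extChartAt 𝓘(ℝ, E) x q) u := fun u ↦ rfl
  unfold nijenhuis
  simp only [map_add, map_sub]
  rw [toChart_mlieBracket hq (cφu u) (cφu w), ← S.φRep_apply hq, ← S.φRep_apply hq,
    ← S.φRep_apply hq, ← S.φRep_apply hq, toChart_mlieBracket hq (cφu u) (cc w),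
    toChart_mlieBracket hq (cc u) (cφu w), toChart_mlieBracket hq (cc u) (cc w)]
  simp only [d0, d1, v0, v1, sub_self, map_zero, add_zero, zero_sub, sub_zero, map_neg]
  abel

variable {S} in
/-- A Sasakian structure in a chart. -/
lemma IsSasakian.isSasakianOn (hS : S.IsSasakian) (x : N) :
    IsSasakianOn (S.φRep x) (fieldRep x S.ξ) (S.ηRep x) (metricRep S.g x)
      (extChartAt 𝓘(ℝ, E) x).target := by
  have key : ∀ P : E → Prop, (∀ q ∈ (chartAt E x).source, P (extChartAt 𝓘(ℝ, E) x q)) →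
      ∀ z ∈ (extChartAt 𝓘(ℝ, E) x).target, P z := by
    intro P hP z hz
    rw [← (extChartAt 𝓘(ℝ, E) x).right_inv hz]
    exact hP _ (extChartAt_symm_mem hz)
  refine ⟨isMetricOn_metricRep S.g x, S.contDiffOn_φRep x, ?_, S.contDiffOn_ηRep x, ?_, ?_, ?_, ?_,
    ?_⟩
  · intro z hz
    have := S.contDiffAt_fieldRep_ξ (extChartAt_symm_mem hz)
    rw [(extChartAt 𝓘(ℝ, E) x).right_inv hz] at this
    exact this.contDiffWithinAt
  · refine key _ fun q hq u' ↦ ?_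
    obtain ⟨u, rfl⟩ : ∃ u, u' = toChart 𝓘(ℝ, E) x q u := ⟨_, (toChart_ofChart hq u').symm⟩
    rw [S.φRep_apply hq, S.φRep_apply hq, S.φ_sq, S.ηRep_apply hq, fieldRep_apply hq, map_add,
      map_neg, map_smul]
  · refine key _ fun q hq ↦ ?_
    rw [fieldRep_apply hq, S.ηRep_apply hq, S.η_ξ]
  · refine key _ fun q hq u' v' ↦ ?_
    obtain ⟨u, rfl⟩ : ∃ u, u' = toChart 𝓘(ℝ, E) x q u := ⟨_, (toChart_ofChart hq u').symm⟩
    obtain ⟨v, rfl⟩ : ∃ v, v' = toChart 𝓘(ℝ, E) x q v := ⟨_, (toChart_ofChart hq v').symm⟩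
    rw [S.φRep_apply hq, S.φRep_apply hq, metricRep_apply S.g hq, metricRep_apply S.g hq,
      S.ηRep_apply hq, S.ηRep_apply hq, S.g_φ_φ]
  · refine key _ fun q hq u w ↦ ?_
    rw [← S.dOneForm_ofChart hq, ← S.g_φ _ _ q (contMDiffAt_ofChart hq u)
      (contMDiffAt_ofChart hq w), ← metricRep_apply S.g hq, ← S.φRep_apply hq, toChart_ofChart hq,
      toChart_ofChart hq]
  · refine key _ fun q hq u w ↦ ?_
    have h1 := congrArg (toChart 𝓘(ℝ, E) x q) (hS _ _ q (contMDiffAt_ofChart hq u)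
      (contMDiffAt_ofChart hq w))
    rw [map_add, map_smul, map_zero, S.toChart_nijenhuis_ofChart hq, S.dOneForm_ofChart hq,
      ← fieldRep_apply hq] at h1
    rw [← h1]
    congr 2
    ring

end ContactMetricStructure

end SasakianCharts

/-! ### Uniqueness for linear differential equations. -/

section LinearODE

open Filter Topology

variable {F : Type*} [NormedAddCommGroup F] [NormedSpace ℝ F]

/-- A solution of a linear differential equation which vanishes at one point vanishes. -/
lemma eq_zero_of_linear_ode {L : ℝ → F →L[ℝ] F} {u : ℝ → F} {a b t₀ t : ℝ}
    (hL : ContinuousOn L (Ioo a b)) (hu : ∀ s ∈ Ioo a b, HasDerivAt u (L s (u s)) s)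
    (ht₀ : t₀ ∈ Ioo a b) (h0 : u t₀ = 0) (ht : t ∈ Ioo a b) : u t = 0 := by
  -- `L` may be unbounded near the endpoints. A compact subinterval around both times provides the
  -- Lipschitz constant.
  obtain ⟨a', ha', ha''⟩ := exists_between (lt_min ht₀.1 ht.1)
  obtain ⟨b', hb', hb''⟩ := exists_between (max_lt ht₀.2 ht.2)
  rw [lt_min_iff] at ha''
  rw [max_lt_iff] at hb'
  have hsub : Icc a' b' ⊆ Ioo a b := fun s hs ↦ ⟨ha'.trans_le hs.1, hs.2.trans_lt hb''⟩
  obtain ⟨C, hC⟩ := isCompact_Icc.exists_bound_of_continuousOn (hL.mono hsub)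
  have hsub' : Ioo a' b' ⊆ Icc a' b' := Ioo_subset_Icc_self
  have key := ODE_solution_unique_of_mem_Ioo (v := fun s x ↦ L s x) (s := fun _ ↦ univ)
    (K := C.toNNReal) (f := u) (g := fun _ ↦ 0) (t₀ := t₀) (a := a') (b := b')
    (fun s hs ↦ ?_) ⟨ha''.1, hb'.1⟩ (fun s hs ↦ ⟨hu s (hsub (hsub' hs)), mem_univ _⟩)
    (fun s _ ↦ ⟨by simpa using hasDerivAt_const s (0 : F), mem_univ _⟩) h0
  · exact key ⟨ha''.2, hb'.2⟩
  · refine (((L s).lipschitz).weaken ?_).lipschitzOnWith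
    rw [← NNReal.coe_le_coe, Real.coe_toNNReal']
    exact (hC s (hsub' hs)).trans (le_max_left _ _)

end LinearODE

/-! ### Tension and bitension of a surface swept out by the flow. -/

section FlowSurfaceTension

open Filter Topology

variable {E : Type*} [NormedAddCommGroup E] [NormedSpace ℝ E]
  {Γ : E → E →L[ℝ] E →L[ℝ] E} {ξ : E → E} {Ω : Set E} {y : ℝ × ℝ → E} {Q : Set (ℝ × ℝ)}

lemma hasDerivAt_fst {V : ℝ × ℝ → E} {t s : ℝ} (hV : DifferentiableAt ℝ V (t, s)) :
    HasDerivAt (fun r ↦ V (r, s)) (fderiv ℝ V (t, s) (1, 0)) t := by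
  have : HasFDerivAt (fun r ↦ V (r, s)) _ t :=
    HasFDerivAt.comp (g := V) t hV.hasFDerivAt (hasFDerivAt_prodMk_left t s)
  simpa using this.hasDerivAt

lemma hasDerivAt_snd {V : ℝ × ℝ → E} {t s : ℝ} (hV : DifferentiableAt ℝ V (t, s)) :
    HasDerivAt (fun r ↦ V (t, r)) (fderiv ℝ V (t, s) (0, 1)) s := by
  have : HasFDerivAt (fun r ↦ V (t, r)) _ s :=
    HasFDerivAt.comp (g := V) s hV.hasFDerivAt (hasFDerivAt_prodMk_right t s)
  simpa using this.hasDerivAt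

lemma fderiv_slice_snd {t s : ℝ} (hy : DifferentiableAt ℝ y (t, s)) :
    fderiv ℝ (fun r ↦ y (t, r)) s 1 = fderiv ℝ y (t, s) (0, 1) := by
  rw [fderiv_apply_one_eq_deriv, (hasDerivAt_snd hy).deriv]

lemma covC_snd {V : ℝ × ℝ → E} {t s : ℝ} (hy : DifferentiableAt ℝ y (t, s))
    (hV : DifferentiableAt ℝ V (t, s)) :
    covC Γ (fun r ↦ y (t, r)) (fun r ↦ V (t, r)) s 1 = covC Γ y V (t, s) (0, 1) := by
  rw [covC, covC, fderiv_slice_snd hy, fderiv_slice_snd hV]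

lemma eventually_snd {P : ℝ × ℝ → Prop} {t s : ℝ} (h : ∀ᶠ q in 𝓝 (t, s), P q) :
    ∀ᶠ r in 𝓝 s, P (t, r) :=
  (Continuous.prodMk_right t).continuousAt.eventually h

namespace IsAffineGeodesicField

variable (h : IsAffineGeodesicField Γ ξ Ω) (hy : IsFlowSurface ξ Ω y Q)
include h hy

/-- The direction of the flow does not contribute, the orbits being geodesics. -/
lemma tensC_eq {q : ℝ × ℝ} (hq : q ∈ Q) : tensC Γ (Module.Basis.finTwoProd ℝ) y q =
    covC Γ y (fun p ↦ fderiv ℝ y p (0, 1)) q (0, 1) := by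
  rw [tensC, Fin.sum_univ_two, Module.Basis.finTwoProd_zero, Module.Basis.finTwoProd_one,
    h.covC_fst_fst hy hq, zero_add]

lemma isInvariantAlong_tensC : IsInvariantAlong ξ y Q (tensC Γ (Module.Basis.finTwoProd ℝ) y) := by
  have h1 := h.invariant_covC hy (h.invariant_fderiv_snd hy)
  refine ⟨h1.contDiffOn.congr fun q hq ↦ h.tensC_eq hy hq, fun q hq ↦ ?_⟩
  have e : tensC Γ (Module.Basis.finTwoProd ℝ) y =ᶠ[𝓝 q]
      fun p ↦ covC Γ y (fun p ↦ fderiv ℝ y p (0, 1)) p (0, 1) := by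
    filter_upwards [hy.isOpen.mem_nhds hq] with p hp using h.tensC_eq hy hp
  rw [e.fderiv_eq, e.eq_of_nhds]
  exact h1.fderiv_fst q hq

/-- The tension field is invariant, hence Jacobi along the orbits; the Jacobi equation cancels the
second derivative in `t` against the curvature term in `∂_t`. -/
lemma bitensC_eq {q : ℝ × ℝ} (hq : q ∈ Q) : bitensC Γ (Module.Basis.finTwoProd ℝ) y q =
    covC Γ y (fun p ↦ covC Γ y (tensC Γ (Module.Basis.finTwoProd ℝ) y) p (0, 1)) q (0, 1)
      - curvC Γ (y q) (fderiv ℝ y q (0, 1)) (tensC Γ (Module.Basis.finTwoProd ℝ) y q)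
        (fderiv ℝ y q (0, 1)) := by
  rw [bitensC, Fin.sum_univ_two, Fin.sum_univ_two, Module.Basis.finTwoProd_zero,
    Module.Basis.finTwoProd_one, h.covC_covC_fst hy (h.isInvariantAlong_tensC hy) hq]
  abel

lemma isInvariantAlong_bitensC :
    IsInvariantAlong ξ y Q (bitensC Γ (Module.Basis.finTwoProd ℝ) y) := by
  have h1 := h.isInvariantAlong_tensC hy
  have h2 := (h.invariant_covC hy (h.invariant_covC hy h1)).sub hy.isOpen
    (h.invariant_curvC hy (h.invariant_fderiv_snd hy) h1 (h.invariant_fderiv_snd hy))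
  refine ⟨h2.contDiffOn.congr fun q hq ↦ h.bitensC_eq hy hq, fun q hq ↦ ?_⟩
  have e := (show ∀ᶠ p in 𝓝 q, _ from by
    filter_upwards [hy.isOpen.mem_nhds hq] with p hp using h.bitensC_eq hy hp)
  rw [EventuallyEq.fderiv_eq e, h.bitensC_eq hy hq]
  exact h2.fderiv_fst q hq

lemma tensC_snd {t s : ℝ} (hq : (t, s) ∈ Q) :
    tensC Γ (Module.Basis.singleton Unit ℝ) (fun r ↦ y (t, r)) s =
      tensC Γ (Module.Basis.finTwoProd ℝ) y (t, s) := by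
  rw [h.tensC_eq hy hq, tensC, Fintype.sum_unique, Module.Basis.singleton_apply,
    ← covC_snd (hy.contDiffAt hq).differentiableAt_infty
      ((h.invariant_fderiv_snd hy).contDiffAt hy.isOpen hq).differentiableAt_infty]
  refine covC_congr (EventuallyEq.refl _ _) ?_ _
  filter_upwards [eventually_snd (hy.isOpen.mem_nhds hq)] with r hr
  exact fderiv_slice_snd (hy.contDiffAt hr).differentiableAt_infty

/-- The surface and the curve `y (t, ·)` have the same tension field, and `bitensC_eq` leaves only
derivatives along that curve. This is the reduction of the theorem to curves. -/
lemma bitensC_snd {t s : ℝ} (hq : (t, s) ∈ Q) :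
    bitensC Γ (Module.Basis.singleton Unit ℝ) (fun r ↦ y (t, r)) s =
      bitensC Γ (Module.Basis.finTwoProd ℝ) y (t, s) := by
  have hH := h.isInvariantAlong_tensC hy
  have hev := eventually_snd (hy.isOpen.eventually_mem hq)
  have eT : ∀ᶠ r in 𝓝 s, tensC Γ (Module.Basis.singleton Unit ℝ) (fun r ↦ y (t, r)) r =
      tensC Γ (Module.Basis.finTwoProd ℝ) y (t, r) := by
    filter_upwards [hev] with r hr using h.tensC_snd hy hr
  rw [h.bitensC_eq hy hq, bitensC, Fintype.sum_unique, Fintype.sum_unique,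
    Module.Basis.singleton_apply, fderiv_slice_snd (hy.contDiffAt hq).differentiableAt_infty,
    h.tensC_snd hy hq, ← covC_snd (hy.contDiffAt hq).differentiableAt_infty
      ((h.invariant_covC hy hH).contDiffAt hy.isOpen hq).differentiableAt_infty]
  congr 1
  refine covC_congr (EventuallyEq.refl _ _) ?_ _
  filter_upwards [hev, eventually_eventually_nhds.2 eT] with r hr hr'
  rw [covC_congr (EventuallyEq.refl _ _) hr', covC_snd (hy.contDiffAt hr).differentiableAt_infty
    (hH.contDiffAt hy.isOpen hr).differentiableAt_infty]

end IsAffineGeodesicField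

/-- An invariant section which vanishes at one time vanishes. -/
lemma IsInvariantAlong.eq_zero {V : ℝ × ℝ → E} (hV : IsInvariantAlong ξ y Q V)
    (hy : IsFlowSurface ξ Ω y Q) (hΩ : IsOpen Ω) (hξ : ContDiffOn ℝ ∞ ξ Ω) {a b s t₀ t : ℝ}
    (hQ : ∀ r ∈ Ioo a b, (r, s) ∈ Q) (ht₀ : t₀ ∈ Ioo a b) (h0 : V (t₀, s) = 0)
    (ht : t ∈ Ioo a b) : V (t, s) = 0 := by
  refine eq_zero_of_linear_ode (L := fun r ↦ fderiv ℝ ξ (y (r, s))) (u := fun r ↦ V (r, s))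
    ?_ ?_ ht₀ h0 ht
  · intro r hr
    have c1 := (hξ.contDiffAt (hΩ.mem_nhds (hy.mapsTo (hQ r hr)))).fderiv_infty.continuousAt
    have c2 : ContinuousAt (fun r ↦ y (r, s)) r := ContinuousAt.comp (g := y)
      (hy.contDiffAt (hQ r hr)).continuousAt (Continuous.prodMk_left s).continuousAt
    exact (ContinuousAt.comp (f := fun r ↦ y (r, s)) c1 c2).continuousWithinAt
  · intro r hr
    have := hasDerivAt_fst (hV.contDiffAt hy.isOpen (hQ r hr)).differentiableAt_infty
    rwa [hV.fderiv_fst _ (hQ r hr)] at this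

/-- Inner products of invariant sections are constant in time, for an invariant metric. -/
lemma IsInvariantAlong.inner_eq {g : E → E →L[ℝ] E →L[ℝ] ℝ} {V W : ℝ × ℝ → E}
    (hV : IsInvariantAlong ξ y Q V) (hW : IsInvariantAlong ξ y Q W)
    (hy : IsFlowSurface ξ Ω y Q) (hg : IsMetricOn g Ω)
    (hK : ∀ z ∈ Ω, ∀ u v,
      fderiv ℝ g z (ξ z) u v + g z (fderiv ℝ ξ z u) v + g z u (fderiv ℝ ξ z v) = 0)
    {a b s t₀ t : ℝ} (hQ : ∀ r ∈ Ioo a b, (r, s) ∈ Q) (ht₀ : t₀ ∈ Ioo a b) (ht : t ∈ Ioo a b) :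
    g (y (t, s)) (V (t, s)) (W (t, s)) = g (y (t₀, s)) (V (t₀, s)) (W (t₀, s)) := by
  have hd : ∀ r ∈ Ioo a b, HasDerivAt (fun r ↦ g (y (r, s)) (V (r, s)) (W (r, s))) 0 r := by
    intro r hr
    have hz := hy.mapsTo (hQ r hr)
    have dg := (hg.contDiffAt hz).differentiableAt_infty
    have dy := (hy.contDiffAt (hQ r hr)).differentiableAt_infty
    have dV := (hV.contDiffAt hy.isOpen (hQ r hr)).differentiableAt_infty
    have dW := (hW.contDiffAt hy.isOpen (hQ r hr)).differentiableAt_infty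
    have dgy : DifferentiableAt ℝ (fun q ↦ g (y q)) (r, s) := dg.comp _ dy
    have h1 := hasDerivAt_fst (V := fun q ↦ g (y q) (V q) (W q))
      ((dgy.clm_apply dV).clm_apply dW)
    rw [fderiv_clm_apply₂ dgy dV dW, fderiv_comp_apply' dg dy, hy.fderiv_fst _ (hQ r hr),
      hV.fderiv_fst _ (hQ r hr), hW.fderiv_fst _ (hQ r hr), hK _ hz] at h1
    exact h1
  exact isOpen_Ioo.is_const_of_deriv_eq_zero isPreconnected_Ioo
    (fun r hr ↦ (hd r hr).differentiableAt.differentiableWithinAt)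
    (fun r hr ↦ (hd r hr).deriv) ht ht₀

/-- Unique continuation in the direction transversal to the flow. -/
lemma IsAffineGeodesicField.tensC_eq_zero [FiniteDimensional ℝ E] (h : IsAffineGeodesicField Γ ξ Ω)
    (hy : IsFlowSurface ξ Ω y Q) {a b s₀ s t : ℝ} (hQ : ∀ r ∈ Ioo a b, (t, r) ∈ Q)
    (hB : ∀ r ∈ Ioo a b, bitensC Γ (Module.Basis.finTwoProd ℝ) y (t, r) = 0)
    (hs₀ : s₀ ∈ Ioo a b)
    (h0 : ∀ᶠ r in 𝓝 s₀, tensC Γ (Module.Basis.finTwoProd ℝ) y (t, r) = 0) (hs : s ∈ Ioo a b) :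
    tensC Γ (Module.Basis.finTwoProd ℝ) y (t, s) = 0 := by
  set T := tensC Γ (Module.Basis.finTwoProd ℝ) y with hT
  have iT : IsInvariantAlong ξ y Q T := h.isInvariantAlong_tensC hy
  have iD : IsInvariantAlong ξ y Q (fun q ↦ covC Γ y T q (0, 1)) := h.invariant_covC hy iT
  have iS := h.invariant_fderiv_snd hy
  -- The equation `∇_s ∇_s T = R(∂_s, T)∂_s`, written as a first-order linear system for the pair
  -- `(T, ∇_s T)`.
  let L : ℝ → E × E →L[ℝ] E × E := fun r ↦ LinearMap.toContinuousLinearMap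
    { toFun := fun w ↦ (w.2 - Γ (y (t, r)) (fderiv ℝ y (t, r) (0, 1)) w.1,
        curvC Γ (y (t, r)) (fderiv ℝ y (t, r) (0, 1)) w.1 (fderiv ℝ y (t, r) (0, 1))
          - Γ (y (t, r)) (fderiv ℝ y (t, r) (0, 1)) w.2)
      map_add' := by intro u v; ext <;> simp [curvC] <;> abel
      map_smul' := by intro c u; ext <;> simp [curvC, smul_sub, smul_add] }
  have hL : ContinuousOn L (Ioo a b) := by
    rw [continuousOn_clm_apply]
    intro w r hr
    have hz := hQ r hr
    have cΓ := h.contDiffAt_Γ (hy.mapsTo hz)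
    have cy := hy.contDiffAt hz
    have cS := iS.contDiffAt hy.isOpen hz
    have cΓy : ContDiffAt ℝ ∞ (fun q ↦ Γ (y q)) (t, r) := cΓ.comp _ cy
    have k1 : ∀ w : E, ContDiffAt ℝ ∞ (fun q ↦ Γ (y q) (fderiv ℝ y q (0, 1)) w) (t, r) :=
      fun w ↦ cΓy.clm_apply₂ cS contDiffAt_const
    have k2 := ContDiffAt.curvC cΓ cy cS (b := fun _ ↦ w.1) contDiffAt_const cS
    have k3 : ContinuousAt (fun q ↦ (w.2 - Γ (y q) (fderiv ℝ y q (0, 1)) w.1,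
        curvC Γ (y q) (fderiv ℝ y q (0, 1)) w.1 (fderiv ℝ y q (0, 1))
          - Γ (y q) (fderiv ℝ y q (0, 1)) w.2)) (t, r) :=
      ((contDiffAt_const.sub (k1 w.1)).prodMk (k2.sub (k1 w.2))).continuousAt
    exact (ContinuousAt.comp (f := fun r ↦ (t, r)) k3
      (Continuous.prodMk_right t).continuousAt).continuousWithinAt
  have hu : ∀ r ∈ Ioo a b, HasDerivAt (fun r ↦ (T (t, r), covC Γ y T (t, r) (0, 1)))
      (L r (T (t, r), covC Γ y T (t, r) (0, 1))) r := by
    intro r hr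
    have h1 := hasDerivAt_snd (iT.contDiffAt hy.isOpen (hQ r hr)).differentiableAt_infty
    have h2 := hasDerivAt_snd (iD.contDiffAt hy.isOpen (hQ r hr)).differentiableAt_infty
    have h3 := hB r hr
    rw [h.bitensC_eq hy (hQ r hr), covC, ← hT] at h3
    refine (h1.prodMk h2).congr_deriv ?_
    refine Prod.ext ?_ ?_
    · change _ = covC Γ y T (t, r) (0, 1) - Γ (y (t, r)) (fderiv ℝ y (t, r) (0, 1)) (T (t, r))
      rw [covC]; abel
    · change _ = curvC Γ (y (t, r)) (fderiv ℝ y (t, r) (0, 1)) (T (t, r))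
        (fderiv ℝ y (t, r) (0, 1)) - Γ (y (t, r)) (fderiv ℝ y (t, r) (0, 1))
          (covC Γ y T (t, r) (0, 1))
      rw [← sub_eq_zero, ← h3]
      abel
  have hzero : (T (t, s₀), covC Γ y T (t, s₀) (0, 1)) = 0 := by
    have h1 := hasDerivAt_snd (iT.contDiffAt hy.isOpen (hQ s₀ hs₀)).differentiableAt_infty
    have h2 : fderiv ℝ T (t, s₀) (0, 1) = 0 :=
      h1.unique ((hasDerivAt_const s₀ (0 : E)).congr_of_eventuallyEq h0)
    refine Prod.ext h0.self_of_nhds ?_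
    change covC Γ y T (t, s₀) (0, 1) = 0
    rw [covC, h2, h0.self_of_nhds]
    simp
  exact congrArg Prod.fst (eq_zero_of_linear_ode hL hu hs₀ hzero hs)

end FlowSurfaceTension

/-! ### The Euclidean plane and the line as flat models. -/

section FlatModels

open Filter Topology

/-- The standard inner product of the plane. -/
def planeForm : ℝ × ℝ →L[ℝ] ℝ × ℝ →L[ℝ] ℝ :=
  (ContinuousLinearMap.fst ℝ ℝ ℝ).smulRight (ContinuousLinearMap.fst ℝ ℝ ℝ)
    + (ContinuousLinearMap.snd ℝ ℝ ℝ).smulRight (ContinuousLinearMap.snd ℝ ℝ ℝ)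

@[simp] lemma planeForm_apply (u v : ℝ × ℝ) : planeForm u v = u.1 * v.1 + u.2 * v.2 := by
  simp [planeForm]

lemma planeForm_symm (u v : ℝ × ℝ) : planeForm u v = planeForm v u := by
  simp [mul_comm]

lemma planeForm_pos (u : ℝ × ℝ) (hu : u ≠ 0) : 0 < planeForm u u := by
  rw [planeForm_apply]
  by_contra h
  have h1 := mul_self_nonneg u.1
  have h2 := mul_self_nonneg u.2
  exact hu (Prod.ext (mul_self_eq_zero.1 (by linarith)) (mul_self_eq_zero.1 (by linarith)))

lemma planeForm_basis (i j : Fin 2) : planeForm (Module.Basis.finTwoProd ℝ i)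
    (Module.Basis.finTwoProd ℝ j) = if i = j then 1 else 0 := by
  fin_cases i <;> fin_cases j <;> simp

lemma lineMetric_inner (q : ℝ) (u v : ℝ) : lineMetric.inner q u v = u * v := by
  have : lineMetric.inner q u v = inner ℝ u v := rfl
  rw [this, real_inner_eq_re_inner, RCLike.inner_apply]
  simp [mul_comm]

lemma isFlatChartAt_lineMetric (p q : ℝ) :
    IsFlatChartAt (ContinuousLinearMap.mul ℝ ℝ) lineMetric p (id : ℝ → ℝ) q where
  mem_source := by rw [chartAt_self_eq]; exact mem_univ _
  continuousAt := continuousAt_id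
  isFlatAt := by
    refine ⟨fun u v ↦ by simp [mul_comm], fun u hu ↦ by simpa using mul_self_pos.2 hu, rfl,
      Eventually.of_forall fun _ ↦ contDiffAt_id, Eventually.of_forall fun r u v ↦ ?_⟩
    have h1 : (fun q' ↦ extChartAt 𝓘(ℝ, ℝ) p (id q')) = (id : ℝ → ℝ) := rfl
    rw [h1]
    have hr : r ∈ (chartAt ℝ p).source := by rw [chartAt_self_eq]; exact mem_univ _
    have hu : toChart 𝓘(ℝ, ℝ) p r u = u := toChart_modelSpace p r u
    have hv : toChart 𝓘(ℝ, ℝ) p r v = v := toChart_modelSpace p r v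
    have h2 := metricRep_apply lineMetric hr u v
    rw [hu, hv] at h2
    rw [fderiv_id]
    exact (h2.trans (lineMetric_inner r u v)).symm

end FlatModels

/-! ### Tension and bitension fields of curves. -/

section Curves

open Filter Topology

variable {E : Type*} [NormedAddCommGroup E] [NormedSpace ℝ E] [FiniteDimensional ℝ E]
  {N : Type*} [TopologicalSpace N] [ChartedSpace E N] [IsManifold 𝓘(ℝ, E) ∞ N]
  {h : SmoothMetric 𝓘(ℝ, E) N} {γ : ℝ → N} {s : ℝ} {x : N}

lemma mul_basis_singleton (i j : Unit) : ContinuousLinearMap.mul ℝ ℝ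
    (Module.Basis.singleton Unit ℝ i) (Module.Basis.singleton Unit ℝ j) = if i = j then 1 else 0 := by
  simp

/-- The identity of the line is a flat chart, with a basis of one vector. -/
lemma toChart_tensionField_curve (hγ : ∀ᶠ r in 𝓝 s, ContMDiffAt 𝓘(ℝ, ℝ) 𝓘(ℝ, E) ∞ γ r)
    (hx : γ s ∈ (chartAt E x).source) :
    toChart 𝓘(ℝ, E) x (γ s) (tensionField lineMetric h γ s) =
      tensC (chrC (metricRep h x)) (Module.Basis.singleton Unit ℝ)
        (fun r ↦ extChartAt 𝓘(ℝ, E) x (γ r)) s :=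
  IsFlatChartAt.toChart_tensionField (k := (id : ℝ → ℝ))
    (Eventually.of_forall (isFlatChartAt_lineMetric s)) _ mul_basis_singleton hγ hx

lemma toChart_bitensionField_curve (hγ : ∀ᶠ r in 𝓝 s, ContMDiffAt 𝓘(ℝ, ℝ) 𝓘(ℝ, E) ∞ γ r)
    (hx : γ s ∈ (chartAt E x).source) :
    toChart 𝓘(ℝ, E) x (γ s) (bitensionField lineMetric h γ s) =
      bitensC (chrC (metricRep h x)) (Module.Basis.singleton Unit ℝ)
        (fun r ↦ extChartAt 𝓘(ℝ, E) x (γ r)) s :=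
  IsFlatChartAt.toChart_bitensionField (k := (id : ℝ → ℝ))
    (Eventually.of_forall (isFlatChartAt_lineMetric s)) _ mul_basis_singleton hγ hx

end Curves

/-! ### Maps of the plane whose `t`-lines are integral curves. -/

section FlowMaps

open Filter Topology

variable {E : Type*} [NormedAddCommGroup E] [NormedSpace ℝ E] [FiniteDimensional ℝ E]
  {N : Type*} [TopologicalSpace N] [ChartedSpace E N] [IsManifold 𝓘(ℝ, E) ∞ N]

/-- `F` is smooth on the open set `Q`, with `∂F/∂t = ξ ∘ F`. -/
structure IsFlowMap (ξ : Π x : N, TangentSpace 𝓘(ℝ, E) x) (F : ℝ × ℝ → N) (Q : Set (ℝ × ℝ)) :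
    Prop where
  isOpen : IsOpen Q
  contMDiffOn : ContMDiffOn 𝓘(ℝ, ℝ × ℝ) 𝓘(ℝ, E) ∞ F Q
  mfderiv_fst : ∀ q ∈ Q, mfderiv 𝓘(ℝ, ℝ × ℝ) 𝓘(ℝ, E) F q ((1, 0) : ℝ × ℝ) = ξ (F q)

namespace IsFlowMap

variable {ξ : Π x : N, TangentSpace 𝓘(ℝ, E) x} {F : ℝ × ℝ → N} {Q : Set (ℝ × ℝ)} {x : N}
  {q : ℝ × ℝ}

lemma contMDiffAt (h : IsFlowMap ξ F Q) (hq : q ∈ Q) :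
    ContMDiffAt 𝓘(ℝ, ℝ × ℝ) 𝓘(ℝ, E) ∞ F q := h.contMDiffOn.contMDiffAt (h.isOpen.mem_nhds hq)

lemma _root_.toChart_mfderiv_modelSpace {X : Type*} [NormedAddCommGroup X] [NormedSpace ℝ X]
    {F : X → N} {q : X} (hF : ContMDiffAt 𝓘(ℝ, X) 𝓘(ℝ, E) ∞ F q)
    (hx : F q ∈ (chartAt E x).source) (v : X) :
    toChart 𝓘(ℝ, E) x (F q) (mfderiv 𝓘(ℝ, X) 𝓘(ℝ, E) F q v) =
      fderiv ℝ (fun q ↦ extChartAt 𝓘(ℝ, E) x (F q)) q v := by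
  have h1 := toChart_mfderiv (p := q) hF (mem_chart_source _ _) hx v
  have h2 : toChart 𝓘(ℝ, X) q q v = v := toChart_modelSpace q q v
  exact h1.trans (congrArg _ h2)

lemma isOpen_chart (h : IsFlowMap ξ F Q) (x : N) : IsOpen (Q ∩ F ⁻¹' (chartAt E x).source) :=
  h.contMDiffOn.continuousOn.isOpen_inter_preimage h.isOpen (chartAt E x).open_source

lemma isFlowSurface (h : IsFlowMap ξ F Q) (x : N) :
    IsFlowSurface (fieldRep x ξ) (extChartAt 𝓘(ℝ, E) x).target
      (fun q ↦ extChartAt 𝓘(ℝ, E) x (F q)) (Q ∩ F ⁻¹' (chartAt E x).source) where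
  isOpen := h.isOpen_chart x
  contDiffOn q hq := ((h.contMDiffAt hq.1).repMap (p := q) (mem_chart_source _ _)
    hq.2).contDiffWithinAt
  mapsTo q hq := extChartAt_mem_target hq.2
  fderiv_fst q hq := by
    rw [← toChart_mfderiv_modelSpace (h.contMDiffAt hq.1) hq.2, h.mfderiv_fst q hq.1,
      fieldRep_apply hq.2]

lemma exists_Ioo {P : Set (ℝ × ℝ)} (hP : IsOpen P) {t s : ℝ} (h : (t, s) ∈ P) :
    ∃ a b, t ∈ Ioo a b ∧ ∀ r ∈ Ioo a b, (r, s) ∈ P := by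
  have : ∀ᶠ r in 𝓝 t, (r, s) ∈ P :=
    (Continuous.prodMk_left s).continuousAt.eventually (hP.eventually_mem h)
  obtain ⟨a, b, hab, hs⟩ := mem_nhds_iff_exists_Ioo_subset.1 this
  exact ⟨a, b, hab, hs⟩

end IsFlowMap

end FlowMaps

/-! ### The induced metric is constant along the flow. -/

section FlowParametrizations

open Filter Topology

variable {E : Type*} [NormedAddCommGroup E] [NormedSpace ℝ E] [FiniteDimensional ℝ E]
  {N : Type*} [TopologicalSpace N] [ChartedSpace E N] [IsManifold 𝓘(ℝ, E) ∞ N]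
  {S : ContactMetricStructure 𝓘(ℝ, E) N} (hS : S.IsSasakian) {F : ℝ × ℝ → N} {Q : Set (ℝ × ℝ)}
include hS

lemma ContactMetricStructure.IsSasakian.inner_ξ (x : N) (u : TangentSpace 𝓘(ℝ, E) x) :
    S.g.inner x (S.ξ x) u = S.η x u := by
  have h1 := (hS.isSasakianOn x).g_ξ (extChartAt_mem_target (mem_chart_source E x))
    (toChart 𝓘(ℝ, E) x x u)
  rwa [fieldRep_apply (mem_chart_source E x), metricRep_apply S.g (mem_chart_source E x),
    S.ηRep_apply (mem_chart_source E x)] at h1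

/-- The coefficients of the induced metric are constant along the flow. -/
lemma IsFlowMap.eventually_inner_eq (hF : IsFlowMap S.ξ F Q) {t s : ℝ} (hq : (t, s) ∈ Q) :
    ∀ᶠ r in 𝓝 t, S.g.inner (F (t, s)) (mfderiv 𝓘(ℝ, ℝ × ℝ) 𝓘(ℝ, E) F (t, s) ((0, 1) : ℝ × ℝ))
        (mfderiv 𝓘(ℝ, ℝ × ℝ) 𝓘(ℝ, E) F (t, s) ((0, 1) : ℝ × ℝ)) =
      S.g.inner (F (r, s)) (mfderiv 𝓘(ℝ, ℝ × ℝ) 𝓘(ℝ, E) F (r, s) ((0, 1) : ℝ × ℝ))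
        (mfderiv 𝓘(ℝ, ℝ × ℝ) 𝓘(ℝ, E) F (r, s) ((0, 1) : ℝ × ℝ)) ∧
      S.η (F (t, s)) (mfderiv 𝓘(ℝ, ℝ × ℝ) 𝓘(ℝ, E) F (t, s) ((0, 1) : ℝ × ℝ)) =
      S.η (F (r, s)) (mfderiv 𝓘(ℝ, ℝ × ℝ) 𝓘(ℝ, E) F (r, s) ((0, 1) : ℝ × ℝ)) := by
  set x := F (t, s) with hx
  have hm : (t, s) ∈ Q ∩ F ⁻¹' (chartAt E x).source := ⟨hq, mem_chart_source E x⟩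
  have hy := hF.isFlowSurface x
  have hSx := hS.isSasakianOn x
  have hA := hSx.isAffineGeodesicField
  obtain ⟨a, b, ht, hab⟩ := IsFlowMap.exists_Ioo hy.isOpen hm
  have iS := hA.invariant_fderiv_snd hy
  -- `ξ` restricted to the surface is itself invariant, so its product with `∂_s`, which is
  -- `η(∂_s)`, is constant in time.
  have iξ : IsInvariantAlong (fieldRep x S.ξ) (fun q ↦ extChartAt 𝓘(ℝ, E) x (F q))
      (Q ∩ F ⁻¹' (chartAt E x).source) (fun q ↦ fieldRep x S.ξ (extChartAt 𝓘(ℝ, E) x (F q))) := by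
    refine ⟨fun q hq ↦ ?_, fun q hq ↦ ?_⟩
    · exact ((hA.contDiffAt_ξ (hy.mapsTo hq)).comp q (hy.contDiffAt hq)).contDiffWithinAt
    · have h1 := fderiv_comp_apply' (y := fun q ↦ extChartAt 𝓘(ℝ, E) x (F q)) (hA.contDiffAt_ξ (hy.mapsTo hq)).differentiableAt_infty
        (hy.contDiffAt hq).differentiableAt_infty (1, 0)
      rw [hy.fderiv_fst q hq] at h1
      exact h1
  have hK := fun z hz ↦ hSx.killing (z := z) hz
  filter_upwards [Ioo_mem_nhds ht.1 ht.2] with r hr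
  have e1 := iS.inner_eq iS hy hSx.isMetricOn hK hab ht hr
  have e2 := iξ.inner_eq iS hy hSx.isMetricOn hK hab ht hr
  have conv : ∀ r ∈ Ioo a b, toChart 𝓘(ℝ, E) x (F (r, s))
      (mfderiv 𝓘(ℝ, ℝ × ℝ) 𝓘(ℝ, E) F (r, s) ((0, 1) : ℝ × ℝ)) =
      fderiv ℝ (fun q ↦ extChartAt 𝓘(ℝ, E) x (F q)) (r, s) (0, 1) := fun r hr ↦
    toChart_mfderiv_modelSpace (hF.contMDiffAt (hab r hr).1) (hab r hr).2 _
  beta_reduce at e1 e2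
  rw [← conv r hr, ← conv t ht, metricRep_apply S.g (hab r hr).2,
    metricRep_apply S.g (hab t ht).2] at e1
  rw [← conv r hr, ← conv t ht, fieldRep_apply (hab r hr).2, fieldRep_apply (hab t ht).2,
    metricRep_apply S.g (hab r hr).2, metricRep_apply S.g (hab t ht).2, hS.inner_ξ,
    hS.inner_ξ] at e2
  exact ⟨e1.symm, e2.symm⟩

end FlowParametrizations

/-! ### Flat parametrizations by the flow; comparison with curves. -/

section FlowParametrization

open Filter Topology

variable {E : Type*} [NormedAddCommGroup E] [NormedSpace ℝ E] [FiniteDimensional ℝ E]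
  {N : Type*} [TopologicalSpace N] [ChartedSpace E N] [IsManifold 𝓘(ℝ, E) ∞ N]
  {E' : Type*} [NormedAddCommGroup E'] [NormedSpace ℝ E'] [FiniteDimensional ℝ E']
  {M : Type*} [TopologicalSpace M] [ChartedSpace E' M] [IsManifold 𝓘(ℝ, E') ∞ M]

variable (E') in
/-- `ψ` is a smooth parametrization of part of `M` by the open set `Q` of the plane, isometric for
the flat metric of the plane and the metric induced by `f`, and such that `f ∘ ψ` maps the lines
`s = const` to integral curves of `ξ`. -/
structure IsFlowParam (S : ContactMetricStructure 𝓘(ℝ, E) N) (f : M → N) (ψ : ℝ × ℝ → M)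
    (Q : Set (ℝ × ℝ)) : Prop where
  contMDiffOn : ContMDiffOn 𝓘(ℝ, ℝ × ℝ) 𝓘(ℝ, E') ∞ ψ Q
  isFlowMap : IsFlowMap S.ξ (f ∘ ψ) Q
  isometry : ∀ q ∈ Q, ∀ u v : ℝ × ℝ, S.g.inner (f (ψ q))
    (mfderiv 𝓘(ℝ, ℝ × ℝ) 𝓘(ℝ, E) (f ∘ ψ) q u) (mfderiv 𝓘(ℝ, ℝ × ℝ) 𝓘(ℝ, E) (f ∘ ψ) q v)
      = planeForm u v

namespace IsFlowParam

variable {S : ContactMetricStructure 𝓘(ℝ, E) N} {g : SmoothMetric 𝓘(ℝ, E') M} {f : M → N}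
  {ψ : ℝ × ℝ → M} {Q : Set (ℝ × ℝ)} {q : ℝ × ℝ} {t s : ℝ} {x : N}

lemma contMDiffAt (h : IsFlowParam E' S f ψ Q) (hq : q ∈ Q) :
    ContMDiffAt 𝓘(ℝ, ℝ × ℝ) 𝓘(ℝ, E') ∞ ψ q :=
  h.contMDiffOn.contMDiffAt (h.isFlowMap.isOpen.mem_nhds hq)

/-- `f ∘ ψ` is isometric for `planeForm` and `f` is isometric, hence `ψ` is a local isometry from
the flat plane. -/
lemma isFlatChartAt (h : IsFlowParam E' S f ψ Q) (hf : IsIsometricImmersion g S.g f)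
    (hdim : Module.finrank ℝ E' = 2) (hq : q ∈ Q) :
    ∀ᶠ q' in 𝓝 q, IsFlatChartAt planeForm g (ψ q) ψ q' := by
  have hQ := h.isFlowMap.isOpen
  have hs : ∀ᶠ q' in 𝓝 q, q' ∈ Q ∧ ψ q' ∈ (chartAt E' (ψ q)).source :=
    (hQ.eventually_mem hq).and ((h.contMDiffAt hq).continuousAt
      ((chartAt E' (ψ q)).open_source.mem_nhds (mem_chart_source E' (ψ q))))
  filter_upwards [hs.eventually_nhds] with q' hq'
  refine ⟨hq'.self_of_nhds.2, (h.contMDiffAt hq'.self_of_nhds.1).continuousAt, planeForm_symm,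
    planeForm_pos, by simp [hdim], ?_, ?_⟩
  · filter_upwards [hq'] with r hr
    exact (h.contMDiffAt hr.1).repMap (p := r) (mem_chart_source _ _) hr.2
  · filter_upwards [hq'] with r hr u v
    have hc : ∀ w : ℝ × ℝ, mfderiv 𝓘(ℝ, ℝ × ℝ) 𝓘(ℝ, E) (f ∘ ψ) r w =
        mfderiv 𝓘(ℝ, E') 𝓘(ℝ, E) f (ψ r) (mfderiv 𝓘(ℝ, ℝ × ℝ) 𝓘(ℝ, E') ψ r w) := fun w ↦
      mfderiv_comp_apply r ((hf.1 (ψ r)).mdifferentiableAt (by simp))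
        ((h.contMDiffAt hr.1).mdifferentiableAt (by simp)) w
    have h1 := h.isometry r hr.1 u v
    rw [hc, hc, hf.2, ← metricRep_apply g hr.2,
      toChart_mfderiv_modelSpace (h.contMDiffAt hr.1) hr.2,
      toChart_mfderiv_modelSpace (h.contMDiffAt hr.1) hr.2] at h1
    exact h1.symm

section

variable (h : IsFlowParam E' S f ψ Q) (hf : IsIsometricImmersion g S.g f)
  (hdim : Module.finrank ℝ E' = 2)
include h hf hdim

lemma toChart_tensionField (hq : q ∈ Q) (hx : f (ψ q) ∈ (chartAt E x).source) :
    toChart 𝓘(ℝ, E) x (f (ψ q)) (tensionField g S.g f (ψ q)) =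
      tensC (chrC (metricRep S.g x)) (Module.Basis.finTwoProd ℝ)
        (fun q' ↦ extChartAt 𝓘(ℝ, E) x ((f ∘ ψ) q')) q :=
  IsFlatChartAt.toChart_tensionField (h.isFlatChartAt hf hdim hq) _ planeForm_basis
    (Eventually.of_forall fun m ↦ hf.1 m) hx

lemma toChart_bitensionField (hq : q ∈ Q) (hx : f (ψ q) ∈ (chartAt E x).source) :
    toChart 𝓘(ℝ, E) x (f (ψ q)) (bitensionField g S.g f (ψ q)) =
      bitensC (chrC (metricRep S.g x)) (Module.Basis.finTwoProd ℝ)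
        (fun q' ↦ extChartAt 𝓘(ℝ, E) x ((f ∘ ψ) q')) q :=
  IsFlatChartAt.toChart_bitensionField (h.isFlatChartAt hf hdim hq) _ planeForm_basis
    (Eventually.of_forall fun m ↦ hf.1 m) hx

lemma tensionField_eq_zero_iff (hq : q ∈ Q) (hx : f (ψ q) ∈ (chartAt E x).source) :
    tensionField g S.g f (ψ q) = 0 ↔ tensC (chrC (metricRep S.g x)) (Module.Basis.finTwoProd ℝ)
        (fun q' ↦ extChartAt 𝓘(ℝ, E) x ((f ∘ ψ) q')) q = 0 := by
  rw [← h.toChart_tensionField hf hdim hq hx]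
  exact ((map_eq_zero_iff (toChart 𝓘(ℝ, E) x (f (ψ q))) (toChart_injective hx)).symm)

lemma bitensionField_eq_zero_iff (hq : q ∈ Q) (hx : f (ψ q) ∈ (chartAt E x).source) :
    bitensionField g S.g f (ψ q) = 0 ↔ bitensC (chrC (metricRep S.g x))
      (Module.Basis.finTwoProd ℝ) (fun q' ↦ extChartAt 𝓘(ℝ, E) x ((f ∘ ψ) q')) q = 0 := by
  rw [← h.toChart_bitensionField hf hdim hq hx]
  exact ((map_eq_zero_iff (toChart 𝓘(ℝ, E) x (f (ψ q))) (toChart_injective hx)).symm)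

/-- Along a line `s = const` both fields solve the linearised flow equation, so they vanish at all
times or at none. This is local in time, since the computation takes place in the chart at one
point. -/
lemma eventually_iff (hS : S.IsSasakian) (hq : (t, s) ∈ Q) :
    ∀ᶠ r in 𝓝 t,
      (tensionField g S.g f (ψ (t, s)) = 0 ↔ tensionField g S.g f (ψ (r, s)) = 0) ∧
      (bitensionField g S.g f (ψ (t, s)) = 0 ↔ bitensionField g S.g f (ψ (r, s)) = 0) := by
  set x := f (ψ (t, s)) with hx
  have hm : (t, s) ∈ Q ∩ (f ∘ ψ) ⁻¹' (chartAt E x).source := ⟨hq, mem_chart_source E x⟩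
  have hy := h.isFlowMap.isFlowSurface x
  have hA := (hS.isSasakianOn x).isAffineGeodesicField
  obtain ⟨a, b, ht, hab⟩ := IsFlowMap.exists_Ioo hy.isOpen hm
  filter_upwards [Ioo_mem_nhds ht.1 ht.2] with r hr
  have iT := hA.isInvariantAlong_tensC hy
  have iB := hA.isInvariantAlong_bitensC hy
  rw [h.tensionField_eq_zero_iff hf hdim (hab t ht).1 (hab t ht).2,
    h.tensionField_eq_zero_iff hf hdim (hab r hr).1 (hab r hr).2,
    h.bitensionField_eq_zero_iff hf hdim (hab t ht).1 (hab t ht).2,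
    h.bitensionField_eq_zero_iff hf hdim (hab r hr).1 (hab r hr).2]
  exact ⟨⟨fun h0 ↦ iT.eq_zero hy hA.isOpen hA.contDiffOn_ξ hab ht h0 hr,
    fun h0 ↦ iT.eq_zero hy hA.isOpen hA.contDiffOn_ξ hab hr h0 ht⟩,
    ⟨fun h0 ↦ iB.eq_zero hy hA.isOpen hA.contDiffOn_ξ hab ht h0 hr,
    fun h0 ↦ iB.eq_zero hy hA.isOpen hA.contDiffOn_ξ hab hr h0 ht⟩⟩

/-- The vanishing of the tension and bitension fields does not depend on time. -/
lemma iff_of_mem (hS : S.IsSasakian) {a b : ℝ} (hab : ∀ r ∈ Ioo a b, (r, s) ∈ Q) {t' : ℝ}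
    (ht : t ∈ Ioo a b) (ht' : t' ∈ Ioo a b) :
    (tensionField g S.g f (ψ (t, s)) = 0 ↔ tensionField g S.g f (ψ (t', s)) = 0) ∧
      (bitensionField g S.g f (ψ (t, s)) = 0 ↔ bitensionField g S.g f (ψ (t', s)) = 0) := by
  -- The relation is an equivalence and holds for nearby times; an interval is connected.
  refine isPreconnected_Ioo.induction₂ (fun t t' ↦
    (tensionField g S.g f (ψ (t, s)) = 0 ↔ tensionField g S.g f (ψ (t', s)) = 0) ∧
      (bitensionField g S.g f (ψ (t, s)) = 0 ↔ bitensionField g S.g f (ψ (t', s)) = 0))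
    (fun r hr ↦ ?_) (fun r₁ r₂ r₃ _ _ _ h1 h2 ↦ ⟨h1.1.trans h2.1, h1.2.trans h2.2⟩)
    (fun r₁ r₂ _ _ h1 ↦ ⟨h1.1.symm, h1.2.symm⟩) ht ht'
  exact (h.eventually_iff hf hdim hS (hab r hr)).filter_mono nhdsWithin_le_nhds

/-- Comparison with the curve `s ↦ f (ψ (t, s))`. -/
lemma curve_iff (hS : S.IsSasakian) {γ : ℝ → N} (hq : (t, s) ∈ Q)
    (hγ : ∀ᶠ r in 𝓝 s, γ r = f (ψ (t, r))) :
    (tensionField lineMetric S.g γ s = 0 ↔ tensionField g S.g f (ψ (t, s)) = 0) ∧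
      (bitensionField lineMetric S.g γ s = 0 ↔ bitensionField g S.g f (ψ (t, s)) = 0) := by
  set x := f (ψ (t, s)) with hx
  have hm : (t, s) ∈ Q ∩ (f ∘ ψ) ⁻¹' (chartAt E x).source := ⟨hq, mem_chart_source E x⟩
  have hy := h.isFlowMap.isFlowSurface x
  have hA := (hS.isSasakianOn x).isAffineGeodesicField
  have hγx : γ s ∈ (chartAt E x).source := by
    rw [hγ.self_of_nhds]; exact mem_chart_source E x
  have hγs : ∀ᶠ r in 𝓝 s, ContMDiffAt 𝓘(ℝ, ℝ) 𝓘(ℝ, E) ∞ γ r := by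
    filter_upwards [hγ.eventually_nhds, eventually_snd (h.isFlowMap.isOpen.eventually_mem hq)]
      with r hr hr'
    have : ContMDiffAt 𝓘(ℝ, ℝ) 𝓘(ℝ, E) ∞ (fun r ↦ (f ∘ ψ) (t, r)) r :=
      (h.isFlowMap.contMDiffAt hr').comp r
        (contDiff_prodMk_right t).contMDiff.contMDiffAt
    exact this.congr_of_eventuallyEq hr
  have e : (fun r ↦ extChartAt 𝓘(ℝ, E) x (γ r)) =ᶠ[𝓝 s]
      fun r ↦ extChartAt 𝓘(ℝ, E) x ((f ∘ ψ) (t, r)) := by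
    filter_upwards [hγ] with r hr
    rw [hr]; rfl
  have k1 := toChart_tensionField_curve (h := S.g) hγs hγx
  have k2 := toChart_bitensionField_curve (h := S.g) hγs hγx
  rw [tensC_congr e, hA.tensC_snd hy hm] at k1
  rw [bitensC_congr e, hA.bitensC_snd hy hm] at k2
  have i1 := map_eq_zero_iff (toChart 𝓘(ℝ, E) x (γ s)) (toChart_injective hγx)
    (x := tensionField lineMetric S.g γ s)
  have i2 := map_eq_zero_iff (toChart 𝓘(ℝ, E) x (γ s)) (toChart_injective hγx)
    (x := bitensionField lineMetric S.g γ s)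
  rw [k1] at i1
  rw [k2] at i2
  exact ⟨i1.symm.trans (h.tensionField_eq_zero_iff hf hdim hq hm.2).symm,
    i2.symm.trans (h.bitensionField_eq_zero_iff hf hdim hq hm.2).symm⟩

/-- Unique continuation for the tension field. -/
lemma tensionField_eq_zero (hS : S.IsSasakian) {a b a' b' : ℝ} (hab : Q = Ioo a b ×ˢ Ioo a' b')
    (hx : ∀ q ∈ Q, f (ψ q) ∈ (chartAt E x).source)
    (hB : ∀ q ∈ Q, bitensionField g S.g f (ψ q) = 0) {q₀ : ℝ × ℝ} (hq₀ : q₀ ∈ Q)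
    (h0 : ∀ᶠ q in 𝓝 q₀, tensionField g S.g f (ψ q) = 0) (hq : q ∈ Q) :
    tensionField g S.g f (ψ q) = 0 := by
  obtain ⟨t₀, s₀⟩ := q₀
  obtain ⟨t, s⟩ := q
  have hm : ∀ q ∈ Q, q ∈ Q ∩ (f ∘ ψ) ⁻¹' (chartAt E x).source := fun q hq ↦ ⟨hq, hx q hq⟩
  have hy := h.isFlowMap.isFlowSurface x
  have hA := (hS.isSasakianOn x).isAffineGeodesicField
  have hq₀' : t₀ ∈ Ioo a b ∧ s₀ ∈ Ioo a' b' := by rw [hab] at hq₀; exact hq₀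
  have hq' : t ∈ Ioo a b ∧ s ∈ Ioo a' b' := by rw [hab] at hq; exact hq
  have hmem : ∀ r ∈ Ioo a b, ∀ r' ∈ Ioo a' b', (r, r') ∈ Q := by
    intro r hr r' hr'; rw [hab]; exact ⟨hr, hr'⟩
  -- Move along the line `t = t₀` from `s₀` to `s` by the bitension equation, then along the flow
  -- from `t₀` to `t`.
  have key : tensionField g S.g f (ψ (t₀, s)) = 0 := by
    rw [h.tensionField_eq_zero_iff hf hdim (hmem _ hq₀'.1 _ hq'.2) (hx _ (hmem _ hq₀'.1 _ hq'.2))]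
    refine hA.tensC_eq_zero hy (a := a') (b := b') (s₀ := s₀)
      (fun r hr ↦ hm _ (hmem _ hq₀'.1 _ hr)) ?_ hq₀'.2 ?_ hq'.2
    · intro r hr
      have hr' := hmem _ hq₀'.1 _ hr
      exact (h.bitensionField_eq_zero_iff hf hdim hr' (hx _ hr')).1 (hB _ hr')
    · filter_upwards [eventually_snd h0, isOpen_Ioo.eventually_mem hq₀'.2] with r hr hr'
      have hr'' := hmem _ hq₀'.1 _ hr'
      exact (h.tensionField_eq_zero_iff hf hdim hr'' (hx _ hr'')).1 hr
  exact (h.iff_of_mem hf hdim hS (fun r hr ↦ hmem r hr s hq'.2) hq₀'.1 hq'.1).1.1 key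

end

end IsFlowParam

end FlowParametrization

/-! ### The pointwise description of the flow, and restrictions to coordinate lines. -/

section FlowImages

open Filter Topology

variable {E : Type*} [NormedAddCommGroup E] [NormedSpace ℝ E] [FiniteDimensional ℝ E]
  {N : Type*} [TopologicalSpace N] [ChartedSpace E N] [IsManifold 𝓘(ℝ, E) ∞ N]
  {ξ : Π x : N, TangentSpace 𝓘(ℝ, E) x}

lemma IsMIntegralCurveOn.eq_of_mem [T2Space N]
    (hξ : ContMDiff 𝓘(ℝ, E) (𝓘(ℝ, E).prod 𝓘(ℝ, E)) ∞
      (fun x ↦ TotalSpace.mk' E (E := fun x : N ↦ TangentSpace 𝓘(ℝ, E) x) x (ξ x)))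
    {σ σ' : ℝ → N} {a b a' b' t₀ t : ℝ} (h : IsMIntegralCurveOn σ ξ (Ioo a b))
    (h' : IsMIntegralCurveOn σ' ξ (Ioo a' b')) (h0 : t₀ ∈ Ioo a b) (h0' : t₀ ∈ Ioo a' b')
    (e : σ t₀ = σ' t₀) (ht : t ∈ Ioo a b) (ht' : t ∈ Ioo a' b') : σ t = σ' t := by
  have hs : Ioo (max a a') (min b b') ⊆ Ioo a b := Ioo_subset_Ioo (le_max_left _ _) (min_le_left _ _)
  have hs' : Ioo (max a a') (min b b') ⊆ Ioo a' b' :=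
    Ioo_subset_Ioo (le_max_right _ _) (min_le_right _ _)
  have : IsManifold 𝓘(ℝ, E) 1 N := IsManifold.of_le (n := ∞) (by simp)
  exact isMIntegralCurveOn_Ioo_eqOn_of_contMDiff_boundaryless (I := 𝓘(ℝ, E))
    ⟨max_lt h0.1 h0'.1, lt_min h0.2 h0'.2⟩
    (hξ.of_le (by simp)) (h.mono hs) (h'.mono hs') e ⟨max_lt ht.1 ht'.1, lt_min ht.2 ht'.2⟩

/-- `IsFlowImage` provides a separate integral curve for each time. They all start at `p`, so by
uniqueness `c` agrees near `t` with the curve chosen for `t`. -/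
lemma IsFlowImage.hasMFDerivAt [T2Space N]
    (hξ : ContMDiff 𝓘(ℝ, E) (𝓘(ℝ, E).prod 𝓘(ℝ, E)) ∞
      (fun x ↦ TotalSpace.mk' E (E := fun x : N ↦ TangentSpace 𝓘(ℝ, E) x) x (ξ x)))
    {c : ℝ → N} {p : N} {ε t : ℝ} (h : ∀ t ∈ Ioo (-ε) ε, IsFlowImage ξ t p (c t))
    (ht : t ∈ Ioo (-ε) ε) :
    HasMFDerivAt 𝓘(ℝ, ℝ) 𝓘(ℝ, E) c t ((1 : ℝ →L[ℝ] ℝ).smulRight (ξ (c t))) := by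
  obtain ⟨a, b, σ, h0, htab, hσ, hσ0, hσt⟩ := h t ht
  have e : c =ᶠ[𝓝 t] σ := by
    filter_upwards [Ioo_mem_nhds ht.1 ht.2, Ioo_mem_nhds htab.1 htab.2] with r hr hr'
    obtain ⟨a', b', σ', h0', hrab', hσ', hσ0', hσr'⟩ := h r hr
    rw [← hσr']
    exact hσ'.eq_of_mem hξ hσ h0' h0 (hσ0'.trans hσ0.symm) hrab' hr'
  have h1 := (hσ t htab).hasMFDerivAt (Ioo_mem_nhds htab.1 htab.2)
  rw [hσt] at h1
  exact h1.congr_of_eventuallyEq e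

lemma IsFlowImage.zero_eq {p q : N} (h : IsFlowImage ξ 0 p q) : p = q := by
  obtain ⟨a, b, σ, -, -, -, h1, h2⟩ := h
  exact h1.symm.trans h2

lemma hasMFDerivAt_slice_fst {F : ℝ × ℝ → N} {t s : ℝ}
    (hF : MDifferentiableAt 𝓘(ℝ, ℝ × ℝ) 𝓘(ℝ, E) F (t, s)) :
    HasMFDerivAt 𝓘(ℝ, ℝ) 𝓘(ℝ, E) (fun r ↦ F (r, s)) t
      ((mfderiv 𝓘(ℝ, ℝ × ℝ) 𝓘(ℝ, E) F (t, s)).comp (ContinuousLinearMap.inl ℝ ℝ ℝ)) :=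
  HasMFDerivAt.comp (f := fun r : ℝ ↦ (r, s)) t hF.hasMFDerivAt
    (hasFDerivAt_prodMk_left t s).hasMFDerivAt

lemma hasMFDerivAt_slice_snd {F : ℝ × ℝ → N} {t s : ℝ}
    (hF : MDifferentiableAt 𝓘(ℝ, ℝ × ℝ) 𝓘(ℝ, E) F (t, s)) :
    HasMFDerivAt 𝓘(ℝ, ℝ) 𝓘(ℝ, E) (fun r ↦ F (t, r)) s
      ((mfderiv 𝓘(ℝ, ℝ × ℝ) 𝓘(ℝ, E) F (t, s)).comp (ContinuousLinearMap.inr ℝ ℝ ℝ)) :=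
  HasMFDerivAt.comp (f := fun r : ℝ ↦ (t, r)) s hF.hasMFDerivAt
    (hasFDerivAt_prodMk_right t s).hasMFDerivAt

lemma mfderiv_slice_snd {F : ℝ × ℝ → N} {γ : ℝ → N} {t s : ℝ}
    (hF : MDifferentiableAt 𝓘(ℝ, ℝ × ℝ) 𝓘(ℝ, E) F (t, s)) (hγ : γ =ᶠ[𝓝 s] fun r ↦ F (t, r)) :
    (mfderiv 𝓘(ℝ, ℝ) 𝓘(ℝ, E) γ s (1 : ℝ) : E) =
      mfderiv 𝓘(ℝ, ℝ × ℝ) 𝓘(ℝ, E) F (t, s) ((0, 1) : ℝ × ℝ) := by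
  rw [((hasMFDerivAt_slice_snd hF).congr_of_eventuallyEq hγ).mfderiv]
  rfl

end FlowImages

/-! ### From Legendre curves to proper-biharmonic surfaces. -/

section Converse

open Filter Topology

variable {E : Type*} [NormedAddCommGroup E] [NormedSpace ℝ E] [FiniteDimensional ℝ E]
  {N : Type*} [TopologicalSpace N] [T2Space N] [ChartedSpace E N] [IsManifold 𝓘(ℝ, E) ∞ N]
  {E' : Type*} [NormedAddCommGroup E'] [NormedSpace ℝ E'] [FiniteDimensional ℝ E']
  {M : Type*} [TopologicalSpace M] [ChartedSpace E' M] [IsManifold 𝓘(ℝ, E') ∞ M]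
  {S : ContactMetricStructure 𝓘(ℝ, E) N} {g : SmoothMetric 𝓘(ℝ, E') M} {f : M → N}

/-- `∂_t` is `ξ`, of length one. The products `g(∂_s, ∂_s)` and `η(∂_s)` are constant along the
flow, and at time `0` they are `1` and `0` because `γ` is a unit-speed Legendre curve. -/
lemma isFlowParam_of_isFlowImage (hS : S.IsSasakian) (hf : IsIsometricImmersion g S.g f)
    {ψ : ℝ × ℝ → M} {γ : ℝ → N} {ε a b : ℝ} (hε : 0 < ε) (hγ : S.IsLegendreCurve γ a b)
    (hψ : ContMDiffOn 𝓘(ℝ, ℝ × ℝ) 𝓘(ℝ, E') ∞ ψ (Ioo (-ε) ε ×ˢ Ioo a b))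
    (h : ∀ t ∈ Ioo (-ε) ε, ∀ s ∈ Ioo a b, IsFlowImage S.ξ t (γ s) (f (ψ (t, s)))) :
    IsFlowParam E' S f ψ (Ioo (-ε) ε ×ˢ Ioo a b) := by
  have h0 : (0 : ℝ) ∈ Ioo (-ε) ε := ⟨by linarith, hε⟩
  have hQ : IsOpen (Ioo (-ε) ε ×ˢ Ioo a b) := isOpen_Ioo.prod isOpen_Ioo
  have hF : IsFlowMap S.ξ (f ∘ ψ) (Ioo (-ε) ε ×ˢ Ioo a b) := by
    refine ⟨hQ, hf.1.comp_contMDiffOn hψ, ?_⟩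
    rintro ⟨t, s⟩ hq
    have hd := (hf.1.comp_contMDiffOn hψ).contMDiffAt (hQ.mem_nhds hq)
    have h1 := hasMFDerivAt_slice_fst (hd.mdifferentiableAt (by simp))
    have h2 := IsFlowImage.hasMFDerivAt S.contMDiff_ξ (c := fun r ↦ f (ψ (r, s)))
      (fun r hr ↦ h r hr s hq.2) hq.1
    have h3 := congrArg (fun L : ℝ →L[ℝ] E ↦ L 1) (hasMFDerivAt_unique h1 h2)
    refine Eq.trans ?_ (h3.trans ?_)
    · rfl
    · exact one_smul ℝ _
  refine ⟨hψ, hF, ?_⟩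
  rintro ⟨t, s⟩ hq
  set F := f ∘ ψ with hFdef
  have key : (S.g.inner (F (0, s)) (mfderiv 𝓘(ℝ, ℝ × ℝ) 𝓘(ℝ, E) F (0, s) ((0, 1) : ℝ × ℝ))
        (mfderiv 𝓘(ℝ, ℝ × ℝ) 𝓘(ℝ, E) F (0, s) ((0, 1) : ℝ × ℝ)) =
      S.g.inner (F (t, s)) (mfderiv 𝓘(ℝ, ℝ × ℝ) 𝓘(ℝ, E) F (t, s) ((0, 1) : ℝ × ℝ))
        (mfderiv 𝓘(ℝ, ℝ × ℝ) 𝓘(ℝ, E) F (t, s) ((0, 1) : ℝ × ℝ))) ∧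
      S.η (F (0, s)) (mfderiv 𝓘(ℝ, ℝ × ℝ) 𝓘(ℝ, E) F (0, s) ((0, 1) : ℝ × ℝ)) =
      S.η (F (t, s)) (mfderiv 𝓘(ℝ, ℝ × ℝ) 𝓘(ℝ, E) F (t, s) ((0, 1) : ℝ × ℝ)) := by
    refine isPreconnected_Ioo.induction₂ (fun t t' ↦
      (S.g.inner (F (t, s)) (mfderiv 𝓘(ℝ, ℝ × ℝ) 𝓘(ℝ, E) F (t, s) ((0, 1) : ℝ × ℝ))
        (mfderiv 𝓘(ℝ, ℝ × ℝ) 𝓘(ℝ, E) F (t, s) ((0, 1) : ℝ × ℝ)) =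
      S.g.inner (F (t', s)) (mfderiv 𝓘(ℝ, ℝ × ℝ) 𝓘(ℝ, E) F (t', s) ((0, 1) : ℝ × ℝ))
        (mfderiv 𝓘(ℝ, ℝ × ℝ) 𝓘(ℝ, E) F (t', s) ((0, 1) : ℝ × ℝ))) ∧
      S.η (F (t, s)) (mfderiv 𝓘(ℝ, ℝ × ℝ) 𝓘(ℝ, E) F (t, s) ((0, 1) : ℝ × ℝ)) =
      S.η (F (t', s)) (mfderiv 𝓘(ℝ, ℝ × ℝ) 𝓘(ℝ, E) F (t', s) ((0, 1) : ℝ × ℝ)))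
      (fun r hr ↦ ?_) (fun r₁ r₂ r₃ _ _ _ h1 h2 ↦ ⟨h1.1.trans h2.1, h1.2.trans h2.2⟩)
      (fun r₁ r₂ _ _ h1 ↦ ⟨h1.1.symm, h1.2.symm⟩) h0 hq.1
    exact (hF.eventually_inner_eq hS ⟨hr, hq.2⟩).filter_mono nhdsWithin_le_nhds
  have hγF : ∀ r ∈ Ioo a b, γ r = F (0, r) := fun r hr ↦ (h 0 h0 r hr).zero_eq
  have hd0 := mfderiv_slice_snd ((hF.contMDiffAt (q := (0, s)) ⟨h0, hq.2⟩).mdifferentiableAt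
    (by simp)) (eventually_of_mem (isOpen_Ioo.mem_nhds hq.2) hγF)
  -- `γ s` and `F (0, s)` are only propositionally equal, so the velocity vectors lie in different
  -- types and are compared in the model space.
  have hleg : ∀ (y y' : N) (e : y = y') (v : TangentSpace 𝓘(ℝ, E) y)
      (v' : TangentSpace 𝓘(ℝ, E) y') (_ : (v : E) = v'),
      S.η y v = 0 ∧ S.g.inner y v v = 1 → S.η y' v' = 0 ∧ S.g.inner y' v' v' = 1 := by
    rintro y _ rfl v _ rfl h
    exact h
  have hleg' := hleg _ _ (hγF s hq.2) _ _ hd0 (hγ.2 s hq.2)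
  rw [key.1, key.2] at hleg'
  intro u v
  have hu : ∀ u : ℝ × ℝ, u = u.1 • ((1, 0) : ℝ × ℝ) + u.2 • ((0, 1) : ℝ × ℝ) := by
    intro u; ext <;> simp
  have hD : ∀ u : ℝ × ℝ, mfderiv 𝓘(ℝ, ℝ × ℝ) 𝓘(ℝ, E) F (t, s) u = u.1 • S.ξ (F (t, s))
      + u.2 • mfderiv 𝓘(ℝ, ℝ × ℝ) 𝓘(ℝ, E) F (t, s) ((0, 1) : ℝ × ℝ) := by
    intro u
    rw [← hF.mfderiv_fst _ hq]
    conv_lhs => rw [hu u]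
    exact (map_add (mfderiv 𝓘(ℝ, ℝ × ℝ) 𝓘(ℝ, E) F (t, s)) _ _).trans
      (congrArg₂ _ (map_smul _ _ _) (map_smul _ _ _))
  change S.g.inner (F (t, s)) _ _ = _
  rw [hD u, hD v]
  generalize mfderiv 𝓘(ℝ, ℝ × ℝ) 𝓘(ℝ, E) F (t, s) ((0, 1) : ℝ × ℝ) = w at hleg'
  have s1 : S.g.inner (F (t, s)) w (S.ξ (F (t, s))) = 0 := by
    rw [S.g.symm, hS.inner_ξ, hleg'.1]
  simp only [map_add, map_smul, _root_.add_apply, _root_.smul_apply, smul_eq_mul, hS.inner_ξ,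
    S.η_ξ, hleg'.1, hleg'.2, s1, planeForm_apply]
  ring

/-- Flows of proper-biharmonic Legendre curves are proper-biharmonic. -/
theorem isProperBiharmonicOn_of_isLocallyFlow [Nonempty M] (hS : S.IsSasakian)
    (hf : IsIsometricImmersion g S.g f) (hdim : Module.finrank ℝ E' = 2)
    (h : S.IsLocallyFlowOfProperBiharmonicLegendre 𝓘(ℝ, E') f) :
    IsProperBiharmonicOn g S.g f univ := by
  have key : ∀ p : M, bitensionField g S.g f p = 0 ∧ ∃ p', tensionField g S.g f p' ≠ 0 := by
    intro p
    obtain ⟨ε, a, b, γ, ψ, hleg, hbi, hsrc, hp, hψ, -, hflow⟩ := h p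
    have hpm : ψ.symm p ∈ Ioo (-ε) ε ×ˢ Ioo a b := by
      rw [← hsrc]; exact ψ.map_target hp
    -- The rectangle contains the coordinates of `p`, so it is not empty.
    have hε : 0 < ε := by linarith [hpm.1.1.trans hpm.1.2]
    rw [hsrc] at hψ
    have hP := isFlowParam_of_isFlowImage hS hf hε hleg hψ hflow
    have h0 : (0 : ℝ) ∈ Ioo (-ε) ε := ⟨by linarith, hε⟩
    have hc : ∀ s ∈ Ioo a b, _ := fun s hs ↦ hP.curve_iff hf hdim hS (t := 0) (γ := γ) ⟨h0, hs⟩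
      (eventually_of_mem (isOpen_Ioo.mem_nhds hs) fun r hr ↦ (hflow 0 h0 r hr).zero_eq)
    constructor
    · have h1 := (hc _ hpm.2).2.1 (hbi.2.1 _ hpm.2)
      have h2 := (hP.iff_of_mem hf hdim hS (a := -ε) (b := ε) (s := (ψ.symm p).2)
        (fun r hr ↦ ⟨hr, hpm.2⟩) h0 hpm.1).2.1 h1
      rwa [Prod.mk.eta, ψ.right_inv hp] at h2
    · by_contra! hall
      exact hbi.2.2 fun s hs ↦ (hc s hs).1.2 (hall _)
  refine ⟨hf.1.contMDiffOn, fun p _ ↦ (key p).1, fun hall ↦ ?_⟩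
  obtain ⟨p', hp'⟩ := (key (Classical.arbitrary M)).2
  exact hp' (hall p' (mem_univ _))

end Converse

/-! ### Strict differentiability of a local flow at time zero. -/

section LocalFlow

open Filter Topology Metric

variable {E : Type*} [NormedAddCommGroup E] [NormedSpace ℝ E] [CompleteSpace E]

/-- The local flow of a `C¹` vector field is strictly differentiable at `(0, x₀)`. -/
lemma exists_flow_hasStrictFDerivAt {v : E → E} {x₀ : E} (hv : ContDiffAt ℝ 1 v x₀) :
    ∃ α : ℝ × E → E, ∃ ε > 0, (∀ y ∈ ball x₀ ε, α (0, y) = y ∧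
        ∀ t ∈ Ioo (-ε) ε, HasDerivAt (fun r ↦ α (r, y)) (v (α (t, y))) t) ∧
      HasStrictFDerivAt α ((ContinuousLinearMap.fst ℝ ℝ E).smulRight (v x₀)
        + ContinuousLinearMap.snd ℝ ℝ E) (0, x₀) := by
  obtain ⟨ε, hε, a, r, L, K', hr, hpl⟩ := IsPicardLindelof.of_contDiffAt_one hv
  obtain ⟨α, hα, L', hL'⟩ :=
    (hpl 0).exists_forall_mem_closedBall_eq_hasDerivWithinAt_lipschitzOnWith
  simp only [zero_sub, zero_add] at hα hL'
  have hr' : (0 : ℝ) < r := hr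
  have hd : ∀ y ∈ closedBall x₀ (r : ℝ), ∀ t ∈ Ioo (-ε) ε, HasDerivAt (α y) (v (α y t)) t :=
    fun y hy t ht ↦ ((hα y hy).2 t (Ioo_subset_Icc_self ht)).hasDerivAt (Icc_mem_nhds ht.1 ht.2)
  -- Orbits of nearby points stay near `x₀` for a short time: the orbit of `x₀` is continuous, and
  -- the flow is Lipschitz in the starting point uniformly in time.
  have hcont : ∀ ρ > 0, ∃ δ > 0, δ ≤ ε ∧ δ ≤ r ∧ ∀ y ∈ ball x₀ δ, ∀ t ∈ Ioo (-δ) δ,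
      α y t ∈ ball x₀ ρ := by
    intro ρ hρ
    have h0 : x₀ ∈ closedBall x₀ (r : ℝ) := mem_closedBall_self hr'.le
    have hc : ContinuousAt (α x₀) 0 := (hd x₀ h0 0 ⟨by linarith, hε⟩).continuousAt
    rw [Metric.continuousAt_iff] at hc
    obtain ⟨δ₁, hδ₁, hδ₁'⟩ := hc (ρ / 2) (by linarith)
    have hL0 : (0 : ℝ) < L' + 1 := by positivity
    refine ⟨min (min ε r) (min δ₁ (ρ / 2 / (L' + 1))), by positivity, ?_, ?_, ?_⟩
    · exact (min_le_left _ _).trans (min_le_left _ _)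
    · exact (min_le_left _ _).trans (min_le_right _ _)
    · intro y hy t ht
      rw [mem_ball, lt_min_iff, lt_min_iff, lt_min_iff] at hy
      obtain ⟨⟨hy1, hy2⟩, hy3, hy4⟩ := hy
      have ht' := abs_lt.2 ht
      rw [lt_min_iff, lt_min_iff, lt_min_iff] at ht'
      obtain ⟨⟨ht1, ht2⟩, ht3, ht4⟩ := ht'
      have e1 := (hL' t (Ioo_subset_Icc_self (abs_lt.1 ht1))).dist_le_mul y
        (mem_closedBall.2 hy2.le) x₀ h0
      have e2 := hδ₁' (x := t) (by rwa [Real.dist_eq, sub_zero])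
      rw [(hα x₀ h0).1] at e2
      have e3 : (L' : ℝ) * dist y x₀ ≤ ρ / 2 := by
        rw [lt_div_iff₀ hL0] at hy4
        nlinarith [dist_nonneg (x := y) (y := x₀)]
      rw [mem_ball]
      linarith [dist_triangle (α y t) (α x₀ t) x₀]
  refine ⟨fun p ↦ α p.2 p.1, min ε r, by positivity, fun y hy ↦ ?_, ?_⟩
  · have hy' := ball_subset_closedBall (ball_subset_ball (min_le_right _ _) hy)
    exact ⟨(hα y hy').1, fun t ht ↦ hd y hy' t
      ⟨by linarith [ht.1, min_le_left ε (r : ℝ)], ht.2.trans_le (min_le_left _ _)⟩⟩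
  refine HasStrictFDerivAt.of_isLittleO ?_
  rw [Asymptotics.isLittleO_iff]
  intro c hc
  obtain ⟨K, s, hs, hK⟩ := hv.exists_lipschitzOnWith
  have hvc : ∀ᶠ y in 𝓝 x₀, dist (v y) (v x₀) < c / 2 :=
    hv.continuousAt.eventually (Metric.ball_mem_nhds _ (by linarith))
  obtain ⟨ρ, hρ, hρs⟩ := Metric.mem_nhds_iff.1 (inter_mem hs hvc)
  obtain ⟨δ, hδ, hδε, hδr, hδα⟩ := hcont ρ hρ
  set C : ℝ := K * L' with hC
  have hC0 : 0 ≤ C := by positivity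
  -- Chosen so that `C * |t'| ≤ c / 2`; the time and space increments then each take half of the
  -- allowed error `c`.
  set δ' := min δ (c / 2 / (C + 1)) with hδ'
  have hδ'0 : 0 < δ' := by positivity
  have hnear : ∀ᶠ p : ℝ × E in 𝓝 (0, x₀), p.1 ∈ Ioo (-δ') δ' ∧ p.2 ∈ ball x₀ δ' :=
    (continuous_fst.continuousAt.eventually (Ioo_mem_nhds (by simpa using hδ'0) hδ'0)).and
      (continuous_snd.continuousAt.eventually (Metric.ball_mem_nhds _ hδ'0))
  have hnear2 := hnear.prod_nhds hnear
  have hsub : Ioo (-δ') δ' ⊆ Ioo (-δ) δ := by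
    have : δ' ≤ δ := min_le_left _ _
    exact Ioo_subset_Ioo (by linarith) this
  filter_upwards [hnear2] with p hp
  obtain ⟨⟨t, y⟩, ⟨t', y'⟩⟩ := p
  obtain ⟨⟨ht, hy⟩, ht', hy'⟩ := hp
  have hyδ : ∀ z ∈ ball x₀ δ', z ∈ ball x₀ δ := fun z hz ↦ ball_subset_ball (min_le_left _ _) hz
  have hyr : ∀ z ∈ ball x₀ δ', z ∈ closedBall x₀ (r : ℝ) := fun z hz ↦
    ball_subset_closedBall (ball_subset_ball hδr (hyδ z hz))
  have hε' : ∀ τ ∈ Ioo (-δ') δ', τ ∈ Ioo (-ε) ε := fun τ hτ ↦ by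
    have := hsub hτ
    exact ⟨by linarith [this.1], by linarith [this.2]⟩
  have hin : ∀ z ∈ ball x₀ δ', ∀ τ ∈ Ioo (-δ') δ', α z τ ∈ s ∧ dist (v (α z τ)) (v x₀) < c / 2 :=
    fun z hz τ hτ ↦ hρs (hδα z (hyδ z hz) τ (hsub hτ))
  -- Increment in time with the starting point fixed: the derivative `v (α y τ) - v x₀` has norm at
  -- most `c / 2`.
  have e1 : ‖(α y t - t • v x₀) - (α y t' - t' • v x₀)‖ ≤ c / 2 * ‖t - t'‖ := by
    refine (convex_Ioo (-δ') δ').norm_image_sub_le_of_norm_hasDerivWithin_le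
      (f := fun τ ↦ α y τ - τ • v x₀) (f' := fun τ ↦ v (α y τ) - v x₀) (fun τ hτ ↦ ?_)
      (fun τ hτ ↦ ?_) ht' ht
    · have := (hd y (hyr y hy) τ (hε' τ hτ)).sub ((hasDerivAt_id τ).smul_const (v x₀))
      rw [one_smul] at this
      exact this.hasDerivWithinAt
    · rw [← dist_eq_norm]
      exact (hin y hy τ hτ).2.le
  -- Increment in the starting point: the difference of two orbits has derivative at most `K * L' *
  -- ‖y - y'‖`, and at time `0` it equals `y - y'`.
  have e2 : ‖(α y t' - α y' t') - (α y 0 - α y' 0)‖ ≤ C * ‖y - y'‖ * ‖t' - 0‖ := by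
    refine (convex_Ioo (-δ') δ').norm_image_sub_le_of_norm_hasDerivWithin_le
      (f := fun τ ↦ α y τ - α y' τ) (f' := fun τ ↦ v (α y τ) - v (α y' τ)) (fun τ hτ ↦ ?_)
      (fun τ hτ ↦ ?_) ⟨by linarith, hδ'0⟩ ht'
    · exact ((hd y (hyr y hy) τ (hε' τ hτ)).sub (hd y' (hyr y' hy') τ (hε' τ hτ))).hasDerivWithinAt
    · have k1 := hK.dist_le_mul _ (hin y hy τ hτ).1 _ (hin y' hy' τ hτ).1
      have k2 := (hL' τ (Ioo_subset_Icc_self (hε' τ hτ))).dist_le_mul y (hyr y hy) y' (hyr y' hy')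
      rw [dist_eq_norm] at k1
      rw [dist_eq_norm y] at k2
      calc _ ≤ _ := k1
        _ ≤ K * (L' * ‖y - y'‖) := by gcongr
        _ = _ := by rw [hC]; ring
  rw [(hα y (hyr y hy)).1, (hα y' (hyr y' hy')).1, sub_zero] at e2
  have e3 : C * ‖y - y'‖ * ‖t'‖ ≤ c / 2 * ‖y - y'‖ := by
    have h1 : ‖t'‖ ≤ c / 2 / (C + 1) := by
      rw [Real.norm_eq_abs]; exact (abs_lt.2 ht').le.trans (min_le_right _ _)
    rw [le_div_iff₀ (by positivity)] at h1
    have h2 : C * ‖t'‖ ≤ c / 2 := by nlinarith [norm_nonneg t']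
    nlinarith [norm_nonneg (y - y')]
  have e4 : α y t - α y' t' - (((ContinuousLinearMap.fst ℝ ℝ E).smulRight (v x₀)
        + ContinuousLinearMap.snd ℝ ℝ E) ((t, y) - (t', y'))) =
      ((α y t - t • v x₀) - (α y t' - t' • v x₀)) + ((α y t' - α y' t') - (y - y')) := by
    simp [sub_smul]
    abel
  have f1 : ‖t - t'‖ ≤ ‖((t, y) - (t', y') : ℝ × E)‖ := norm_fst_le ((t, y) - (t', y') : ℝ × E)
  have f2 : ‖y - y'‖ ≤ ‖((t, y) - (t', y') : ℝ × E)‖ := norm_snd_le ((t, y) - (t', y') : ℝ × E)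
  change ‖α y t - α y' t' - _‖ ≤ c * ‖((t, y) - (t', y') : ℝ × E)‖
  rw [e4]
  refine (norm_add_le _ _).trans ?_
  nlinarith

end LocalFlow

/-! ### An immersion with flow-invariant image is tangent to the field. -/

section Tangency

open Filter Topology Metric

variable {E : Type*} [NormedAddCommGroup E] [NormedSpace ℝ E] [FiniteDimensional ℝ E]
  {N : Type*} [TopologicalSpace N] [ChartedSpace E N] [IsManifold 𝓘(ℝ, E) ∞ N]
  {E' : Type*} [NormedAddCommGroup E'] [NormedSpace ℝ E'] [FiniteDimensional ℝ E']
  {M : Type*} [TopologicalSpace M] [ChartedSpace E' M] [IsManifold 𝓘(ℝ, E') ∞ M]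
  {F : Type*} [NormedAddCommGroup F] [NormedSpace ℝ F]
  {ξ : Π x : N, TangentSpace 𝓘(ℝ, E) x}

/-- The image of a smooth map has at most the dimension of its source. -/
lemma dimH_image_le_finrank [SecondCountableTopology M] {h : M → F} {W : Set M}
    (hh : ∀ p ∈ W, ContMDiffAt 𝓘(ℝ, E') 𝓘(ℝ, F) ∞ h p) :
    dimH (h '' W) ≤ Module.finrank ℝ E' := by
  have key : ∀ p ∈ W, ∃ V ∈ 𝓝[W] p, dimH (h '' V) ≤ Module.finrank ℝ E' := by
    intro p hp
    have hpm := mem_chart_source E' p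
    have h1 := (contMDiffAt_iff_contDiffAt_comp_symm hpm).1 (hh p hp)
    have h2 : ∀ᶠ z in 𝓝 (extChartAt 𝓘(ℝ, E') p p),
        ContDiffAt ℝ 1 (h ∘ (extChartAt 𝓘(ℝ, E') p).symm) z :=
      (h1.of_le (m := 1) (by simp)).eventually (by simp)
    obtain ⟨r, hr, hB⟩ := Metric.mem_nhds_iff.1
      (h2.and ((isOpen_extChartAt_target p).mem_nhds (extChartAt_mem_target hpm)))
    refine ⟨(chartAt E' p).source ∩ extChartAt 𝓘(ℝ, E') p ⁻¹'
      ball (extChartAt 𝓘(ℝ, E') p p) r, mem_nhdsWithin_of_mem_nhds (inter_mem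
        ((chartAt E' p).open_source.mem_nhds hpm) ?_), ?_⟩
    · exact (contMDiffAt_extChartAt_of_mem hpm).continuousAt (ball_mem_nhds _ hr)
    · have hsub : h '' ((chartAt E' p).source ∩ extChartAt 𝓘(ℝ, E') p ⁻¹'
          ball (extChartAt 𝓘(ℝ, E') p p) r) ⊆
          (h ∘ (extChartAt 𝓘(ℝ, E') p).symm) '' ball (extChartAt 𝓘(ℝ, E') p p) r := by
        rintro _ ⟨q, ⟨hq, hq'⟩, rfl⟩
        exact ⟨_, hq', by rw [Function.comp_apply, extChartAt_symm_apply hq]⟩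
      have hC : ContDiffOn ℝ 1 (h ∘ (extChartAt 𝓘(ℝ, E') p).symm)
          (ball (extChartAt 𝓘(ℝ, E') p p) r) := fun z hz ↦ (hB hz).1.contDiffWithinAt
      calc dimH _ ≤ _ := dimH_mono hsub
        _ ≤ dimH (ball (extChartAt 𝓘(ℝ, E') p p) r) :=
          hC.dimH_image_le (convex_ball _ _) Subset.rfl
        _ ≤ dimH (univ : Set E') := dimH_mono (subset_univ _)
        _ = _ := Real.dimH_univ_eq_finrank E'
  choose! V hV hVd using key
  -- Second countability: countably many of the local pieces cover `W`, and the dimension of a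
  -- countable union is the supremum.
  obtain ⟨t, ht, htc, hW⟩ := TopologicalSpace.countable_cover_nhdsWithin hV
  calc dimH (h '' W) ≤ dimH (⋃ p ∈ t, h '' V p) := by
        refine dimH_mono ?_
        rintro _ ⟨q, hq, rfl⟩
        obtain ⟨p, hp, hqp⟩ := mem_iUnion₂.1 (hW hq)
        exact mem_iUnion₂.2 ⟨p, hp, q, hqp, rfl⟩
    _ ≤ _ := by
      rw [dimH_bUnion htc]
      exact iSup₂_le fun p hp ↦ hVd p (ht hp)

/-- Integral curves in a chart. -/
lemma isMIntegralCurveOn_symm {x : N} {σ : ℝ → E} {s : Set ℝ}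
    (h : ∀ t ∈ s, HasDerivAt σ (fieldRep x ξ (σ t)) t)
    (hs : ∀ t ∈ s, σ t ∈ (extChartAt 𝓘(ℝ, E) x).target) :
    IsMIntegralCurveOn (fun t ↦ (extChartAt 𝓘(ℝ, E) x).symm (σ t)) ξ s := by
  intro t ht
  have hz := hs t ht
  have h1 := ((contMDiffAt_extChartAt_symm_of_mem hz).mdifferentiableAt (by simp)).hasMFDerivAt
  have h2 := HasMFDerivAt.comp (f := σ) t h1 (h t ht).hasFDerivAt.hasMFDerivAt
  refine HasMFDerivAt.hasMFDerivWithinAt ?_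
  let w : E := fieldRep x ξ (σ t)
  have h3 : mfderiv 𝓘(ℝ, E) 𝓘(ℝ, E) (extChartAt 𝓘(ℝ, E) x).symm (σ t) w =
      ξ ((extChartAt 𝓘(ℝ, E) x).symm (σ t)) :=
    toChart_injective (extChartAt_symm_mem hz) (toChart_mfderiv_symm hz _)
  let D : ℝ →L[ℝ] E := ContinuousLinearMap.toSpanSingleton ℝ w
  have e : (1 : ℝ →L[ℝ] ℝ).smulRight (ξ ((extChartAt 𝓘(ℝ, E) x).symm (σ t))) =
      (mfderiv 𝓘(ℝ, E) 𝓘(ℝ, E) (extChartAt 𝓘(ℝ, E) x).symm (σ t)).comp D := by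
    refine ContinuousLinearMap.ext_ring ?_
    refine (one_smul ℝ _).trans (h3.symm.trans ?_)
    exact congrArg (mfderiv 𝓘(ℝ, E) 𝓘(ℝ, E) (extChartAt 𝓘(ℝ, E) x).symm (σ t))
      (one_smul ℝ w).symm
  rw [e]
  exact h2

/-- A vector field whose flow preserves the image of an immersion is tangent to it. -/
theorem mem_range_mfderiv_of_isFlowInvariant [SecondCountableTopology M] {f : M → N}
    (hf : ContMDiff 𝓘(ℝ, E') 𝓘(ℝ, E) ∞ f)
    (hξ : ContMDiff 𝓘(ℝ, E) (𝓘(ℝ, E).prod 𝓘(ℝ, E)) ∞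
      (fun x ↦ TotalSpace.mk' E (E := fun x : N ↦ TangentSpace 𝓘(ℝ, E) x) x (ξ x)))
    (hinv : IsFlowInvariant ξ (range f)) {p : M}
    (hp : Function.Injective (mfderiv 𝓘(ℝ, E') 𝓘(ℝ, E) f p)) :
    ∃ w, mfderiv 𝓘(ℝ, E') 𝓘(ℝ, E) f p w = ξ (f p) := by
  by_contra! hne
  set x := f p with hx
  have hxm : f p ∈ (chartAt E x).source := mem_chart_source E x
  have hpm := mem_chart_source E' p
  set z₀ := extChartAt 𝓘(ℝ, E') p p with hz₀
  set y := repMap E E' p x f with hy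
  set v := fieldRep x ξ with hv
  have cy : ContDiffAt ℝ ∞ y z₀ := (hf p).repMap hpm hxm
  have y0 : y z₀ = extChartAt 𝓘(ℝ, E) x x := repMap_apply hpm
  set A := fderiv ℝ y z₀ with hA
  have hAd : ∀ u, toChart 𝓘(ℝ, E) x (f p) (mfderiv 𝓘(ℝ, E') 𝓘(ℝ, E) f p u) =
      A (toChart 𝓘(ℝ, E') p p u) := toChart_mfderiv (hf p) hpm hxm
  have cv : ContDiffAt ℝ ∞ v (y z₀) := by
    rw [y0]; exact (contMDiffAt_section_iff_fieldRep hxm).1 (hξ x)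
  have v0 : v (y z₀) = toChart 𝓘(ℝ, E) x x (ξ x) := by
    rw [y0]; exact fieldRep_apply hxm ξ
  have hvA : ∀ u, A u ≠ v (y z₀) := by
    intro u hu
    refine hne (ofChart 𝓘(ℝ, E') p p u) (toChart_injective hxm ?_)
    rw [hAd, toChart_ofChart hpm, hu, v0]
  have hAinj : Function.Injective A := by
    rw [injective_iff_map_eq_zero]
    intro u hu
    have h1 := hAd (ofChart 𝓘(ℝ, E') p p u)
    rw [toChart_ofChart hpm, hu] at h1
    have h2 : mfderiv 𝓘(ℝ, E') 𝓘(ℝ, E) f p (ofChart 𝓘(ℝ, E') p p u) = 0 :=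
      toChart_injective hxm (h1.trans (map_zero _).symm)
    have h3 : ofChart 𝓘(ℝ, E') p p u = 0 := hp (h2.trans (map_zero _).symm)
    rw [← toChart_ofChart hpm u, h3]
    exact map_zero _
  obtain ⟨α, ε, hε, hα, hαd⟩ := exists_flow_hasStrictFDerivAt (cv.of_le (m := 1) (by simp))
  -- The derivative at `(0, z₀)` of `(t, z) ↦ α (t, y z)`, which flows the surface. It is injective
  -- because `ξ` is assumed not tangent.
  let T : ℝ × E' →L[ℝ] E := (ContinuousLinearMap.fst ℝ ℝ E').smulRight (v (y z₀))
    + A.comp (ContinuousLinearMap.snd ℝ ℝ E')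
  have hT : Function.Injective T := by
    rw [injective_iff_map_eq_zero]
    rintro ⟨t, u⟩ h
    have h' : t • v (y z₀) + A u = 0 := h
    by_cases ht : t = 0
    · rw [ht, zero_smul, zero_add] at h'
      rw [ht, hAinj (h'.trans (map_zero A).symm)]
      rfl
    · exfalso
      refine hvA (-(t⁻¹ • u)) ?_
      rw [map_neg, map_smul, eq_neg_of_add_eq_zero_right h', smul_neg, neg_neg, smul_smul,
        inv_mul_cancel₀ ht, one_smul]
  -- Composing with a left inverse of `T` gives a map between spaces of equal dimension whose strict
  -- derivative at one point is the identity; this suffices for it to cover a neighbourhood.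
  obtain ⟨L₀, hL₀⟩ := T.toLinearMap.exists_leftInverse_of_injective (LinearMap.ker_eq_bot.2 hT)
  let L : E →L[ℝ] ℝ × E' := LinearMap.toContinuousLinearMap L₀
  have hLT : L.comp T = ContinuousLinearMap.id ℝ (ℝ × E') := by
    refine ContinuousLinearMap.ext fun q ↦ ?_
    exact LinearMap.congr_fun hL₀ q
  let P : ℝ × E' → ℝ × E' := fun q ↦ L (α (q.1, y q.2))
  have hP : HasStrictFDerivAt P (L.comp T) (0, z₀) := by
    have hy' : HasStrictFDerivAt y A z₀ := cy.hasStrictFDerivAt (by simp)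
    have h1 : HasStrictFDerivAt (fun q : ℝ × E' ↦ (q.1, y q.2))
        ((ContinuousLinearMap.fst ℝ ℝ E').prod (A.comp (ContinuousLinearMap.snd ℝ ℝ E')))
        (0, z₀) :=
      hasStrictFDerivAt_fst.prodMk (HasStrictFDerivAt.comp (f := Prod.snd) (0, z₀) hy'
        hasStrictFDerivAt_snd)
    exact L.hasStrictFDerivAt.comp (0, z₀)
      (HasStrictFDerivAt.comp (f := fun q : ℝ × E' ↦ (q.1, y q.2)) (0, z₀) hαd h1)
  have hmap : map P (𝓝 (0, z₀)) = 𝓝 (P (0, z₀)) := by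
    refine hP.map_nhds_eq_of_surj ?_
    rw [hLT]
    exact LinearMap.range_id
  have htar : α (0, y z₀) ∈ (extChartAt 𝓘(ℝ, E) x).target := by
    rw [(hα _ (mem_ball_self hε)).1, y0]
    exact extChartAt_mem_target hxm
  have hev := hαd.continuousAt.eventually ((isOpen_extChartAt_target x).eventually_mem htar)
  obtain ⟨δ, hδ, hδt⟩ := Metric.eventually_nhds_iff_ball.1 hev
  set δ' := min δ ε with hδ'
  have hδ'0 : 0 < δ' := lt_min hδ hε
  let U : Set (ℝ × E') := {q | q.1 ∈ Ioo (-δ') δ' ∧ y q.2 ∈ ball (y z₀) δ' ∧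
    (q.2 ∈ (extChartAt 𝓘(ℝ, E') p).target ∧
      f ((extChartAt 𝓘(ℝ, E') p).symm q.2) ∈ (chartAt E x).source)}
  have hU : U ∈ 𝓝 ((0 : ℝ), z₀) := by
    refine Filter.Eventually.and ?_ (Filter.Eventually.and ?_ ?_)
    · exact continuous_fst.continuousAt.eventually (Ioo_mem_nhds (by simpa using hδ'0) hδ'0)
    · exact (ContinuousAt.comp (f := Prod.snd) (x := ((0 : ℝ), z₀)) cy.continuousAt
        continuous_snd.continuousAt).eventually (ball_mem_nhds _ hδ'0)
    · exact (continuous_snd.tendsto ((0 : ℝ), z₀)).eventually (eventually_mem_of_contMDiffAt (hf p) hpm hxm)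
  have hPU : P '' U ∈ 𝓝 (P (0, z₀)) := by rw [← hmap]; exact image_mem_map hU
  have hdim := Real.dimH_of_mem_nhds hPU
  -- By invariance the flowed points still lie in the image of `f`. Their projection by `L` has
  -- dimension at most that of `M`, yet contains an open set of `ℝ × E'`. The argument uses only the
  -- size of the image, since `f` may be non-injective or have dense image.
  have hsub : P '' U ⊆ (fun m ↦ L (extChartAt 𝓘(ℝ, E) x (f m))) '' (f ⁻¹' (chartAt E x).source) := by
    rintro _ ⟨⟨t, z⟩, ⟨ht, hyz, hz, hzx⟩, rfl⟩
    have hyz' : y z ∈ ball (y z₀) ε := ball_subset_ball (min_le_right _ _) hyz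
    have hmem : ∀ τ ∈ Ioo (-δ') δ', α (τ, y z) ∈ (extChartAt 𝓘(ℝ, E) x).target := by
      intro τ hτ
      refine hδt _ ?_
      rw [← ball_prod_same]
      refine ⟨?_, ball_subset_ball (min_le_left _ _) hyz⟩
      rw [mem_ball, Real.dist_eq, sub_zero]
      exact (abs_lt.2 hτ).trans_le (min_le_left _ _)
    have hder : ∀ τ ∈ Ioo (-δ') δ', HasDerivAt (fun r ↦ α (r, y z)) (v (α (τ, y z))) τ := by
      intro τ hτ
      refine (hα _ hyz').2 τ ⟨?_, hτ.2.trans_le (min_le_right _ _)⟩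
      have := min_le_right δ ε
      linarith [hτ.1]
    have hflow : IsFlowImage ξ t (f ((extChartAt 𝓘(ℝ, E') p).symm z))
        ((extChartAt 𝓘(ℝ, E) x).symm (α (t, y z))) := by
      refine ⟨-δ', δ', fun τ ↦ (extChartAt 𝓘(ℝ, E) x).symm (α (τ, y z)), ⟨by linarith, hδ'0⟩, ht,
        isMIntegralCurveOn_symm hder hmem, ?_, rfl⟩
      refine (congrArg (extChartAt 𝓘(ℝ, E) x).symm (hα _ hyz').1).trans ?_
      exact extChartAt_symm_apply hzx
    obtain ⟨m, hm⟩ := hinv _ _ _ hflow ⟨_, rfl⟩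
    refine ⟨m, ?_, ?_⟩
    · rw [mem_preimage, hm]
      exact extChartAt_symm_mem (hmem t ht)
    · simp only [hm]
      rw [(extChartAt 𝓘(ℝ, E) x).right_inv (hmem t ht)]
  have hle : dimH ((fun m ↦ L (extChartAt 𝓘(ℝ, E) x (f m))) '' (f ⁻¹' (chartAt E x).source)) ≤
      Module.finrank ℝ E' := by
    refine dimH_image_le_finrank fun m hm ↦ ?_
    exact L.contDiff.contMDiff.contMDiffAt.comp m
      ((contMDiffAt_extChartAt_of_mem hm).comp m (hf m))
  have hfin := hdim.symm.le.trans ((dimH_mono hsub).trans hle)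
  rw [Module.finrank_prod, Module.finrank_self] at hfin
  have : (1 + Module.finrank ℝ E' : ℕ) ≤ Module.finrank ℝ E' := by exact_mod_cast hfin
  omega

end Tangency

/-! ### Flat coordinates on a surface with a closed unit Killing field. -/

section FlatCoordinates

open Filter Topology Metric

variable {V : Type*} [NormedAddCommGroup V] [NormedSpace ℝ V] [FiniteDimensional ℝ V]
  (hdim : Module.finrank ℝ V = 2)
include hdim

/-- Three vectors of a plane are dependent; as `w ≠ 0`, the coefficients of `a` and `b` cannot both
vanish. -/
lemma exists_smul_add_smul_add_smul_eq_zero (a b : V) {w : V} (hw : w ≠ 0) :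
    ∃ c₁ c₂ c₃ : ℝ, c₁ • a + c₂ • b + c₃ • w = 0 ∧ (c₁ ≠ 0 ∨ c₂ ≠ 0) := by
  have h : ¬ LinearIndependent ℝ ![a, b, w] := fun h ↦ by
    have := h.fintype_card_le_finrank
    rw [hdim] at this
    simp at this
  obtain ⟨c, hc, i, hi⟩ := Fintype.not_linearIndependent_iff.1 h
  rw [Fin.sum_univ_three] at hc
  simp only [Matrix.cons_val] at hc
  refine ⟨c 0, c 1, c 2, hc, ?_⟩
  by_contra! h0
  rw [h0.1, h0.2, zero_smul, zero_smul, zero_add, zero_add] at hc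
  have h2 := (smul_eq_zero.1 hc).resolve_right hw
  fin_cases i
  · exact hi h0.1
  · exact hi h0.2
  · exact hi h2

/-- A bilinear form on a plane is symmetric if some nonzero vector commutes with all others. -/
lemma apply_comm_of_finrank_two {B : V →L[ℝ] V →L[ℝ] ℝ} {w : V} (hw : w ≠ 0)
    (h : ∀ u, B w u = B u w) (a b : V) : B a b = B b a := by
  obtain ⟨c₁, c₂, c₃, hc, h0⟩ := exists_smul_add_smul_add_smul_eq_zero hdim a b hw
  have h1 : ∀ v, c₁ * B a v + c₂ * B b v + c₃ * B w v = 0 := fun v ↦ by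
    simpa using congrArg (fun x ↦ B x v) hc
  have h2 : ∀ v, c₁ * B v a + c₂ * B v b + c₃ * B v w = 0 := fun v ↦ by
    simpa using congrArg (fun x ↦ B v x) hc
  rcases h0 with h0 | h0
  · refine mul_left_cancel₀ h0 ?_
    linear_combination h1 b - h2 b - c₃ * h b
  · refine mul_left_cancel₀ h0 ?_
    linear_combination h2 a - h1 a + c₃ * h a

/-- A degenerate symmetric bilinear form on a plane has rank at most one. -/
lemma apply_mul_apply_of_finrank_two {P : V → V → ℝ} (hadd : ∀ a b v, P (a + b) v = P a v + P b v)
    (hsmul : ∀ (c : ℝ) a v, P (c • a) v = c * P a v) (hsymm : ∀ a b, P a b = P b a) {w : V}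
    (hw : w ≠ 0) (h : ∀ u, P w u = 0) (u v a : V) : P u v * P a a = P a u * P a v := by
  obtain ⟨c₁, c₂, c₃, hc, h0⟩ := exists_smul_add_smul_add_smul_eq_zero hdim u a hw
  have hz : ∀ v, P 0 v = 0 := fun v ↦ by simpa using hsmul 0 0 v
  have h1 : ∀ v, c₁ * P u v + c₂ * P a v = 0 := fun v ↦ by
    have := congrArg (fun x ↦ P x v) hc
    simp only [hadd, hsmul, h, hz] at this
    linarith
  have e := hsymm a u
  by_cases hc1 : c₁ = 0
  · have h2 : ∀ v, P a v = 0 := fun v ↦ by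
      have := h1 v
      rw [hc1, zero_mul, zero_add] at this
      exact (mul_eq_zero.1 this).resolve_left (h0.resolve_left fun h ↦ h hc1)
    rw [h2, h2]; simp
  · refine mul_left_cancel₀ hc1 ?_
    rw [e]
    linear_combination P a a * h1 v - P a v * h1 a

omit hdim in
lemma contDiffAt_of_hasFDerivAt {F : Type*} [NormedAddCommGroup F] [NormedSpace ℝ F] {s : Set V}
    (hs : IsOpen s) {Φ : V → F} {Φ' : V → V →L[ℝ] F} (h : ∀ z ∈ s, HasFDerivAt Φ (Φ' z) z)
    (hΦ : ∀ z ∈ s, ContDiffAt ℝ ∞ Φ' z) {z : V} (hz : z ∈ s) : ContDiffAt ℝ ∞ Φ z := by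
  have h1 : ContDiffOn ℝ ∞ Φ s := by
    rw [contDiffOn_infty_iff_fderiv_of_isOpen hs]
    refine ⟨fun z hz ↦ (h z hz).differentiableAt.differentiableWithinAt, fun z hz ↦ ?_⟩
    exact (hΦ z hz).contDiffWithinAt.congr (fun z hz ↦ (h z hz).fderiv) (h z hz).fderiv
  exact h1.contDiffAt (hs.mem_nhds hz)

/-- Two closed forms which are linearly independent are the differentials of coordinates. -/
lemma exists_coordinates_of_closed {s : Set V} (hs : IsOpen s) (hconv : Convex ℝ s)
    {θ κ : V → V →L[ℝ] ℝ} (cθ : ∀ z ∈ s, ContDiffAt ℝ ∞ θ z) (cκ : ∀ z ∈ s, ContDiffAt ℝ ∞ κ z)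
    (dθ : ∀ z ∈ s, ∀ u v, fderiv ℝ θ z u v = fderiv ℝ θ z v u)
    (dκ : ∀ z ∈ s, ∀ u v, fderiv ℝ κ z u v = fderiv ℝ κ z v u)
    (hi : ∀ z ∈ s, ∀ u, θ z u = 0 → κ z u = 0 → u = 0) {z₀ : V} (hz₀ : z₀ ∈ s) :
    ∃ e : OpenPartialHomeomorph V (ℝ × ℝ), z₀ ∈ e.source ∧ e.source ⊆ s ∧
      ContDiffOn ℝ ∞ e e.source ∧ ContDiffOn ℝ ∞ e.symm e.target ∧ (e z₀).1 = 0 ∧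
      ∀ z ∈ e.source, ∀ u, fderiv ℝ e z u = (θ z u, κ z u) := by
  -- Poincaré lemma on a convex set: both forms have primitives.
  obtain ⟨t, ht⟩ := hconv.exists_forall_hasFDerivAt_of_fderiv_symmetric hs
    (fun z hz ↦ (cθ z hz).differentiableAt_infty.differentiableWithinAt) dθ
  obtain ⟨σ, hσ⟩ := hconv.exists_forall_hasFDerivAt_of_fderiv_symmetric hs
    (fun z hz ↦ (cκ z hz).differentiableAt_infty.differentiableWithinAt) dκ
  let Φ : V → ℝ × ℝ := fun z ↦ (t z - t z₀, σ z)
  have hΦ : ∀ z ∈ s, HasFDerivAt Φ ((θ z).prod (κ z)) z := fun z hz ↦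
    ((ht z hz).sub_const _).prodMk (hσ z hz)
  have cΦ : ∀ z ∈ s, ContDiffAt ℝ ∞ Φ z := fun z hz ↦
    contDiffAt_of_hasFDerivAt hs hΦ (fun z hz ↦
      (ContinuousLinearMap.prodₗᵢ (𝕜 := ℝ) (E := V) (F := ℝ) (G := ℝ) ℝ).contDiff.contDiffAt.comp z ((cθ z hz).prodMk (cκ z hz))) hz
  have hinv : ∀ z ∈ s, ∃ L : V ≃L[ℝ] ℝ × ℝ, (L : V →L[ℝ] ℝ × ℝ) = (θ z).prod (κ z) := by
    intro z hz
    have hinj : Function.Injective ((θ z).prod (κ z)).toLinearMap := by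
      rw [← LinearMap.ker_eq_bot, LinearMap.ker_eq_bot']
      intro u hu
      have h1 : (θ z u, κ z u) = (0, 0) := hu
      exact hi z hz u (congrArg Prod.fst h1) (congrArg Prod.snd h1)
    exact ⟨(LinearEquiv.ofInjectiveOfFinrankEq _ hinj (by simp [hdim])).toContinuousLinearEquiv,
      by ext <;> rfl⟩
  obtain ⟨L, hL⟩ := hinv z₀ hz₀
  let e₀ := (cΦ z₀ hz₀).toOpenPartialHomeomorph Φ (f' := L) (by rw [hL]; exact hΦ z₀ hz₀) (by simp)
  have he₀ : z₀ ∈ e₀.source := ContDiffAt.mem_toOpenPartialHomeomorph_source _ _ _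
  have hsrc : (e₀.restrOpen s hs).source = e₀.source ∩ s := e₀.restrOpen_source s hs
  have hsub : ∀ z ∈ (e₀.restrOpen s hs).source, z ∈ s := fun z hz ↦ (hsrc ▸ hz).2
  refine ⟨e₀.restrOpen s hs, by rw [hsrc]; exact ⟨he₀, hz₀⟩, hsub,
    fun z hz ↦ (cΦ z (hsub z hz)).contDiffWithinAt, fun q hq ↦ ?_, ?_, fun z hz u ↦ ?_⟩
  · have hz := hsub _ ((e₀.restrOpen s hs).map_target hq)
    obtain ⟨L', hL'⟩ := hinv _ hz
    exact ((e₀.restrOpen s hs).contDiffAt_symm hq (f₀' := L') (by rw [hL']; exact hΦ _ hz)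
      (cΦ _ hz)).contDiffWithinAt
  · change t z₀ - t z₀ = 0
    ring
  · have : fderiv ℝ (e₀.restrOpen s hs) z = (θ z).prod (κ z) := (hΦ z (hsub z hz)).fderiv
    rw [this]
    rfl

/-- Flat coordinates on a surface with a closed unit Killing field. -/
theorem IsMetricOn.exists_flat_coordinates {G : V → V →L[ℝ] V →L[ℝ] ℝ} {Ω : Set V}
    (hG : IsMetricOn G Ω) {w : V → V} (cw : ∀ z ∈ Ω, ContDiffAt ℝ ∞ w z)
    (hw : ∀ z ∈ Ω, G z (w z) (w z) = 1)
    (hK : ∀ z ∈ Ω, ∀ u v, fderiv ℝ G z (w z) u v + G z (fderiv ℝ w z u) v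
      + G z u (fderiv ℝ w z v) = 0)
    (dθ : ∀ z ∈ Ω, ∀ u v, fderiv ℝ (fun z ↦ G z (w z)) z u v = fderiv ℝ (fun z ↦ G z (w z)) z v u)
    {z₀ : V} (hz₀ : z₀ ∈ Ω) :
    ∃ e : OpenPartialHomeomorph V (ℝ × ℝ), z₀ ∈ e.source ∧ e.source ⊆ Ω ∧
      ContDiffOn ℝ ∞ e e.source ∧ ContDiffOn ℝ ∞ e.symm e.target ∧ (e z₀).1 = 0 ∧
      ∀ z ∈ e.source, (∀ u v, G z u v = planeForm (fderiv ℝ e z u) (fderiv ℝ e z v)) ∧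
        fderiv ℝ e z (w z) = (1, 0) := by
  set θ : V → V →L[ℝ] ℝ := fun z ↦ G z (w z) with hθ
  have cG : ∀ z ∈ Ω, ContDiffAt ℝ ∞ G z := fun z hz ↦ hG.contDiffAt hz
  have cθ : ∀ z ∈ Ω, ContDiffAt ℝ ∞ θ z := fun z hz ↦ (cG z hz).clm_apply (cw z hz)
  have hw0 : ∀ z ∈ Ω, w z ≠ 0 := fun z hz h0 ↦ by simpa [h0] using hw z hz
  -- A vector orthogonal to `w z₀`, kept constant in the chart; nearby it need not be orthogonal to
  -- `w`, but it stays independent of it.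
  obtain ⟨a, ha0, ha⟩ : ∃ a, a ≠ 0 ∧ θ z₀ a = 0 := by
    by_contra! h
    have hinj : Function.Injective (θ z₀).toLinearMap := by
      rw [← LinearMap.ker_eq_bot, LinearMap.ker_eq_bot']
      intro u hu
      by_contra hu0
      exact h u hu0 hu
    have := LinearMap.finrank_le_finrank_of_injective hinj
    rw [hdim, Module.finrank_self] at this
    omega
  -- The metric on components orthogonal to `w`. It degenerates along `w`, so it has rank one and
  -- equals `κ²` for the form `κ` obtained by normalising `P(a, ·)`.
  let P : V → V → V → ℝ := fun z u v ↦ G z u v - θ z u * θ z v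
  have cP : ∀ z ∈ Ω, ContDiffAt ℝ ∞ (fun z ↦ P z a a) z := fun z hz ↦
    ((cG z hz).clm_apply₂ contDiffAt_const contDiffAt_const).sub
      (((cθ z hz).clm_apply contDiffAt_const).mul ((cθ z hz).clm_apply contDiffAt_const))
  have hP0 : 0 < P z₀ a a := by
    simp only [P, ha, mul_zero, sub_zero]
    exact hG.pos z₀ hz₀ a ha0
  obtain ⟨r, hr, hB⟩ := Metric.eventually_nhds_iff_ball.1
    ((hG.isOpen.eventually_mem hz₀).and ((cP z₀ hz₀).continuousAt.eventually (lt_mem_nhds hP0)))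
  let κ : V → V →L[ℝ] ℝ := fun z ↦ (√(P z a a))⁻¹ • (G z a - θ z a • θ z)
  have hκ : ∀ z u, κ z u = (√(P z a a))⁻¹ * P z a u := fun z u ↦ rfl
  have cκ : ∀ z ∈ ball z₀ r, ContDiffAt ℝ ∞ κ z := by
    intro z hz
    obtain ⟨hzΩ, hpos⟩ := hB z hz
    refine ContDiffAt.smul (𝕜 := ℝ) (f := fun z ↦ (√(P z a a))⁻¹) ?_ (((cG z hzΩ).clm_apply contDiffAt_const).sub
      (((cθ z hzΩ).clm_apply contDiffAt_const).smul (cθ z hzΩ)))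
    exact ((cP z hzΩ).sqrt hpos.ne').inv (Real.sqrt_pos.2 hpos).ne'
  have hPw : ∀ z ∈ Ω, ∀ u, P z (w z) u = 0 := by
    intro z hz u
    simp only [P, hθ, hw z hz, one_mul, sub_self]
  have hPs : ∀ z ∈ Ω, ∀ u v, P z u v = P z v u := by
    intro z hz u v
    simp only [P, hG.symm z hz u v, mul_comm]
  have hdec : ∀ z ∈ ball z₀ r, ∀ u v, G z u v = θ z u * θ z v + κ z u * κ z v := by
    intro z hz u v
    obtain ⟨hzΩ, hpos⟩ := hB z hz
    have h1 := apply_mul_apply_of_finrank_two hdim (P := P z) (fun a b v ↦ by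
      simp only [P, map_add, _root_.add_apply]; ring) (fun c a v ↦ by
      simp only [P, map_smul, _root_.smul_apply, smul_eq_mul]; ring) (hPs z hzΩ) (hw0 z hzΩ)
      (hPw z hzΩ) u v a
    have h2 := Real.sq_sqrt hpos.le
    have h3 := (Real.sqrt_pos.2 hpos).ne'
    have h4 : P z u v = κ z u * κ z v := by
      rw [hκ, hκ]
      field_simp
      rw [h2, mul_comm, mul_comm (P z a u)] at *
      linarith
    rw [← h4]
    simp only [P]
    ring
  have hκw : ∀ z ∈ ball z₀ r, κ z (w z) = 0 := by
    intro z hz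
    rw [hκ, hPs z (hB z hz).1 a (w z), hPw z (hB z hz).1, mul_zero]
  have hθw : ∀ z ∈ Ω, θ z (w z) = 1 := hw
  have hi : ∀ z ∈ ball z₀ r, ∀ u, θ z u = 0 → κ z u = 0 → u = 0 := by
    intro z hz u h1 h2
    by_contra hu
    have := hG.pos z (hB z hz).1 u hu
    rw [hdec z hz, h1, h2] at this
    simp at this
  have dκ : ∀ z ∈ ball z₀ r, ∀ u v, fderiv ℝ κ z u v = fderiv ℝ κ z v u := by
    intro z hz
    have hzΩ := (hB z hz).1
    have dG := (cG z hzΩ).differentiableAt_infty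
    have d1 := (cθ z hzΩ).differentiableAt_infty
    have d2 := (cκ z hz).differentiableAt_infty
    have dw := (cw z hzΩ).differentiableAt_infty
    have cc : ∀ u : V, DifferentiableAt ℝ (fun _ : V ↦ u) z := fun u ↦ differentiableAt_const u
    have k1 : ∀ u, fderiv ℝ κ z u (w z) = - κ z (fderiv ℝ w z u) := by
      intro u
      have e : (fun p ↦ κ p (w p)) =ᶠ[𝓝 z] fun _ ↦ 0 := by
        filter_upwards [isOpen_ball.mem_nhds hz] with p hp using hκw p hp
      have e1 := congrArg (fun L : V →L[ℝ] ℝ ↦ L u) e.fderiv_eq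
      rw [fderiv_clm_apply₁ d2 dw] at e1
      simp only [fderiv_fun_const, Pi.zero_apply, _root_.zero_apply] at e1
      exact eq_neg_of_add_eq_zero_left e1
    have k2 : ∀ u, fderiv ℝ θ z (w z) u + θ z (fderiv ℝ w z u) = 0 := by
      intro u
      have e : (fun p ↦ θ p (w p)) =ᶠ[𝓝 z] fun _ ↦ 1 := by
        filter_upwards [hG.isOpen.mem_nhds hzΩ] with p hp using hθw p hp
      have e1 := congrArg (fun L : V →L[ℝ] ℝ ↦ L u) e.fderiv_eq
      rw [fderiv_clm_apply₁ d1 dw] at e1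
      simp only [fderiv_fun_const, Pi.zero_apply, _root_.zero_apply] at e1
      rw [dθ z hzΩ]
      exact e1
    -- Since `w` preserves `G` and `θ`, it preserves `κ²`: with `λ` the Lie derivative of `κ` along
    -- `w`, this reads `λ(u) κ(v) + κ(u) λ(v) = 0`. Taking `u = v = a`, and then `v = a`, gives `λ =
    -- 0`.
    have k3 : ∀ u v, (fderiv ℝ κ z (w z) u + κ z (fderiv ℝ w z u)) * κ z v
        + κ z u * (fderiv ℝ κ z (w z) v + κ z (fderiv ℝ w z v)) = 0 := by
      intro u v
      have e : (fun p ↦ G p u v) =ᶠ[𝓝 z] fun p ↦ θ p u * θ p v + κ p u * κ p v := by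
        filter_upwards [isOpen_ball.mem_nhds hz] with p hp using hdec p hp u v
      have e1 := congrArg (fun L : V →L[ℝ] ℝ ↦ L (w z)) e.fderiv_eq
      have t1 := d1.clm_apply (cc u)
      have t2 := d1.clm_apply (cc v)
      have t3 := d2.clm_apply (cc u)
      have t4 := d2.clm_apply (cc v)
      rw [fderiv_clm_apply₂ dG (cc u) (cc v), fderiv_fun_add (t1.fun_mul t2) (t3.fun_mul t4),
        fderiv_fun_mul t1 t2, fderiv_fun_mul t3 t4] at e1
      simp only [_root_.add_apply, _root_.smul_apply, smul_eq_mul] at e1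
      rw [fderiv_clm_apply₁ d1 (cc u), fderiv_clm_apply₁ d1 (cc v), fderiv_clm_apply₁ d2 (cc u),
        fderiv_clm_apply₁ d2 (cc v)] at e1
      simp only [fderiv_fun_const, Pi.zero_apply, _root_.zero_apply, map_zero, add_zero] at e1
      have e2 := hK z hzΩ u v
      rw [hdec z hz (fderiv ℝ w z u) v, hdec z hz u (fderiv ℝ w z v)] at e2
      linear_combination e2 - e1 - θ z v * k2 u - θ z u * k2 v
    have hκa : κ z a ≠ 0 := by
      rw [hκ]
      have := (hB z hz).2
      have := Real.sqrt_pos.2 this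
      positivity
    have k4 : fderiv ℝ κ z (w z) a + κ z (fderiv ℝ w z a) = 0 := by
      have := k3 a a
      rw [mul_comm, ← mul_add] at this
      have := (mul_eq_zero.1 this).resolve_left hκa
      linarith
    have k5 : ∀ u, fderiv ℝ κ z (w z) u = fderiv ℝ κ z u (w z) := by
      intro u
      have := k3 u a
      rw [k4, mul_zero, add_zero] at this
      have := (mul_eq_zero.1 this).resolve_right hκa
      rw [k1]
      linarith
    -- `κ(w) = 0` and `λ = 0` give `dκ(w, ·) = 0`, which on a plane means `dκ = 0`.
    exact apply_comm_of_finrank_two hdim (hw0 z hzΩ) k5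
  obtain ⟨e, h1, h2, h3, h4, h5, h6⟩ := exists_coordinates_of_closed hdim isOpen_ball
    (convex_ball z₀ r) (fun z hz ↦ cθ z (hB z hz).1) cκ (fun z hz ↦ dθ z (hB z hz).1) dκ hi
    (mem_ball_self hr)
  refine ⟨e, h1, fun z hz ↦ (hB z (h2 hz)).1, h3, h4, h5, fun z hz ↦ ⟨fun u v ↦ ?_, ?_⟩⟩
  · rw [h6 z hz, h6 z hz, hdec z (h2 hz), planeForm_apply]
  · rw [h6 z hz, hκw z (h2 hz), hθw z (hB z (h2 hz)).1]

variable {E : Type*} [NormedAddCommGroup E] [NormedSpace ℝ E]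

/-- Flat coordinates on a surface tangent to the characteristic field of a Sasakian structure. -/
theorem IsSasakianOn.exists_flat_coordinates {φ : E → E →L[ℝ] E} {ξ : E → E} {η : E → E →L[ℝ] ℝ}
    {g : E → E →L[ℝ] E →L[ℝ] ℝ} {Ω' : Set E} (h : IsSasakianOn φ ξ η g Ω')
    {G : V → V →L[ℝ] V →L[ℝ] ℝ} {Ω : Set V} (hG : IsMetricOn G Ω) {y : V → E}
    (cy : ∀ z ∈ Ω, ContDiffAt ℝ ∞ y z) (hy : ∀ z ∈ Ω, y z ∈ Ω')
    (hpull : ∀ z ∈ Ω, ∀ u v, G z u v = g (y z) (fderiv ℝ y z u) (fderiv ℝ y z v))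
    (htan : ∀ z ∈ Ω, ∃ u, fderiv ℝ y z u = ξ (y z)) {z₀ : V} (hz₀ : z₀ ∈ Ω) :
    ∃ e : OpenPartialHomeomorph V (ℝ × ℝ), z₀ ∈ e.source ∧ e.source ⊆ Ω ∧
      ContDiffOn ℝ ∞ e e.source ∧ ContDiffOn ℝ ∞ e.symm e.target ∧ (e z₀).1 = 0 ∧
      ∀ z ∈ e.source, (∀ u v, G z u v = planeForm (fderiv ℝ e z u) (fderiv ℝ e z v)) ∧
        ∀ u, fderiv ℝ y z u = ξ (y z) → fderiv ℝ e z u = (1, 0) := by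
  choose! w hyw using htan
  -- The dual form of `w` is the pull-back of `η`. Conversely, `w` is recovered from this smooth
  -- form by the inverse of the metric, which is how the pointwise choice of `w` is seen to be
  -- smooth.
  have hθ : ∀ z ∈ Ω, G z (w z) = (η (y z)).comp (fderiv ℝ y z) := by
    intro z hz
    ext u
    rw [hpull z hz, hyw z hz, h.g_ξ (hy z hz)]
    rfl
  have huniq : ∀ z ∈ Ω, ∀ u, fderiv ℝ y z u = ξ (y z) → u = w z := by
    intro z hz u hu
    refine hG.nondegenerate hz fun v ↦ ?_
    rw [hpull z hz, hpull z hz, hu, hyw z hz]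
  have cηy : ∀ z ∈ Ω, ContDiffAt ℝ ∞ (fun z ↦ η (y z)) z := fun z hz ↦
    (h.contDiffAt_η (hy z hz)).comp z (cy z hz)
  have cθ : ∀ z ∈ Ω, ContDiffAt ℝ ∞ (fun z ↦ (η (y z)).comp (fderiv ℝ y z)) z := fun z hz ↦
    (cηy z hz).clm_comp (cy z hz).fderiv_infty
  have cw : ∀ z ∈ Ω, ContDiffAt ℝ ∞ w z := by
    intro z hz
    have h1 : ContDiffAt ℝ ∞ (fun z ↦ (G z).inverse ((η (y z)).comp (fderiv ℝ y z))) z :=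
      (hG.contDiffOn_inverse.contDiffAt (hG.isOpen.mem_nhds hz)).clm_apply (cθ z hz)
    refine h1.congr_of_eventuallyEq ?_
    filter_upwards [hG.isOpen.mem_nhds hz] with p hp
    rw [← hθ p hp]
    exact ((hG.isInvertible hp).inverse_apply_self _).symm
  -- Derivative of the relation `dy(w) = ξ ∘ y`; it lets the Killing equation of `ξ` be pulled back
  -- to `w`.
  have hD : ∀ z ∈ Ω, ∀ v, fderiv ℝ (fderiv ℝ y) z v (w z) + fderiv ℝ y z (fderiv ℝ w z v) =
      fderiv ℝ ξ (y z) (fderiv ℝ y z v) := by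
    intro z hz v
    have e : (fun p ↦ fderiv ℝ y p (w p)) =ᶠ[𝓝 z] fun p ↦ ξ (y p) := by
      filter_upwards [hG.isOpen.mem_nhds hz] with p hp using hyw p hp
    have e1 := congrArg (fun L : V →L[ℝ] E ↦ L v) e.fderiv_eq
    rw [fderiv_clm_apply₁ (cy z hz).fderiv_infty.differentiableAt_infty
      (cw z hz).differentiableAt_infty, fderiv_comp_apply' (y := y)
      (h.contDiffAt_ξ (hy z hz)).differentiableAt_infty (cy z hz).differentiableAt_infty] at e1
    exact e1
  suffices H : ∃ e : OpenPartialHomeomorph V (ℝ × ℝ), z₀ ∈ e.source ∧ e.source ⊆ Ω ∧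
      ContDiffOn ℝ ∞ e e.source ∧ ContDiffOn ℝ ∞ e.symm e.target ∧ (e z₀).1 = 0 ∧
      ∀ z ∈ e.source, (∀ u v, G z u v = planeForm (fderiv ℝ e z u) (fderiv ℝ e z v)) ∧
        fderiv ℝ e z (w z) = (1, 0) by
    obtain ⟨e, h1, h2, h3, h4, h5, h6⟩ := H
    exact ⟨e, h1, h2, h3, h4, h5, fun z hz ↦ ⟨(h6 z hz).1, fun u hu ↦ by
      rw [huniq z (h2 hz) u hu]; exact (h6 z hz).2⟩⟩
  refine hG.exists_flat_coordinates hdim cw ?_ ?_ ?_ hz₀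
  · intro z hz
    rw [hpull z hz, hyw z hz, h.g_ξ_ξ (hy z hz)]
  · intro z hz u v
    have dy := (cy z hz).differentiableAt_infty
    have dy' := (cy z hz).fderiv_infty.differentiableAt_infty
    have dg := (h.isMetricOn.contDiffAt (hy z hz)).differentiableAt_infty
    have dG := (hG.contDiffAt hz).differentiableAt_infty
    have cc : ∀ u : V, DifferentiableAt ℝ (fun _ : V ↦ u) z := fun u ↦ differentiableAt_const u
    have e : (fun p ↦ G p u v) =ᶠ[𝓝 z] fun p ↦ g (y p) (fderiv ℝ y p u) (fderiv ℝ y p v) := by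
      filter_upwards [hG.isOpen.mem_nhds hz] with p hp using hpull p hp u v
    have e1 := congrArg (fun L : V →L[ℝ] ℝ ↦ L (w z)) e.fderiv_eq
    rw [fderiv_clm_apply₂ dG (cc u) (cc v), fderiv_clm_apply₂ (L := fun p ↦ g (y p))
      (dg.comp z dy) (dy'.clm_apply (cc u)) (dy'.clm_apply (cc v)),
      fderiv_comp_apply' (y := y) dg dy, fderiv_clm_apply₁ dy' (cc u),
      fderiv_clm_apply₁ dy' (cc v), hyw z hz] at e1
    simp only [fderiv_fun_const, Pi.zero_apply, _root_.zero_apply, map_zero, add_zero] at e1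
    rw [e1, hpull z hz, hpull z hz]
    have e2 := h.killing (hy z hz) (fderiv ℝ y z u) (fderiv ℝ y z v)
    rw [← hD z hz, ← hD z hz, (cy z hz).fderiv_apply_comm u, (cy z hz).fderiv_apply_comm v] at e2
    simp only [map_add, _root_.add_apply] at e2
    linarith
  · intro z hz u v
    have dy := (cy z hz).differentiableAt_infty
    have dy' := (cy z hz).fderiv_infty.differentiableAt_infty
    have dη := (h.contDiffAt_η (hy z hz)).differentiableAt_infty
    have cc : ∀ u : V, DifferentiableAt ℝ (fun _ : V ↦ u) z := fun u ↦ differentiableAt_const u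
    have hw0 : w z ≠ 0 := fun h0 ↦ h.ξ_ne_zero (hy z hz) (by rw [← hyw z hz, h0, map_zero])
    have e : (fun p ↦ G p (w p)) =ᶠ[𝓝 z] fun p ↦ (η (y p)).comp (fderiv ℝ y p) := by
      filter_upwards [hG.isOpen.mem_nhds hz] with p hp using hθ p hp
    have k : ∀ u v, fderiv ℝ (fun p ↦ (η (y p)).comp (fderiv ℝ y p)) z u v =
        fderiv ℝ η (y z) (fderiv ℝ y z u) (fderiv ℝ y z v)
          + η (y z) (fderiv ℝ (fderiv ℝ y) z u v) := by
      intro u v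
      have e1 : fderiv ℝ (fun p ↦ (η (y p)).comp (fderiv ℝ y p)) z u v =
          fderiv ℝ (fun p ↦ η (y p) (fderiv ℝ y p v)) z u := by
        have := fderiv_clm_apply₁ (cθ z hz).differentiableAt_infty (cc v) u
        simp only [fderiv_fun_const, Pi.zero_apply, _root_.zero_apply, map_zero, add_zero] at this
        exact this.symm
      rw [e1, fderiv_clm_apply₁ (L := fun p ↦ η (y p)) (dη.comp z dy) (dy'.clm_apply (cc v)),
        fderiv_comp_apply' (y := y) dη dy, fderiv_clm_apply₁ dy' (cc v)]
      simp only [fderiv_fun_const, Pi.zero_apply, _root_.zero_apply, map_zero, add_zero]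
    rw [e.fderiv_eq]
    -- The pull-back of `dη` vanishes on `w`, because `dη(ξ, ·) = 0`; on a plane it is therefore
    -- zero.
    refine apply_comm_of_finrank_two hdim hw0 (fun u ↦ ?_) u v
    rw [k, k, (cy z hz).fderiv_apply_comm u, hyw z hz, h.fderiv_η_ξ (hy z hz)]
    linarith [h.lie_η (hy z hz) (fderiv ℝ y z u)]

end FlatCoordinates

/-! ### Existence of flat flow coordinates on the surface. -/

section FlowCoordinates

open Filter Topology Metric

variable {E : Type*} [NormedAddCommGroup E] [NormedSpace ℝ E] [FiniteDimensional ℝ E]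
  {N : Type*} [TopologicalSpace N] [ChartedSpace E N] [IsManifold 𝓘(ℝ, E) ∞ N]
  {E' : Type*} [NormedAddCommGroup E'] [NormedSpace ℝ E'] [FiniteDimensional ℝ E']
  {M : Type*} [TopologicalSpace M] [ChartedSpace E' M] [IsManifold 𝓘(ℝ, E') ∞ M]
  {S : ContactMetricStructure 𝓘(ℝ, E) N} {g : SmoothMetric 𝓘(ℝ, E') M} {f : M → N}

lemma OpenPartialHomeomorph.fderiv_fderiv_symm {X Y : Type*} [NormedAddCommGroup X]
    [NormedSpace ℝ X] [NormedAddCommGroup Y] [NormedSpace ℝ Y] (e : OpenPartialHomeomorph X Y)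
    (he : ContDiffOn ℝ ∞ e e.source) (he' : ContDiffOn ℝ ∞ e.symm e.target) {q : Y}
    (hq : q ∈ e.target) (v : Y) :
    fderiv ℝ e (e.symm q) (fderiv ℝ e.symm q v) = v := by
  have h1 := (he.contDiffAt (e.open_source.mem_nhds (e.map_target hq))).differentiableAt_infty
  have h2 := (he'.contDiffAt (e.open_target.mem_nhds hq)).differentiableAt_infty
  rw [← fderiv_comp_apply' h1 h2]
  have h3 : (fun p ↦ e (e.symm p)) =ᶠ[𝓝 q] id := by
    filter_upwards [e.open_target.mem_nhds hq] with p hp using e.right_inv hp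
  rw [h3.fderiv_eq, fderiv_id]
  rfl

/-- The coordinates are constructed in the charts at `p` and `f p`. Their domain is kept inside both
charts, so that one chart of `N` serves the whole rectangle in the unique continuation argument. -/
lemma IsIsometricImmersion.exists_coordinates (hS : S.IsSasakian)
    (hf : IsIsometricImmersion g S.g f) (hdim : Module.finrank ℝ E' = 2)
    (htan : ∀ p, ∃ w, mfderiv 𝓘(ℝ, E') 𝓘(ℝ, E) f p w = S.ξ (f p)) (p : M) :
    ∃ e : OpenPartialHomeomorph E' (ℝ × ℝ), extChartAt 𝓘(ℝ, E') p p ∈ e.source ∧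
      (∀ z ∈ e.source, z ∈ (extChartAt 𝓘(ℝ, E') p).target ∧
        f ((extChartAt 𝓘(ℝ, E') p).symm z) ∈ (chartAt E (f p)).source) ∧
      ContDiffOn ℝ ∞ e e.source ∧ ContDiffOn ℝ ∞ e.symm e.target ∧
      (e (extChartAt 𝓘(ℝ, E') p p)).1 = 0 ∧
      ∀ q ∈ (chartAt E' p).source, extChartAt 𝓘(ℝ, E') p q ∈ e.source →
        (∀ u v, g.inner q u v =
          planeForm (fderiv ℝ e (extChartAt 𝓘(ℝ, E') p q) (toChart 𝓘(ℝ, E') p q u))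
            (fderiv ℝ e (extChartAt 𝓘(ℝ, E') p q) (toChart 𝓘(ℝ, E') p q v))) ∧
        ∀ w, mfderiv 𝓘(ℝ, E') 𝓘(ℝ, E) f q w = S.ξ (f q) →
          fderiv ℝ e (extChartAt 𝓘(ℝ, E') p q) (toChart 𝓘(ℝ, E') p q w) = (1, 0) := by
  set x := f p with hx
  let Ω : Set E' := (extChartAt 𝓘(ℝ, E') p).target ∩
    (extChartAt 𝓘(ℝ, E') p).symm ⁻¹' (f ⁻¹' (chartAt E x).source)
  have hΩ : IsOpen Ω := (continuousOn_extChartAt_symm p).isOpen_inter_preimage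
    (isOpen_extChartAt_target p) ((chartAt E x).open_source.preimage hf.1.continuous)
  have hG : IsMetricOn (metricRep g p) Ω := by
    have h := isMetricOn_metricRep g p
    exact ⟨hΩ, h.contDiffOn.mono inter_subset_left, fun z hz ↦ h.symm z hz.1,
      fun z hz ↦ h.pos z hz.1⟩
  have key : ∀ P : E' → Prop, (∀ q ∈ (chartAt E' p).source, f q ∈ (chartAt E x).source →
      P (extChartAt 𝓘(ℝ, E') p q)) → ∀ z ∈ Ω, P z := by
    intro P hP z hz
    rw [← (extChartAt 𝓘(ℝ, E') p).right_inv hz.1]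
    exact hP _ (extChartAt_symm_mem hz.1) hz.2
  have hm : ∀ q ∈ (chartAt E' p).source, f q ∈ (chartAt E x).source → ∀ u,
      fderiv ℝ (repMap E E' p x f) (extChartAt 𝓘(ℝ, E') p q) (toChart 𝓘(ℝ, E') p q u) =
      toChart 𝓘(ℝ, E) x (f q) (mfderiv 𝓘(ℝ, E') 𝓘(ℝ, E) f q u) := fun q hq hqx u ↦
    (toChart_mfderiv (hf.1 q) hq hqx u).symm
  obtain ⟨e, h1, h2, h3, h4, h5, h6⟩ := (hS.isSasakianOn x).exists_flat_coordinates hdim hG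
    (y := repMap E E' p x f) (z₀ := extChartAt 𝓘(ℝ, E') p p)
    (key _ fun q hq hqx ↦ (hf.1 q).repMap hq hqx)
    (key _ fun q hq hqx ↦ by
      rw [repMap_apply hq]
      exact extChartAt_mem_target hqx)
    (key _ fun q hq hqx u' v' ↦ by
      obtain ⟨u, rfl⟩ : ∃ u, u' = toChart 𝓘(ℝ, E') p q u := ⟨_, (toChart_ofChart hq u').symm⟩
      obtain ⟨v, rfl⟩ : ∃ v, v' = toChart 𝓘(ℝ, E') p q v := ⟨_, (toChart_ofChart hq v').symm⟩
      rw [hm q hq hqx, hm q hq hqx, repMap_apply hq, metricRep_apply g hq,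
        metricRep_apply S.g hqx, hf.2])
    (key _ fun q hq hqx ↦ by
      obtain ⟨w, hw⟩ := htan q
      exact ⟨toChart 𝓘(ℝ, E') p q w, by rw [hm q hq hqx, hw, repMap_apply hq, fieldRep_apply hqx]⟩)
    ⟨extChartAt_mem_target (mem_chart_source E' p), by
      rw [mem_preimage, extChartAt_symm_apply (mem_chart_source E' p)]
      exact mem_chart_source E x⟩
  refine ⟨e, h1, fun z hz ↦ h2 hz, h3, h4, h5, fun q hq hqe ↦ ⟨fun u v ↦ ?_, fun w hw ↦ ?_⟩⟩
  · rw [← metricRep_apply g hq]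
    exact (h6 _ hqe).1 _ _
  · have hqx : f q ∈ (chartAt E x).source := by
      have := (h2 hqe).2
      rwa [mem_preimage, extChartAt_symm_apply hq] at this
    refine (h6 _ hqe).2 _ ?_
    rw [hm q hq hqx, hw, repMap_apply hq, fieldRep_apply hqx]

/-- A surface tangent to the characteristic field of a Sasakian manifold is locally parametrized,
isometrically, by a rectangle of the plane, one family of lines being mapped to integral curves. -/
theorem exists_isFlowParam (hS : S.IsSasakian) (hf : IsIsometricImmersion g S.g f)
    (hdim : Module.finrank ℝ E' = 2)
    (htan : ∀ p, ∃ w, mfderiv 𝓘(ℝ, E') 𝓘(ℝ, E) f p w = S.ξ (f p)) (p : M) :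
    ∃ (ε a b : ℝ) (ψ : OpenPartialHomeomorph (ℝ × ℝ) M), 0 < ε ∧
      ψ.source = Ioo (-ε) ε ×ˢ Ioo a b ∧ p ∈ ψ.target ∧
      ContMDiffOn 𝓘(ℝ, ℝ × ℝ) 𝓘(ℝ, E') ∞ ψ ψ.source ∧
      ContMDiffOn 𝓘(ℝ, E') 𝓘(ℝ, ℝ × ℝ) ∞ ψ.symm ψ.target ∧
      IsFlowParam E' S f ψ ψ.source ∧
      ∀ q ∈ ψ.source, f (ψ q) ∈ (chartAt E (f p)).source := by
  obtain ⟨e, he, heΩ, ce, ce', he0, hev⟩ := hf.exists_coordinates hS hdim htan p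
  set c := extChartAt 𝓘(ℝ, E') p with hc
  have hpt : e (c p) ∈ e.target := e.map_source he
  obtain ⟨ε, hε, hball⟩ := Metric.isOpen_iff.1 e.open_target _ hpt
  set s₀ := (e (c p)).2 with hs₀
  -- A ball of the supremum norm is a rectangle; it is centred on the line `t = 0`, as the first
  -- coordinate of `p` is `0`.
  have hR : ball (e (c p)) ε = Ioo (-ε) ε ×ˢ Ioo (s₀ - ε) (s₀ + ε) := by
    rw [← Prod.mk.eta (p := e (c p)), he0, ← ball_prod_same, Real.ball_eq_Ioo, Real.ball_eq_Ioo,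
      zero_sub, zero_add]
  let ψ₀ : OpenPartialHomeomorph (ℝ × ℝ) M := ((chartAt E' p).trans e).symm
  let ψ := ψ₀.restrOpen (ball (e (c p)) ε) isOpen_ball
  have hψ : ∀ q, ψ q = c.symm (e.symm q) := fun q ↦ rfl
  have hsrc : ψ.source = ball (e (c p)) ε := by
    rw [ψ₀.restrOpen_source]
    refine inter_eq_right.2 fun q hq ↦ ?_
    rw [OpenPartialHomeomorph.symm_source, OpenPartialHomeomorph.trans_target]
    refine ⟨hball hq, ?_⟩
    have := (heΩ _ (e.map_target (hball hq))).1
    rw [hc, extChartAt_target] at this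
    simpa using this
  have hmem : ∀ q ∈ ψ.source, q ∈ e.target ∧ e.symm q ∈ e.source := fun q hq ↦
    ⟨hball (hsrc ▸ hq), e.map_target (hball (hsrc ▸ hq))⟩
  have hm : ∀ q ∈ ψ.source, ψ q ∈ (chartAt E' p).source ∧ c (ψ q) = e.symm q := fun q hq ↦
    ⟨extChartAt_symm_mem (heΩ _ (hmem q hq).2).1, c.right_inv (heΩ _ (hmem q hq).2).1⟩
  have cψ : ∀ q ∈ ψ.source, ContMDiffAt 𝓘(ℝ, ℝ × ℝ) 𝓘(ℝ, E') ∞ ψ q := fun q hq ↦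
    ContMDiffAt.comp (g := c.symm) (f := e.symm) q (contMDiffAt_extChartAt_symm_of_mem (heΩ _ (hmem q hq).2).1)
      (ce'.contDiffAt (e.open_target.mem_nhds (hmem q hq).1)).contMDiffAt
  have cψ' : ContMDiffOn 𝓘(ℝ, ℝ × ℝ) 𝓘(ℝ, E') ∞ ψ ψ.source := fun q hq ↦
    (cψ q hq).contMDiffWithinAt
  have hpψ : p = ψ (e (c p)) := by
    rw [hψ, e.left_inv he]
    exact (extChartAt_symm_apply (mem_chart_source E' p)).symm
  have hD : ∀ q ∈ ψ.source, ∀ v : ℝ × ℝ,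
      toChart 𝓘(ℝ, E') p (ψ q) (mfderiv 𝓘(ℝ, ℝ × ℝ) 𝓘(ℝ, E') ψ q v) = fderiv ℝ e.symm q v := by
    intro q hq v
    rw [toChart_mfderiv_modelSpace (cψ q hq) (hm q hq).1]
    have : (fun q ↦ extChartAt 𝓘(ℝ, E') p (ψ q)) =ᶠ[𝓝 q] e.symm := by
      filter_upwards [ψ.open_source.mem_nhds hq] with q' hq' using (hm q' hq').2
    rw [this.fderiv_eq]
  have hcomp : ∀ q ∈ ψ.source, ∀ v : ℝ × ℝ, mfderiv 𝓘(ℝ, ℝ × ℝ) 𝓘(ℝ, E) (f ∘ ψ) q v =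
      mfderiv 𝓘(ℝ, E') 𝓘(ℝ, E) f (ψ q) (mfderiv 𝓘(ℝ, ℝ × ℝ) 𝓘(ℝ, E') ψ q v) := fun q hq v ↦
    mfderiv_comp_apply q ((hf.1 (ψ q)).mdifferentiableAt (by simp))
      ((cψ q hq).mdifferentiableAt (by simp)) v
  have hed : ∀ q ∈ ψ.source, ∀ v : ℝ × ℝ, fderiv ℝ e (c (ψ q))
      (toChart 𝓘(ℝ, E') p (ψ q) (mfderiv 𝓘(ℝ, ℝ × ℝ) 𝓘(ℝ, E') ψ q v)) = v := by
    intro q hq v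
    rw [hD q hq, (hm q hq).2, e.fderiv_fderiv_symm ce ce' (hmem q hq).1]
  have hce : ∀ q ∈ ψ.source, c (ψ q) ∈ e.source := fun q hq ↦ by
    rw [(hm q hq).2]; exact (hmem q hq).2
  -- The coordinates are isometric, so their differential is injective. Hence `∂_t` is the vector
  -- that `f` maps to `ξ`, both having components `(1, 0)`.
  have hinj : ∀ q ∈ ψ.source, ∀ u v : TangentSpace 𝓘(ℝ, E') (ψ q),
      fderiv ℝ e (c (ψ q)) (toChart 𝓘(ℝ, E') p (ψ q) u) =
        fderiv ℝ e (c (ψ q)) (toChart 𝓘(ℝ, E') p (ψ q) v) → u = v := by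
    intro q hq u v huv
    have h0 : fderiv ℝ e (c (ψ q)) (toChart 𝓘(ℝ, E') p (ψ q) (u - v)) = 0 := by
      rw [map_sub (toChart 𝓘(ℝ, E') p (ψ q))]
      exact (map_sub _ _ _).trans (sub_eq_zero.2 huv)
    have h1 := (hev (ψ q) (hm q hq).1 (hce q hq)).1 (u - v) (u - v)
    rw [h0, map_zero] at h1
    by_contra hne
    exact (g.pos (ψ q) (u - v) (sub_ne_zero.2 hne)).ne' h1
  refine ⟨ε, s₀ - ε, s₀ + ε, ψ, hε, hsrc.trans hR, ?_, cψ', ?_, ⟨cψ', ⟨ψ.open_source,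
    hf.1.comp_contMDiffOn cψ', fun q hq ↦ ?_⟩, fun q hq u v ↦ ?_⟩, fun q hq ↦ ?_⟩
  · rw [hpψ]
    exact ψ.map_source (by rw [hsrc]; exact mem_ball_self hε)
  · intro m hmt
    have hq := ψ.map_target hmt
    have h1 := (hm _ hq).1
    have h2 := hce _ hq
    rw [ψ.right_inv hmt] at h1 h2
    refine ContMDiffAt.contMDiffWithinAt ?_
    exact ContMDiffAt.comp (g := e) (f := c) m
      (ce.contDiffAt (e.open_source.mem_nhds h2)).contMDiffAt (contMDiffAt_extChartAt_of_mem h1)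
  · obtain ⟨w, hw⟩ := htan (ψ q)
    have h1 := (hev (ψ q) (hm q hq).1 (hce q hq)).2 w hw
    rw [hcomp q hq, hinj q hq _ w ((hed q hq _).trans h1.symm)]
    exact hw
  · rw [hcomp q hq, hcomp q hq, hf.2, (hev (ψ q) (hm q hq).1 (hce q hq)).1, hed q hq, hed q hq]
  · exact (heΩ _ (hmem q hq).2).2

end FlowCoordinates

/-! ### From proper-biharmonic surfaces to Legendre curves. -/

section Direct

open Filter Topology

variable {E : Type*} [NormedAddCommGroup E] [NormedSpace ℝ E] [FiniteDimensional ℝ E]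
  {N : Type*} [TopologicalSpace N] [ChartedSpace E N] [IsManifold 𝓘(ℝ, E) ∞ N]
  {E' : Type*} [NormedAddCommGroup E'] [NormedSpace ℝ E'] [FiniteDimensional ℝ E']
  {M : Type*} [TopologicalSpace M] [ChartedSpace E' M] [IsManifold 𝓘(ℝ, E') ∞ M]
  {S : ContactMetricStructure 𝓘(ℝ, E) N} {g : SmoothMetric 𝓘(ℝ, E') M} {f : M → N}

lemma IsIsometricImmersion.injective_mfderiv {h : SmoothMetric 𝓘(ℝ, E) N}
    (hf : IsIsometricImmersion g h f) (p : M) :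
    Function.Injective (mfderiv 𝓘(ℝ, E') 𝓘(ℝ, E) f p) := by
  rw [injective_iff_map_eq_zero]
  intro u hu
  by_contra h0
  have h1 := g.pos p u h0
  rw [← hf.2, hu, map_zero] at h1
  exact lt_irrefl _ h1

/-- The flow map of a parametrization by a rectangle. -/
lemma IsFlowMap.isFlowImage {ξ : Π x : N, TangentSpace 𝓘(ℝ, E) x} {F : ℝ × ℝ → N} {ε a b : ℝ}
    (hF : IsFlowMap ξ F (Ioo (-ε) ε ×ˢ Ioo a b)) {t s : ℝ} (ht : t ∈ Ioo (-ε) ε)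
    (hs : s ∈ Ioo a b) : IsFlowImage ξ t (F (0, s)) (F (t, s)) := by
  refine ⟨-ε, ε, fun r ↦ F (r, s), ⟨by linarith [ht.1.trans ht.2], by linarith [ht.1.trans ht.2]⟩,
    ht, fun r hr ↦ ?_, rfl, rfl⟩
  have h1 := hasMFDerivAt_slice_fst ((hF.contMDiffAt (q := (r, s)) ⟨hr, hs⟩).mdifferentiableAt
    (by simp))
  refine HasMFDerivAt.hasMFDerivWithinAt ?_
  have e : (1 : ℝ →L[ℝ] ℝ).smulRight (ξ (F (r, s))) =
      (mfderiv 𝓘(ℝ, ℝ × ℝ) 𝓘(ℝ, E) F (r, s)).comp (ContinuousLinearMap.inl ℝ ℝ ℝ) := by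
    refine ContinuousLinearMap.ext_ring ?_
    exact (one_smul ℝ _).trans (hF.mfderiv_fst (r, s) ⟨hr, hs⟩).symm
  rw [e]
  exact h1

/-- `∂_t = ξ` and `∂_s` are orthonormal, so `η(∂_s) = g(ξ, ∂_s) = 0` and `∂_s` has length one. -/
lemma IsFlowParam.isLegendreCurve (hS : S.IsSasakian) {ψ : ℝ × ℝ → M} {Q : Set (ℝ × ℝ)}
    (h : IsFlowParam E' S f ψ Q) {t a b : ℝ} (hQ : ∀ s ∈ Ioo a b, (t, s) ∈ Q) :
    S.IsLegendreCurve (fun s ↦ f (ψ (t, s))) a b := by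
  have hF := h.isFlowMap
  constructor
  · intro s hs
    have h1 : ContMDiffAt 𝓘(ℝ, ℝ) 𝓘(ℝ, E) ∞ (fun r ↦ (f ∘ ψ) (t, r)) s :=
      (hF.contMDiffAt (hQ s hs)).comp s (contDiff_prodMk_right t).contMDiff.contMDiffAt
    exact h1.contMDiffWithinAt
  · intro s hs
    have hd := mfderiv_slice_snd ((hF.contMDiffAt (hQ s hs)).mdifferentiableAt (by simp))
      (γ := fun s ↦ f (ψ (t, s))) EventuallyEq.rfl
    have h1 := h.isometry _ (hQ s hs) (1, 0) (0, 1)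
    have h2 := h.isometry _ (hQ s hs) (0, 1) (0, 1)
    rw [hF.mfderiv_fst _ (hQ s hs)] at h1
    have h3 := (hS.inner_ξ _ _).symm.trans h1
    simp only [planeForm_apply, mul_zero, mul_one, add_zero, zero_add] at h2 h3
    have hleg : ∀ (y : N) (v v' : TangentSpace 𝓘(ℝ, E) y) (_ : v = v'),
        S.η y v' = 0 → S.g.inner y v' v' = 1 → S.η y v = 0 ∧ S.g.inner y v v = 1 := by
      rintro y v _ rfl h h'
      exact ⟨h, h'⟩
    exact hleg _ _ _ hd h3 h2

/-- A proper-biharmonic surface whose image is invariant under the flow is locally the flow of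
proper-biharmonic Legendre curves. -/
theorem isLocallyFlow_of_isProperBiharmonicOn [SecondCountableTopology M] [ConnectedSpace M]
    (hS : S.IsSasakian) (hf : IsIsometricImmersion g S.g f) (hdim : Module.finrank ℝ E' = 2)
    (hinv : IsFlowInvariant S.ξ (range f)) (h : IsProperBiharmonicOn g S.g f univ) :
    S.IsLocallyFlowOfProperBiharmonicLegendre 𝓘(ℝ, E') f := by
  have htan : ∀ p, ∃ w, mfderiv 𝓘(ℝ, E') 𝓘(ℝ, E) f p w = S.ξ (f p) := fun p ↦
    mem_range_mfderiv_of_isFlowInvariant hf.1 S.contMDiff_ξ hinv (hf.injective_mfderiv p)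
  have hcoord := exists_isFlowParam hS hf hdim htan
  -- The interior of the zero set of the tension field. It is open and closed, and not all of `M`,
  -- hence empty; so no coordinate rectangle consists of zeros.
  let A : Set M := {m | ∀ᶠ m' in 𝓝 m, tensionField g S.g f m' = 0}
  have hA : A = ∅ := by
    have hopen : IsOpen A := isOpen_iff_mem_nhds.2 fun m hm ↦ hm.eventually_nhds
    -- A rectangle around a limit point meets `A` in an open set, and unique continuation spreads
    -- the zeros over the rectangle.
    have hclosed : IsClosed A := by
      refine isClosed_of_closure_subset fun p hp ↦ ?_
      obtain ⟨ε, a, b, ψ, hε, hsrc, hpt, -, -, hP, hx⟩ := hcoord p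
      obtain ⟨m, hm, hmA⟩ := mem_closure_iff.1 hp _ ψ.open_target hpt
      have hq := ψ.map_target hm
      have h0 : ∀ᶠ q in 𝓝 (ψ.symm m), tensionField g S.g f (ψ q) = 0 := by
        refine (ψ.continuousAt hq).eventually (p := fun m' ↦ tensionField g S.g f m' = 0) ?_
        rw [ψ.right_inv hm]
        exact hmA
      filter_upwards [ψ.open_target.mem_nhds hpt] with m' hm'
      have := hP.tensionField_eq_zero hf hdim hS hsrc hx (fun q _ ↦ h.2.1 _ (mem_univ _)) hq h0
        (ψ.map_target hm')
      rwa [ψ.right_inv hm'] at this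
    refine (isClopen_iff.1 ⟨hclosed, hopen⟩).resolve_right fun hu ↦ h.2.2 fun p _ ↦ ?_
    have : p ∈ A := hu ▸ mem_univ p
    exact this.self_of_nhds
  intro p
  obtain ⟨ε, a, b, ψ, hε, hsrc, hpt, hψ, hψ', hP, -⟩ := hcoord p
  have h0 : (0 : ℝ) ∈ Ioo (-ε) ε := ⟨by linarith, hε⟩
  have hQ : ∀ t ∈ Ioo (-ε) ε, ∀ s ∈ Ioo a b, (t, s) ∈ ψ.source := fun t ht s hs ↦ by
    rw [hsrc]; exact ⟨ht, hs⟩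
  have hleg := hP.isLegendreCurve hS (hQ 0 h0)
  have hc : ∀ s ∈ Ioo a b, _ := fun s hs ↦ hP.curve_iff hf hdim hS (t := 0)
    (γ := fun s ↦ f (ψ (0, s))) (hQ 0 h0 s hs) (Eventually.of_forall fun _ ↦ rfl)
  refine ⟨ε, a, b, fun s ↦ f (ψ (0, s)), ψ, hleg, ⟨hleg.1, fun s hs ↦ ?_, fun hall ↦ ?_⟩, hsrc,
    hpt, hψ, hψ', fun t ht s hs ↦ ?_⟩
  · exact (hc s hs).2.2 (h.2.1 _ (mem_univ _))
  · have hpA : p ∈ A := by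
      filter_upwards [ψ.open_target.mem_nhds hpt] with m hm
      have hq := ψ.map_target hm
      rw [hsrc] at hq
      have h1 := (hc _ hq.2).1.1 (hall _ hq.2)
      have h2 := (hP.iff_of_mem hf hdim hS (fun r hr ↦ hQ r hr _ hq.2) h0 hq.1).1.1 h1
      rwa [Prod.mk.eta, ψ.right_inv hm] at h2
    rw [hA] at hpA
    exact hpA
  · have hF := hP.isFlowMap
    rw [hsrc] at hF
    exact hF.isFlowImage ht hs

end Direct

end

/-! ### The theorem. -/

theorem mainTheorem7 {n : ℕ}
    {N : Type*} [TopologicalSpace N] [T2Space N] [SecondCountableTopology N]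
    [ChartedSpace (EuclideanSpace ℝ (Fin (2 * n + 1))) N] [IsManifold (𝓡 (2 * n + 1)) ∞ N]
    (S : ContactMetricStructure (𝓡 (2 * n + 1)) N) (c : ℝ) (hS : S.IsSasakianSpaceForm c)
    {M : Type*} [TopologicalSpace M] [T2Space M] [SecondCountableTopology M] [ConnectedSpace M]
    [ChartedSpace (EuclideanSpace ℝ (Fin 2)) M] [IsManifold (𝓡 2) ∞ M]
    (g : SmoothMetric (𝓡 2) M) (f : M → N) (hf : IsIsometricImmersion g S.g f)
    (hinv : IsFlowInvariant S.ξ (range f)) :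
    IsProperBiharmonicOn g S.g f univ ↔ S.IsLocallyFlowOfProperBiharmonicLegendre (𝓡 2) f :=
  have hdim : Module.finrank ℝ (EuclideanSpace ℝ (Fin 2)) = 2 := finrank_euclideanSpace_fin
  ⟨isLocallyFlow_of_isProperBiharmonicOn hS.1 hf hdim hinv,
    isProperBiharmonicOn_of_isLocallyFlow hS.1 hf hdim⟩
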